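/- **Setting.** Let $\psi:\mathbb R\to\mathbb R$ be an obstacle function such that (A1) $\psi$ is uniformly continuous; (A2) $\psi<0$ on $(-\infty,0]$ and on $[1,\infty)$; (A3) $\max_{[0,1]}\psi>0$. Let $W^{2,2}_{\rm imm}(0,1;\mathbb R^2)$ be the set of $\gamma=(\gamma^1,\gamma^2)\in W^{2,2}(0,1;\mathbb R^2)$ with $\gamma'(x)\neq 0$ for all $x\in[0,1]$, and let $A_{\rm sym}$ be the set of all $\gamma\in W^{2,2}_{\rm imm}(0,1;\mathbb R^2)$ with $\gamma(0)=(0,0)$, $\gamma(1)=(1,0)$, $\gamma^2(x)\ge\psi(\gamma^1(x))$ and $\gamma(1-x)=(1-\gamma^1(x),\gamma^2(x))$ for all $x\in[0,1]$. For $\lambda>0$ put $\mathcal E_\lambda[\gamma]=B[\gamma]+\lambda L[\gamma]=\int_\gamma|\kappa|^2\,ds+\lambda\int_\gamma ds$, where $\partial_s=|\gamma'|^{-1}\frac{d}{dx}$ and $\kappa=\partial_s^2\gamma$. A minimizer of $\mathcal E_\lambda$ in $A_{\rm sym}$ is a $\gamma\in A_{\rm sym}$ with $\mathcal E_\lambda[\gamma]\le\mathcal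 E_\lambda[\sigma]$ for all $\sigma\in A_{\rm sym}$. The coincidence set of $\gamma$ is $I_\gamma=\{x\in[0,1]:\gamma^2(x)=\psi(\gamma^1(x))\}$. **The longer arc.** Let $\mathrm F(x,q)=\int_0^x(1-q^2\sin^2\theta)^{-1/2}d\theta$, $\mathrm E(x,q)=\int_0^x(1-q^2\sin^2\theta)^{1/2}d\theta$, $\mathrm K(q)=\mathrm F(\frac\pi2,q)$, $\mathrm E(q)=\mathrm E(\frac\pi2,q)$; let $\mathrm{am}(\cdot,q)$ be the inverse of $\mathrm F(\cdot,q)$ and $\mathrm{cn}=\cos\mathrm{am}$. Let $\hat q\approx0.79257$ be the unique root in $[\frac1{\sqrt2},1)$ of $f(q)=(4q^4-5q^2+1)\mathrm K(q)+(-8q^4+8q^2-1)\mathrm E(q)$, let $q_*\approx0.90891$ be the unique root in $(0,1)$ of $2\mathrm E(q)-\mathrm K(q)$, let $g(q)=8(2\mathrm E(q)-\mathrm K(q))^2(2q^2-1)$ and $\hat\lambda=g(\hat q)\approx0.70107$. For $0<\lambda\le\hat\lambda$ let $q=q_2(\lambda)$ be the unique solution of $g(q)=\lambda$ in $[\hat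 q,q_*)$, let $\alpha=2(2\mathrm E(q)-\mathrm K(q))$, and define the $(\lambda,1,1)$-longer arc by $$\gamma_{\rm larc}^{\lambda,1,1}(s)=\frac1\alpha\begin{pmatrix}2\mathrm E(\mathrm{am}(\alpha s-\mathrm K(q),q),q)+2\mathrm E(q)-\alpha s\\ 2q\,\mathrm{cn}(\alpha s-\mathrm K(q),q)\end{pmatrix},\qquad 0\le s\le \ell_\lambda:=\frac{2\mathrm K(q)}\alpha .$$ **Theorem.** There is a constant $\bar\lambda\in(0,\hat\lambda]$, depending on $\psi$, such that for every $\lambda\in(0,\bar\lambda)$ each minimizer $\gamma$ of $\mathcal E_\lambda$ in $A_{\rm sym}$ does not touch the obstacle, i.e. $I_\gamma=\emptyset$. Moreover, for such $\lambda$ the minimizer exists, is unique up to reparametrization, and is given by the critical point $\gamma_{\rm larc}^{\lambda,1,1}$. That is: 1. $\gamma_{\rm larc}^{\lambda,1,1}$ is a smooth curve from $(0,0)$ to $(1,0)$ parametrized by arclength, whose signed curvature $k$ satisfies $2k''+k^3-\lambda k=0$ in $(0,\ell_\lambda)$ and $k(0)=k(\ell_\lambda)=0$; 2. its constant speed parametrization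 $x\mapsto\gamma_{\rm larc}^{\lambda,1,1}(\ell_\lambda x)$, $x\in[0,1]$, is a minimizer of $\mathcal E_\lambda$ in $A_{\rm sym}$; 3. every minimizer $\gamma$ of $\mathcal E_\lambda$ in $A_{\rm sym}$ has length $\ell_\lambda$ and arclength parametrization $\gamma_{\rm larc}^{\lambda,1,1}$, i.e. $\gamma(x)=\gamma_{\rm larc}^{\lambda,1,1}\big(\int_0^x|\gamma'|\big)$ for all $x\in[0,1]$. -/

import Mathlib

open Set MeasureTheory
open scoped ContDiff

noncomputable section

namespace ElasticObstacle

/-- The Euclidean plane. -/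
abbrev Plane : Type := EuclideanSpace ℝ (Fin 2)

/-! ### Immersed curves of class `W^{2,2}` on the unit interval -/

/-- `g` is a weak derivative of `f` on `(0,1)`, tested against `C^∞_c(0,1)`. -/
def HasWeakDeriv (f g : ℝ → Plane) : Prop :=
  ∀ φ : ℝ → ℝ, ContDiff ℝ ∞ φ → HasCompactSupport φ → tsupport φ ⊆ Ioo 0 1 →
    ∫ x in Ioo (0 : ℝ) 1, deriv φ x • f x = - ∫ x in Ioo (0 : ℝ) 1, φ x • g x

/-- `γ`, restricted to `[0,1]`, is the continuous representative of an element of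
`W^{2,2}(0,1; ℝ²)`. (It is then automatically of class `C¹` on `[0,1]`.) -/
def MemW22 (γ : ℝ → Plane) : Prop :=
  ContinuousOn γ (Icc 0 1) ∧
    ∃ v w : ℝ → Plane,
      MemLp v 2 (volume.restrict (Ioo 0 1)) ∧ MemLp w 2 (volume.restrict (Ioo 0 1)) ∧
        HasWeakDeriv γ v ∧ HasWeakDeriv v w

/-- The velocity `γ'` on `[0,1]` (one-sided at the endpoints). -/
def velocity (γ : ℝ → Plane) (x : ℝ) : Plane := derivWithin γ (Icc 0 1) x

/-- Immersed `W^{2,2}`-curves. -/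
def MemW22Imm (γ : ℝ → Plane) : Prop :=
  MemW22 γ ∧ ∀ x ∈ Icc (0 : ℝ) 1, velocity γ x ≠ 0

/-- The arclength derivative `∂ₛ f = f' / |γ'|` along `γ`. -/
def arcDeriv (γ f : ℝ → Plane) (x : ℝ) : Plane :=
  ‖velocity γ x‖⁻¹ • derivWithin f (Icc 0 1) x

/-- The curvature vector `κ = ∂ₛ² γ`. For an immersed `W^{2,2}`-curve it is defined for almost
every parameter. -/
def curvatureVec (γ : ℝ → Plane) : ℝ → Plane := arcDeriv γ (arcDeriv γ γ)

/-- The arclength `s(x) = ∫₀ˣ |γ'|`. -/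
def arclength (γ : ℝ → Plane) (x : ℝ) : ℝ := ∫ t in (0 : ℝ)..x, ‖velocity γ t‖

/-- The length `L[γ]`. -/
def length (γ : ℝ → Plane) : ℝ := arclength γ 1

/-- The bending energy `B[γ] = ∫ |κ|² ds`, where `ds = |γ'| dx`. -/
def bending (γ : ℝ → Plane) : ℝ :=
  ∫ x in (0 : ℝ)..1, ‖curvatureVec γ x‖ ^ 2 * ‖velocity γ x‖

/-- The length-penalized elastic energy `E_λ = B + λ L`. -/
def energy (lam : ℝ) (γ : ℝ → Plane) : ℝ := bending γ + lam * length γ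

/-- `c` is, on `[0, L[γ]]`, the arclength parametrization of `γ`. -/
def IsArclengthParam (γ c : ℝ → Plane) : Prop :=
  ∀ x ∈ Icc (0 : ℝ) 1, γ x = c (arclength γ x)

/-! ### The obstacle problem -/

/-- The standing assumptions on the obstacle function. -/
structure IsObstacle (ψ : ℝ → ℝ) : Prop where
  uniformContinuous : UniformContinuous ψ
  neg_left : ∀ x ≤ 0, ψ x < 0
  neg_right : ∀ x, 1 ≤ x → ψ x < 0
  pos_somewhere : ∃ x ∈ Icc (0 : ℝ) 1, 0 < ψ x

/-- The admissible set `A`. -/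
def admissible (ψ : ℝ → ℝ) : Set (ℝ → Plane) :=
  {γ | MemW22Imm γ ∧ γ 0 = !₂[0, 0] ∧ γ 1 = !₂[1, 0] ∧
    ∀ x ∈ Icc (0 : ℝ) 1, ψ (γ x 0) ≤ γ x 1}

/-- The admissible set `A_sym` of curves symmetric under reflection in the line `x = 1/2`. -/
def admissibleSym (ψ : ℝ → ℝ) : Set (ℝ → Plane) :=
  {γ | γ ∈ admissible ψ ∧ ∀ x ∈ Icc (0 : ℝ) 1, γ (1 - x) = !₂[1 - γ x 0, γ x 1]}

/-- The coincidence set `I_γ`. -/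
def coincidenceSet (ψ : ℝ → ℝ) (γ : ℝ → Plane) : Set ℝ :=
  {x | x ∈ Icc (0 : ℝ) 1 ∧ γ x 1 = ψ (γ x 0)}

/-- The (global) minimizers of `E_λ` in `A_sym`. -/
def symMinimizers (ψ : ℝ → ℝ) (lam : ℝ) : Set (ℝ → Plane) :=
  {γ | γ ∈ admissibleSym ψ ∧ ∀ σ ∈ admissibleSym ψ, energy lam γ ≤ energy lam σ}

/-! ### Elliptic integrals and functions (with modulus `q`) -/

/-- The incomplete elliptic integral of the first kind `F(x,q)`. -/
def ellF (x q : ℝ) : ℝ := ∫ θ in (0 : ℝ)..x, 1 / √(1 - q ^ 2 * Real.sin θ ^ 2)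

/-- The incomplete elliptic integral of the second kind `E(x,q)`. -/
def ellE (x q : ℝ) : ℝ := ∫ θ in (0 : ℝ)..x, √(1 - q ^ 2 * Real.sin θ ^ 2)

/-- The complete elliptic integral of the first kind `K(q)`. -/
def compK (q : ℝ) : ℝ := ellF (Real.pi / 2) q

/-- The complete elliptic integral of the second kind `E(q)`. -/
def compE (q : ℝ) : ℝ := ellE (Real.pi / 2) q

/-- The Jacobian amplitude `am(·,q)`, the inverse of the bijection `F(·,q) : ℝ → ℝ`, for
`0 ≤ q < 1`. -/
def jacobiAm (x q : ℝ) : ℝ := Function.invFun (fun ξ => ellF ξ q) x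

/-- The Jacobian elliptic function `cn`. -/
def jacobiCn (x q : ℝ) : ℝ := Real.cos (jacobiAm x q)

/-! ### The longer arcs -/

/-- The function `f` whose root in `[1/√2, 1)` is `q̂`. -/
def fAux (q : ℝ) : ℝ :=
  (4 * q ^ 4 - 5 * q ^ 2 + 1) * compK q + (-8 * q ^ 4 + 8 * q ^ 2 - 1) * compE q

/-- The function `g` relating the modulus of an arc to the penalization parameter. -/
def gAux (q : ℝ) : ℝ := 8 * (2 * compE q - compK q) ^ 2 * (2 * q ^ 2 - 1)

/-- The modulus `q̂ ≈ 0.79257`, the unique root of `f` in `[1/√2, 1)`. -/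
def qHat : ℝ := sInf {q | q ∈ Ico (1 / √2) 1 ∧ fAux q = 0}

/-- The modulus `q_* ≈ 0.90891`, the unique root of `2E - K` in `(0,1)`. -/
def qStar : ℝ := sInf {q | q ∈ Ioo (0 : ℝ) 1 ∧ 2 * compE q - compK q = 0}

/-- The threshold `λ̂ = g(q̂) ≈ 0.70107`. -/
def lambdaHat : ℝ := gAux qHat

/-- For `c ∈ (0, λ̂]`, the modulus `q₂(c)`: the unique solution of `g(q) = c` in `[q̂, q_*)`. -/
def qTwo (c : ℝ) : ℝ := sInf {q | q ∈ Ico qHat qStar ∧ gAux q = c}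

/-- The scaling parameter `α = 2n(2E(q) - K(q))`, `q = q₂(λ/n²)`, of the `(λ,1,n)`-longer arc. -/
def larcScale (lam : ℝ) (n : ℕ) : ℝ :=
  2 * n * (2 * compE (qTwo (lam / n ^ 2)) - compK (qTwo (lam / n ^ 2)))

/-- The length `2nK(q)/α`, `q = q₂(λ/n²)`, of the `(λ,1,n)`-longer arc. -/
def larcLength (lam : ℝ) (n : ℕ) : ℝ :=
  2 * n * compK (qTwo (lam / n ^ 2)) / larcScale lam n

/-- The `(λ,1,n)`-longer arc `γ_larc^{λ,1,n}`, parametrized by arclength `s ∈ [0, 2nK(q)/α]`. -/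
def larc (lam : ℝ) (n : ℕ) (s : ℝ) : Plane :=
  let q := qTwo (lam / n ^ 2)
  let α := larcScale lam n
  (1 / α) • !₂[2 * ellE (jacobiAm (α * s - compK q) q) q + 2 * compE q - α * s,
    2 * q * jacobiCn (α * s - compK q) q]

/-! ### Critical points -/

/-- Counterclockwise rotation by `π/2`. -/
def rotQuarter (v : Plane) : Plane := !₂[-v 1, v 0]

/-- The signed curvature `k = ⟨c'', R_{π/2} c'⟩` of a curve `c` that is parametrized by arclength
on `[0,L]`. -/
def signedCurvature (L : ℝ) (c : ℝ → Plane) (s : ℝ) : ℝ :=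
  inner ℝ (iteratedDerivWithin 2 c (Icc 0 L) s) (rotQuarter (derivWithin c (Icc 0 L) s))

/-- `c`, on `[0,L]`, is the arclength parametrization of a penalized pinned elastica: a smooth
curve from `(0,0)` to `(1,0)` whose signed curvature vanishes at both ends and solves the
Euler-Lagrange equation `2k'' + k³ - λk = 0` of `E_λ`. -/
structure IsPenalizedPinnedElastica (lam L : ℝ) (c : ℝ → Plane) : Prop where
  length_pos : 0 < L
  smooth : ContDiffOn ℝ ∞ c (Icc 0 L)
  start_eq : c 0 = !₂[0, 0]
  end_eq : c L = !₂[1, 0]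
  unit_speed : ∀ s ∈ Icc 0 L, ‖derivWithin c (Icc 0 L) s‖ = 1
  curvature_start : signedCurvature L c 0 = 0
  curvature_end : signedCurvature L c L = 0
  euler_lagrange : ∀ s ∈ Ioo 0 L,
    2 * iteratedDerivWithin 2 (signedCurvature L c) (Icc 0 L) s
      + signedCurvature L c s ^ 3 - lam * signedCurvature L c s = 0

end ElasticObstacle

end

/-!
# Minimality of the longer arc in the elastic obstacle problem with small length penalization

A symmetric curve is horizontal at its midpoint, and its right half determines it; in terms of the
tangent `(c, τ)`, `c² + τ² = 1`, of the right half the bending energy is `2 ∫ c'² / (1 - c²) ds`,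
which is jointly convex in `(c, c')`, and the condition that the curve ends in `(1,0)` is the *linear*
constraint `∫ c ds = ± 1/2`. Hence, for a fixed length, an elastica is a global minimizer, and this
is proved by a calibration, without compactness arguments: for the elastica of modulus `q`, scaled to
the length of the curve, with `n₀ = 1 - c₀` and the slope `β = cn / (sn dn)` of its field of
extremals, the integrand of the bending energy exceeds the sum of the elastic energy density, a
Lagrange multiplier times `n - n₀`, and an exact derivative by the square of a real number, plus
`(wβ(n - n₀))²` (`IsHalfFrame.calibration`). The Riccati equation `hasDerivAt_calib` is what makes the
field a calibration; its singularity at the midpoint is harmless, because a tangent in `W^{1,2}`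
leaves its initial direction slowly enough (`IsHalfFrame.tendsto_calib_mul_gap`). A curve starting
its right half to the left is treated by reversing its tangent, which only raises the lower bound.

It remains to compare different lengths. Using the modulus `q = q₂(λ)` of the longer arc for *every*
length `L`, the calibration yields, with `w = 2K/L`, `α = 2(2E - K)` and `λ = 2α²(2q² - 1)`,
`E_λ[γ] ≥ E_λ[larc] + 2(w - α)²((2q² - 1)L - 1)`, see `IsSymCurve.energy_ge`. So the longer arc is
the unique minimizer among the curves with `L > 1/(2q² - 1)`. The remaining curves have bounded
length, while the obstacle forces `L ≥ 1 + δ` (`exists_length_ge`); therefore their tangent must turn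
by a definite amount and their energy is bounded from below (`IsSymCurve.two_mul_div_le_bending`).
The energy `2α² + 8αK(2q² - 1)` of the longer arc tends to `0` with `λ`, so these curves do not
compete. In the case of equality the calibration determines the first component of the tangent,
and hence the curve up to reflection in the `x`-axis; the reflected arc violates the obstacle
condition (`tangent_eq_of_apply_zero_eq`). Finally the longer arc is admissible, and does not touch
the obstacle, since over `(0,1)` it runs at a height proportional to `1/α` (`le_arc_one_sq`).

Elements of `W^{2,2}` are handled through the du Bois-Reymond lemma, which shows that their velocity
is absolutely continuous with square integrable derivative (`MemW22.velocity_regular`).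
-/

open Filter Topology

namespace ElasticObstacle

/-! ### Absolutely continuous functions -/

lemma _root_.AbsolutelyContinuousOnInterval.congr_uIcc {f g : ℝ → ℝ} {a b : ℝ}
    (hf : AbsolutelyContinuousOnInterval f a b) (h : EqOn f g (uIcc a b)) :
    AbsolutelyContinuousOnInterval g a b := by
  rw [absolutelyContinuousOnInterval_iff] at hf ⊢
  intro ε hε
  obtain ⟨δ, hδ, H⟩ := hf ε hε
  refine ⟨δ, hδ, fun E hE hlen => ?_⟩
  have := H E hE hlen
  rwa [Finset.sum_congr rfl fun i hi => ?_] at this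
  rw [h (hE.1 i hi).1, h (hE.1 i hi).2]

lemma _root_.LipschitzOnWith.comp_absolutelyContinuousOnInterval {f φ : ℝ → ℝ} {a b : ℝ}
    {s : Set ℝ} {C : NNReal} (hφ : LipschitzOnWith C φ s)
    (hf : AbsolutelyContinuousOnInterval f a b) (hfs : MapsTo f (uIcc a b) s) :
    AbsolutelyContinuousOnInterval (fun x => φ (f x)) a b := by
  rw [absolutelyContinuousOnInterval_iff] at hf ⊢
  intro ε hε
  obtain ⟨δ, hδ, H⟩ := hf (ε / (C + 1)) (by positivity)
  refine ⟨δ, hδ, fun E hE hlen => ?_⟩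
  have hsum := H E hE hlen
  calc ∑ i ∈ Finset.range E.1, dist (φ (f (E.2 i).1)) (φ (f (E.2 i).2))
      ≤ ∑ i ∈ Finset.range E.1, (C + 1) * dist (f (E.2 i).1) (f (E.2 i).2) := by
        refine Finset.sum_le_sum fun i hi => ?_
        have := hφ.dist_le_mul _ (hfs (hE.1 i hi).1) _ (hfs (hE.1 i hi).2)
        have h0 : 0 ≤ dist (f (E.2 i).1) (f (E.2 i).2) := dist_nonneg
        linarith
    _ = (C + 1) * ∑ i ∈ Finset.range E.1, dist (f (E.2 i).1) (f (E.2 i).2) := by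
        rw [Finset.mul_sum]
    _ < (C + 1) * (ε / (C + 1)) := by gcongr
    _ = ε := by field_simp

/-- A `C¹` function of an absolutely continuous function is absolutely
continuous. -/
lemma _root_.AbsolutelyContinuousOnInterval.comp_contDiffOn {f φ : ℝ → ℝ} {a b : ℝ}
    {s : Set ℝ} (hφ : ContDiffOn ℝ 1 φ s)
    (hf : AbsolutelyContinuousOnInterval f a b) (hfs : MapsTo f (uIcc a b) s) :
    AbsolutelyContinuousOnInterval (fun x => φ (f x)) a b := by
  have hcomp : IsCompact (f '' uIcc a b) := isCompact_uIcc.image_of_continuousOn hf.continuousOn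
  have hconn : OrdConnected (f '' uIcc a b) :=
    (isPreconnected_uIcc.image _ hf.continuousOn).ordConnected
  obtain ⟨C, hC⟩ := (hφ.mono hfs.image_subset).exists_lipschitzOnWith one_ne_zero
    hconn.convex hcomp
  exact hC.comp_absolutelyContinuousOnInterval hf (mapsTo_image _ _)

/-- The fundamental theorem of calculus for absolutely continuous functions, with a prescribed
representative of the derivative. -/
lemma _root_.AbsolutelyContinuousOnInterval.integral_eq_sub_of_ae_hasDerivAt {f f' : ℝ → ℝ}
    {a b : ℝ} (hf : AbsolutelyContinuousOnInterval f a b)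
    (h : ∀ᵐ x, x ∈ uIoc a b → HasDerivAt f (f' x) x) :
    IntervalIntegrable f' volume a b ∧ ∫ x in a..b, f' x = f b - f a := by
  have hae : ∀ᵐ x, x ∈ uIoc a b → deriv f x = f' x := by
    filter_upwards [h] with x hx hm using (hx hm).deriv
  refine ⟨?_, ?_⟩
  · refine hf.intervalIntegrable_deriv.congr_ae ?_
    rw [EventuallyEq, ae_restrict_iff' measurableSet_uIoc]
    exact hae
  · rw [← hf.integral_deriv_eq_sub]
    refine (intervalIntegral.integral_congr_ae hae).symm

lemma ae_mem_Ioo_of_mem_uIoc {a b : ℝ} (hab : a ≤ b) :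
    ∀ᵐ x, x ∈ uIoc a b → x ∈ Ioo a b := by
  have : ∀ᵐ x : ℝ, x ≠ b := by simp [ae_iff]
  filter_upwards [this] with x hx hm
  rw [uIoc_of_le hab] at hm
  exact ⟨hm.1, lt_of_le_of_ne hm.2 hx⟩

/-! ### Weak derivatives on the unit interval -/

lemma integrableOn_mul_of_continuous {φ h : ℝ → ℝ} (hφ : Continuous φ)
    (hh : IntegrableOn h (Ioo 0 1)) : IntegrableOn (fun x => φ x * h x) (Ioo 0 1) := by
  rw [← integrableOn_Icc_iff_integrableOn_Ioo] at hh ⊢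
  exact hh.continuousOn_mul hφ.continuousOn isCompact_Icc

/-- The du Bois-Reymond lemma: a function with vanishing weak derivative is constant. -/
lemma exists_ae_eq_const_of_integral_deriv_mul_eq_zero {h : ℝ → ℝ}
    (hh : IntegrableOn h (Ioo 0 1))
    (H : ∀ φ : ℝ → ℝ, ContDiff ℝ ∞ φ → HasCompactSupport φ → tsupport φ ⊆ Ioo 0 1 →
      ∫ x in Ioo (0 : ℝ) 1, deriv φ x * h x = 0) :
    ∃ c, ∀ᵐ x, x ∈ Ioo (0 : ℝ) 1 → h x = c := by
  let B : ContDiffBump (1 / 2 : ℝ) := ⟨1 / 8, 1 / 4, by norm_num, by norm_num⟩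
  set ρ : ℝ → ℝ := B.normed volume with hρdef
  have hρ : ContDiff ℝ ∞ ρ := B.contDiff_normed
  have hρc : HasCompactSupport ρ := B.hasCompactSupport_normed
  have hρs : tsupport ρ ⊆ Ioo 0 1 := by
    rw [hρdef, B.tsupport_normed_eq, Real.closedBall_eq_Icc]
    intro x hx
    have h1 : (1 / 2 - 1 / 4 : ℝ) ≤ x := hx.1
    have h2 : x ≤ (1 / 2 + 1 / 4 : ℝ) := hx.2
    constructor <;> linarith
  have hρ1 : ∫ x, ρ x = 1 := B.integral_normed
  set c : ℝ := ∫ x in Ioo (0 : ℝ) 1, ρ x * h x with hc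
  refine ⟨c, ?_⟩
  have key : ∀ φ : ℝ → ℝ, ContDiff ℝ ∞ φ → HasCompactSupport φ → tsupport φ ⊆ Ioo 0 1 →
      ∫ x in Ioo (0 : ℝ) 1, φ x * h x = (∫ x, φ x) * c := by
    intro φ hφ hφc hφs
    set J : ℝ := ∫ x, φ x with hJ
    let η : ℝ → ℝ := fun x => φ x - J * ρ x
    have hη : ContDiff ℝ ∞ η := hφ.sub (contDiff_const.mul hρ)
    let Φ : ℝ → ℝ := fun x => ∫ t in (0 : ℝ)..x, η t
    have hΦd : ∀ x, HasDerivAt Φ (η x) x := fun x =>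
      intervalIntegral.integral_hasDerivAt_right (hη.continuous.intervalIntegrable _ _)
        (hη.continuous.stronglyMeasurableAtFilter _ _) hη.continuous.continuousAt
    have hΦderiv : deriv Φ = η := funext fun x => (hΦd x).deriv
    have hΦ : ContDiff ℝ ∞ Φ := by
      rw [contDiff_infty_iff_deriv]
      exact ⟨fun x => (hΦd x).differentiableAt, hΦderiv ▸ hη⟩
    -- the supports of `φ` and `ρ` lie in a compact subinterval
    obtain ⟨a, b, ha, hb, hab⟩ : ∃ a b : ℝ, 0 < a ∧ b < 1 ∧ ∀ x, x ∉ Icc a b → η x = 0 := by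
      have hK : IsCompact (tsupport φ ∪ tsupport ρ) := hφc.isCompact.union hρc.isCompact
      have hKs : tsupport φ ∪ tsupport ρ ⊆ Ioo 0 1 := union_subset hφs hρs
      have hne : (tsupport φ ∪ tsupport ρ).Nonempty := by
        refine ⟨1 / 2, Or.inr ?_⟩
        rw [hρdef, B.tsupport_normed_eq]
        exact Metric.mem_closedBall_self (by norm_num)
      obtain ⟨a, ha, hal⟩ := hK.exists_isLeast hne
      obtain ⟨b, hb, hbl⟩ := hK.exists_isGreatest hne
      refine ⟨a, b, (hKs ha).1, (hKs hb).2, fun x hx => ?_⟩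
      have hx' : x ∉ tsupport φ ∪ tsupport ρ := fun hm => hx ⟨hal hm, hbl hm⟩
      simp only [mem_union, not_or] at hx'
      simp [η, image_eq_zero_of_notMem_tsupport hx'.1, image_eq_zero_of_notMem_tsupport hx'.2]
    have hηint : ∫ x, η x = 0 := by
      have : ∫ x, η x = J - J * ∫ x, ρ x := by
        rw [← integral_const_mul, hJ]
        exact integral_sub (hφ.continuous.integrable_of_hasCompactSupport hφc)
          ((hρ.continuous.integrable_of_hasCompactSupport hρc).const_mul _)
      rw [this, hρ1]; ring
    have hη01 : ∫ x in (0 : ℝ)..1, η x = 0 := by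
      rw [intervalIntegral.integral_of_le zero_le_one]
      refine Eq.trans ?_ hηint
      refine setIntegral_eq_integral_of_forall_compl_eq_zero fun x hx => hab x fun hm => hx ?_
      exact ⟨ha.trans_le hm.1, hm.2.trans hb.le⟩
    have hΦ0 : ∀ x, x ∉ Icc a b → Φ x = 0 := by
      intro x hx
      rcases lt_or_ge x a with hxa | hxa
      · refine intervalIntegral.integral_zero_ae (Eventually.of_forall fun t ht => hab t ?_)
        intro hm
        rcases le_total 0 x with h0 | h0
        · rw [uIoc_of_le h0] at ht; linarith [hm.1, ht.2]
        · rw [uIoc_of_ge h0] at ht; linarith [hm.1, ht.2]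
      · have hbx : b < x := by
          by_contra hcon
          exact hx ⟨hxa, not_lt.1 hcon⟩
        have h1 : Φ x = (∫ t in (0 : ℝ)..1, η t) + ∫ t in (1 : ℝ)..x, η t :=
          (intervalIntegral.integral_add_adjacent_intervals
            (hη.continuous.intervalIntegrable _ _) (hη.continuous.intervalIntegrable _ _)).symm
        rw [h1, hη01, zero_add]
        refine intervalIntegral.integral_zero_ae (Eventually.of_forall fun t ht => hab t ?_)
        intro hm
        rcases le_total 1 x with h0 | h0
        · rw [uIoc_of_le h0] at ht; linarith [hm.2, ht.1]
        · rw [uIoc_of_ge h0] at ht; linarith [hm.2, ht.1]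
    have hts : tsupport Φ ⊆ Icc a b :=
      closure_minimal (fun x hx => by_contra fun hm => hx (hΦ0 x hm)) isClosed_Icc
    have hΦc : HasCompactSupport Φ := isCompact_Icc.of_isClosed_subset (isClosed_tsupport _) hts
    have := H Φ hΦ hΦc (hts.trans fun x hx => ⟨ha.trans_le hx.1, hx.2.trans_lt hb⟩)
    rw [hΦderiv] at this
    have h2 : ∫ x in Ioo (0 : ℝ) 1, η x * h x =
        (∫ x in Ioo (0 : ℝ) 1, φ x * h x) - J * c := by
      rw [hc, ← integral_const_mul, ← integral_sub]
      · refine integral_congr_ae (Eventually.of_forall fun x => ?_)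
        simp only [η]; ring
      · exact integrableOn_mul_of_continuous hφ.continuous hh
      · exact (integrableOn_mul_of_continuous hρ.continuous hh).const_mul _
    linarith
  have hloc : LocallyIntegrableOn (fun x => h x - c) (Ioo 0 1) := by
    refine IntegrableOn.locallyIntegrableOn ?_
    exact hh.sub (integrableOn_const (by simp))
  have hz := isOpen_Ioo.ae_eq_zero_of_integral_contDiff_smul_eq_zero hloc (μ := volume) ?_
  · filter_upwards [hz] with x hx hm
    have := hx hm
    linarith
  · intro φ hφ hφc hφs
    have h1 : ∫ x, φ x • (h x - c) = ∫ x in Ioo (0 : ℝ) 1, φ x * (h x - c) := by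
      refine (setIntegral_eq_integral_of_forall_compl_eq_zero fun x hx => ?_).symm
      rw [image_eq_zero_of_notMem_tsupport fun hm => hx (hφs hm), zero_smul]
    have h2 : ∫ x, φ x = ∫ x in Ioo (0 : ℝ) 1, φ x :=
      (setIntegral_eq_integral_of_forall_compl_eq_zero fun x hx =>
        image_eq_zero_of_notMem_tsupport fun hm => hx (hφs hm)).symm
    have h3 := key φ hφ hφc hφs
    rw [h1]
    simp only [mul_sub]
    rw [integral_sub (integrableOn_mul_of_continuous hφ.continuous hh), h3, h2,
      integral_mul_const, sub_self]
    exact (integrableOn_mul_of_continuous hφ.continuous (integrableOn_const (by simp)))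

/-- A function with an integrable weak derivative coincides almost everywhere with a primitive of
that derivative. -/
lemma exists_ae_eq_add_integral_of_weakDeriv {f g : ℝ → ℝ} (hf : IntegrableOn f (Ioo 0 1))
    (hg : IntegrableOn g (Ioo 0 1))
    (H : ∀ φ : ℝ → ℝ, ContDiff ℝ ∞ φ → HasCompactSupport φ → tsupport φ ⊆ Ioo 0 1 →
      ∫ x in Ioo (0 : ℝ) 1, deriv φ x * f x = - ∫ x in Ioo (0 : ℝ) 1, φ x * g x) :
    ∃ c, ∀ᵐ x, x ∈ Ioo (0 : ℝ) 1 → f x = c + ∫ t in (0 : ℝ)..x, g t := by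
  have hgi : IntervalIntegrable g volume 0 1 :=
    (intervalIntegrable_iff_integrableOn_Ioo_of_le zero_le_one).2 hg
  set G : ℝ → ℝ := fun x => ∫ t in (0 : ℝ)..x, g t with hG
  have hGac : AbsolutelyContinuousOnInterval G 0 1 :=
    hgi.absolutelyContinuousOnInterval_intervalIntegral (by simp)
  have hGint : IntegrableOn G (Ioo 0 1) := by
    rw [← integrableOn_Icc_iff_integrableOn_Ioo]
    have := hGac.continuousOn
    rw [uIcc_of_le zero_le_one] at this
    exact this.integrableOn_Icc
  have hzero : ∀ φ : ℝ → ℝ, ContDiff ℝ ∞ φ → HasCompactSupport φ → tsupport φ ⊆ Ioo 0 1 →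
      ∫ x in Ioo (0 : ℝ) 1, deriv φ x * (f - G) x = 0 := by
    intro φ hφ hφc hφs
    have hd : Continuous (deriv φ) := hφ.continuous_deriv (by simp)
    simp only [Pi.sub_apply, mul_sub]
    rw [integral_sub (integrableOn_mul_of_continuous hd hf)
      (integrableOn_mul_of_continuous hd hGint), H φ hφ hφc hφs]
    have hφ0 : φ 0 = 0 := image_eq_zero_of_notMem_tsupport fun hm => (hφs hm).1.false
    have hφ1 : φ 1 = 0 := image_eq_zero_of_notMem_tsupport fun hm => (hφs hm).2.false
    have hφac : AbsolutelyContinuousOnInterval φ 0 1 :=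
      (hφ.of_le (by simp)).contDiffOn.absolutelyContinuousOnInterval
    have hder : ∀ᵐ x, x ∈ uIoc (0 : ℝ) 1 →
        HasDerivAt (fun x => φ x * G x) (deriv φ x * G x + φ x * g x) x := by
      filter_upwards [hgi.ae_hasDerivAt_integral] with x hx hm
      have hx2 := hx (uIoc_subset_uIcc hm) 0 (by simp)
      exact ((hφ.differentiable (by simp)).differentiableAt.hasDerivAt).mul hx2
    have h := ((hφac.fun_mul hGac).integral_eq_sub_of_ae_hasDerivAt hder).2
    rw [hφ0, hφ1, intervalIntegral.integral_of_le zero_le_one, integral_Ioc_eq_integral_Ioo,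
      integral_add (integrableOn_mul_of_continuous hd hGint)
      (integrableOn_mul_of_continuous hφ.continuous hg)] at h
    linarith
  obtain ⟨c, hc⟩ := exists_ae_eq_const_of_integral_deriv_mul_eq_zero (hf.sub hGint) hzero
  refine ⟨c, ?_⟩
  filter_upwards [hc] with x hx hm
  have := hx hm
  simp only [Pi.sub_apply] at this
  linarith

/-! ### The velocity of a curve of class `W^{2,2}` -/

lemma HasWeakDeriv.apply {f g : ℝ → Plane} (h : HasWeakDeriv f g)
    (hf : IntegrableOn f (Ioo 0 1)) (hg : IntegrableOn g (Ioo 0 1)) (i : Fin 2)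
    {φ : ℝ → ℝ} (hφ : ContDiff ℝ ∞ φ) (hφc : HasCompactSupport φ) (hφs : tsupport φ ⊆ Ioo 0 1) :
    ∫ x in Ioo (0 : ℝ) 1, deriv φ x * f x i = - ∫ x in Ioo (0 : ℝ) 1, φ x * g x i := by
  have hsmul : ∀ {χ : ℝ → ℝ} {k : ℝ → Plane}, Continuous χ → IntegrableOn k (Ioo 0 1) →
      IntegrableOn (fun x => χ x • k x) (Ioo 0 1) := by
    intro χ k hχ hk
    rw [← integrableOn_Icc_iff_integrableOn_Ioo] at hk ⊢
    exact hk.continuousOn_smul hχ.continuousOn isCompact_Icc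
  have h1 := congrArg (EuclideanSpace.proj (𝕜 := ℝ) i) (h φ hφ hφc hφs)
  rw [map_neg, ← ContinuousLinearMap.integral_comp_comm _
    (hsmul (hφ.continuous_deriv (by simp)) hf),
    ← ContinuousLinearMap.integral_comp_comm _ (hsmul hφ.continuous hg)] at h1
  simpa using h1

lemma integrableOn_apply {f : ℝ → Plane} {s : Set ℝ} (hf : IntegrableOn f s) (i : Fin 2) :
    IntegrableOn (fun x => f x i) s := by
  exact (EuclideanSpace.proj (𝕜 := ℝ) i).integrable_comp hf

lemma hasDerivWithinAt_plane {γ : ℝ → Plane} {V : Plane} {s : Set ℝ} {x : ℝ} :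
    HasDerivWithinAt γ V s x ↔ ∀ i, HasDerivWithinAt (fun y => γ y i) (V i) s x := by
  rw [hasDerivWithinAt_iff_hasFDerivWithinAt, hasFDerivWithinAt_euclidean]
  simp only [hasDerivWithinAt_iff_hasFDerivWithinAt]
  refine forall_congr' fun i => ?_
  have : EuclideanSpace.proj i ∘L ContinuousLinearMap.toSpanSingleton ℝ V =
      ContinuousLinearMap.toSpanSingleton ℝ (V i) := by
    ext; simp
  rw [← this]

/-- The `C¹` representative of a `W^{2,2}`-curve: its velocity is absolutely continuous, with square
integrable derivative. -/
lemma MemW22.velocity_regular {γ : ℝ → Plane} (h : MemW22 γ) :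
    (∀ i, AbsolutelyContinuousOnInterval (fun x => velocity γ x i) 0 1) ∧
    (∀ i, MemLp (fun x => deriv (fun y => velocity γ y i) x) 2 (volume.restrict (Ioo 0 1))) ∧
    ∀ x ∈ Icc (0 : ℝ) 1, HasDerivWithinAt γ (velocity γ x) (Icc 0 1) x := by
  obtain ⟨hγ, v, w, hv, hw, hγv, hvw⟩ := h
  have hγi : IntegrableOn γ (Ioo 0 1) :=
    (hγ.integrableOn_Icc).mono_set Ioo_subset_Icc_self
  have hvi : IntegrableOn v (Ioo 0 1) := hv.integrable (by norm_num)
  have hwi : IntegrableOn w (Ioo 0 1) := hw.integrable (by norm_num)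
  have hvac : ∀ i, ∃ c, ∀ᵐ x, x ∈ Ioo (0 : ℝ) 1 → v x i = c + ∫ t in (0 : ℝ)..x, w t i :=
    fun i => exists_ae_eq_add_integral_of_weakDeriv (integrableOn_apply hvi i)
      (integrableOn_apply hwi i) fun φ h1 h2 h3 => hvw.apply hvi hwi i h1 h2 h3
  have hγac : ∀ i, ∃ c, ∀ᵐ x, x ∈ Ioo (0 : ℝ) 1 → γ x i = c + ∫ t in (0 : ℝ)..x, v t i :=
    fun i => exists_ae_eq_add_integral_of_weakDeriv (integrableOn_apply hγi i)
      (integrableOn_apply hvi i) fun φ h1 h2 h3 => hγv.apply hγi hvi i h1 h2 h3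
  choose c hc using hvac
  choose d hd using hγac
  have hwint : ∀ i, IntervalIntegrable (fun t => w t i) volume 0 1 := fun i =>
    (intervalIntegrable_iff_integrableOn_Ioo_of_le zero_le_one).2 (integrableOn_apply hwi i)
  have hvint : ∀ i, IntervalIntegrable (fun t => v t i) volume 0 1 := fun i =>
    (intervalIntegrable_iff_integrableOn_Ioo_of_le zero_le_one).2 (integrableOn_apply hvi i)
  let V : Fin 2 → ℝ → ℝ := fun i x => c i + ∫ t in (0 : ℝ)..x, w t i
  have hVac : ∀ i, AbsolutelyContinuousOnInterval (V i) 0 1 := fun i => by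
    have h1 : AbsolutelyContinuousOnInterval (fun _ : ℝ => c i) 0 1 :=
      contDiffOn_const.absolutelyContinuousOnInterval
    exact h1.fun_add ((hwint i).absolutelyContinuousOnInterval_intervalIntegral (by simp))
  have hVcont : ∀ i, ContinuousOn (V i) (Icc 0 1) := fun i => by
    simpa [uIcc_of_le zero_le_one] using (hVac i).continuousOn
  -- the identity for `γ` holds everywhere by continuity
  have hγeq : ∀ i, ∀ x ∈ Icc (0 : ℝ) 1, γ x i = d i + ∫ t in (0 : ℝ)..x, v t i := by
    intro i
    have h1 : ContinuousOn (fun x => γ x i) (Icc 0 1) :=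
      (EuclideanSpace.proj (𝕜 := ℝ) i).continuous.comp_continuousOn hγ
    have h2 : ContinuousOn (fun x => d i + ∫ t in (0 : ℝ)..x, v t i) (Icc 0 1) := by
      have := ((hvint i).absolutelyContinuousOnInterval_intervalIntegral
        (c := 0) (by simp)).continuousOn
      rw [uIcc_of_le zero_le_one] at this
      exact continuousOn_const.add this
    have h3 : (fun x => γ x i) =ᵐ[volume.restrict (Ioo (0 : ℝ) 1)]
        fun x => d i + ∫ t in (0 : ℝ)..x, v t i := by
      rw [EventuallyEq, ae_restrict_iff' measurableSet_Ioo]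
      exact hd i
    rw [restrict_Ioo_eq_restrict_Icc] at h3
    exact Measure.eqOn_Icc_of_ae_eq volume zero_ne_one h3 h1 h2
  have hγeq' : ∀ i, ∀ x ∈ Icc (0 : ℝ) 1, γ x i = d i + ∫ t in (0 : ℝ)..x, V i t := by
    intro i x hx
    rw [hγeq i x hx]
    congr 1
    refine intervalIntegral.integral_congr_ae ?_
    filter_upwards [hc i, ae_mem_Ioo_of_mem_uIoc hx.1] with t ht hm htx
    exact ht ⟨(hm htx).1, (hm htx).2.trans_le hx.2⟩
  have hder : ∀ x ∈ Icc (0 : ℝ) 1, HasDerivWithinAt γ (!₂[V 0 x, V 1 x]) (Icc 0 1) x := by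
    intro x hx
    rw [hasDerivWithinAt_plane]
    intro i
    have h1 : HasDerivWithinAt (fun y => d i + ∫ t in (0 : ℝ)..y, V i t) (V i x) (Icc 0 1) x := by
      refine HasDerivWithinAt.const_add _ ?_
      have : Fact (x ∈ Icc (0 : ℝ) 1) := ⟨hx⟩
      refine intervalIntegral.integral_hasDerivWithinAt_right ?_ ?_ (hVcont i x hx)
      · refine ((hVcont i).mono ?_).intervalIntegrable
        rw [uIcc_of_le hx.1]; exact Icc_subset_Icc_right hx.2
      · exact (hVcont i).stronglyMeasurableAtFilter_nhdsWithin measurableSet_Icc x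
    have h2 := h1.congr (fun y hy => hγeq' i y hy) (hγeq' i x hx)
    fin_cases i <;> simpa using h2
  have hvel : ∀ i, ∀ x ∈ Icc (0 : ℝ) 1, V i x = velocity γ x i := by
    intro i x hx
    have := (hder x hx).derivWithin (uniqueDiffOn_Icc zero_lt_one x hx)
    rw [velocity, this]
    fin_cases i <;> simp
  refine ⟨fun i => (hVac i).congr_uIcc (by rw [uIcc_of_le zero_le_one]; exact hvel i), fun i => ?_,
    fun x hx => ?_⟩
  · have hwi2 : MemLp (fun x => w x i) 2 (volume.restrict (Ioo 0 1)) := by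
      exact (EuclideanSpace.proj (𝕜 := ℝ) i).comp_memLp' hw
    refine hwi2.ae_eq ?_
    rw [EventuallyEq, ae_restrict_iff' measurableSet_Ioo]
    filter_upwards [(hwint i).ae_hasDerivAt_integral] with x hx hm
    have h1 := (hx (by rw [uIcc_of_le zero_le_one]; exact Ioo_subset_Icc_self hm) 0
      (by simp)).const_add (c i)
    refine (HasDerivAt.deriv ?_).symm
    refine h1.congr_of_eventuallyEq ?_
    filter_upwards [isOpen_Ioo.mem_nhds hm] with y hy
    exact (hvel i y (Ioo_subset_Icc_self hy)).symm
  · have h1 := hder x hx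
    rwa [← h1.derivWithin (uniqueDiffOn_Icc zero_lt_one x hx)] at h1

/-! ### The unit tangent and its turning speed -/

lemma plane_norm_sq (v : Plane) : ‖v‖ ^ 2 = v 0 ^ 2 + v 1 ^ 2 := by
  rw [EuclideanSpace.norm_sq_eq, Fin.sum_univ_two]; simp

lemma plane_norm (v : Plane) : ‖v‖ = √(v 0 ^ 2 + v 1 ^ 2) := by
  rw [← plane_norm_sq, Real.sqrt_sq (norm_nonneg v)]

/-- The speed of rotation `det(γ', γ'') / |γ'|²` of the tangent of `γ`, with respect to the
parameter of `γ` (so it equals signed curvature times speed). -/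
noncomputable def turning (γ : ℝ → Plane) (x : ℝ) : ℝ :=
  (velocity γ x 0 * deriv (fun y => velocity γ y 1) x -
    velocity γ x 1 * deriv (fun y => velocity γ y 0) x) / ‖velocity γ x‖ ^ 2

lemma arcDeriv_self_apply (γ : ℝ → Plane) (x : ℝ) (i : Fin 2) :
    arcDeriv γ γ x i = ‖velocity γ x‖⁻¹ * velocity γ x i := by
  simp [arcDeriv, velocity]

section

variable {γ : ℝ → Plane}

lemma MemW22Imm.norm_velocity_pos (h : MemW22Imm γ) {x : ℝ} (hx : x ∈ Icc (0 : ℝ) 1) :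
    0 < ‖velocity γ x‖ := norm_pos_iff.2 (h.2 x hx)

lemma MemW22Imm.continuousOn_velocity_apply (h : MemW22Imm γ) (i : Fin 2) :
    ContinuousOn (fun x => velocity γ x i) (Icc 0 1) := by
  simpa [uIcc_of_le zero_le_one] using (h.1.velocity_regular.1 i).continuousOn

lemma MemW22Imm.continuousOn_norm_velocity (h : MemW22Imm γ) :
    ContinuousOn (fun x => ‖velocity γ x‖) (Icc 0 1) := by
  simp only [plane_norm]
  exact (((h.continuousOn_velocity_apply 0).pow 2).add
    ((h.continuousOn_velocity_apply 1).pow 2)).sqrt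

lemma MemW22Imm.tangent_sq_add (h : MemW22Imm γ) {x : ℝ} (hx : x ∈ Icc (0 : ℝ) 1) :
    arcDeriv γ γ x 0 ^ 2 + arcDeriv γ γ x 1 ^ 2 = 1 := by
  have h1 := h.norm_velocity_pos hx
  have h2 := plane_norm_sq (velocity γ x)
  rw [arcDeriv_self_apply, arcDeriv_self_apply, mul_pow, mul_pow, ← mul_add, ← h2]
  field_simp

lemma MemW22Imm.velocity_eq (h : MemW22Imm γ) {x : ℝ} (hx : x ∈ Icc (0 : ℝ) 1) (i : Fin 2) :
    velocity γ x i = arcDeriv γ γ x i * ‖velocity γ x‖ := by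
  have h1 := h.norm_velocity_pos hx
  rw [arcDeriv_self_apply]
  field_simp

lemma MemW22Imm.tangent_absolutelyContinuous (h : MemW22Imm γ) (i : Fin 2) :
    AbsolutelyContinuousOnInterval (fun x => arcDeriv γ γ x i) 0 1 := by
  have hV := h.1.velocity_regular.1
  have hsq : AbsolutelyContinuousOnInterval
      (fun x => velocity γ x 0 * velocity γ x 0 + velocity γ x 1 * velocity γ x 1) 0 1 :=
    ((hV 0).fun_mul (hV 0)).fun_add ((hV 1).fun_mul (hV 1))
  have hinv : ContDiffOn ℝ 1 (fun s : ℝ => (√s)⁻¹) (Ioi 0) := by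
    refine ContDiffOn.inv (fun s hs => ?_) fun s hs => (Real.sqrt_pos.2 hs).ne'
    exact (Real.contDiffAt_sqrt (ne_of_gt hs)).contDiffWithinAt
  have hcomp := (hsq.comp_contDiffOn hinv ?_).fun_mul (hV i)
  · refine hcomp.congr_uIcc fun x _ => ?_
    simp only [arcDeriv_self_apply, plane_norm, pow_two]
  · intro x hx
    rw [uIcc_of_le zero_le_one] at hx
    have h1 := h.norm_velocity_pos hx
    have h2 := plane_norm_sq (velocity γ x)
    have : 0 < ‖velocity γ x‖ ^ 2 := by positivity
    simp only [mem_Ioi]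
    nlinarith

/-- Frenet's equations, almost everywhere. -/
lemma MemW22Imm.ae_hasDerivAt_tangent (h : MemW22Imm γ) :
    ∀ᵐ x, x ∈ Ioo (0 : ℝ) 1 →
      HasDerivAt (fun y => arcDeriv γ γ y 0) (-(arcDeriv γ γ x 1 * turning γ x)) x ∧
      HasDerivAt (fun y => arcDeriv γ γ y 1) (arcDeriv γ γ x 0 * turning γ x) x := by
  have hV := h.1.velocity_regular.1
  filter_upwards [(hV 0).ae_differentiableAt, (hV 1).ae_differentiableAt] with x h0 h1 hm
  have hm' : x ∈ uIcc (0 : ℝ) 1 := by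
    rw [uIcc_of_le zero_le_one]; exact Ioo_subset_Icc_self hm
  have d0 := (h0 hm').hasDerivAt
  have d1 := (h1 hm').hasDerivAt
  have hpos := h.norm_velocity_pos (Ioo_subset_Icc_self hm)
  have hsq := plane_norm_sq (velocity γ x)
  have hpos2 : 0 < velocity γ x 0 ^ 2 + velocity γ x 1 ^ 2 := by rw [← hsq]; positivity
  have dN := ((d0.fun_pow 2).fun_add (d1.fun_pow 2)).sqrt hpos2.ne'
  have hNx : √(velocity γ x 0 ^ 2 + velocity γ x 1 ^ 2) = ‖velocity γ x‖ :=
    (plane_norm _).symm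
  have dI := dN.fun_inv (by rw [hNx]; exact hpos.ne')
  simp only [arcDeriv_self_apply, plane_norm, turning]
  simp only [hNx] at dI ⊢
  constructor
  · refine (dI.fun_mul d0).congr_deriv ?_
    rw [hNx]
    field_simp
    rw [hsq]; ring
  · refine (dI.fun_mul d1).congr_deriv ?_
    rw [hNx]
    field_simp
    rw [hsq]; ring

lemma MemW22Imm.ae_bending_integrand (h : MemW22Imm γ) :
    ∀ᵐ x, x ∈ Ioo (0 : ℝ) 1 →
      ‖curvatureVec γ x‖ ^ 2 * ‖velocity γ x‖ = turning γ x ^ 2 / ‖velocity γ x‖ := by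
  filter_upwards [h.ae_hasDerivAt_tangent] with x hx hm
  obtain ⟨h0, h1⟩ := hx hm
  have hpos := h.norm_velocity_pos (Ioo_subset_Icc_self hm)
  have hT := h.tangent_sq_add (Ioo_subset_Icc_self hm)
  have hd : HasDerivWithinAt (arcDeriv γ γ)
      !₂[-(arcDeriv γ γ x 1 * turning γ x), arcDeriv γ γ x 0 * turning γ x] (Icc 0 1) x := by
    rw [hasDerivWithinAt_plane]
    intro i
    fin_cases i
    · simpa using h0.hasDerivWithinAt
    · simpa using h1.hasDerivWithinAt
  have hk : curvatureVec γ x = ‖velocity γ x‖⁻¹ •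
      !₂[-(arcDeriv γ γ x 1 * turning γ x), arcDeriv γ γ x 0 * turning γ x] := by
    rw [curvatureVec, arcDeriv,
      hd.derivWithin (uniqueDiffOn_Icc zero_lt_one x (Ioo_subset_Icc_self hm))]
  have hn : ‖(!₂[-(arcDeriv γ γ x 1 * turning γ x), arcDeriv γ γ x 0 * turning γ x] : Plane)‖ ^ 2
      = turning γ x ^ 2 := by
    rw [plane_norm_sq]
    simp only [Matrix.cons_val_zero, Matrix.cons_val_one]
    linear_combination turning γ x ^ 2 * hT
  rw [hk, norm_smul, mul_pow, hn, norm_inv, norm_norm]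
  field_simp

lemma MemW22Imm.memLp_turning (h : MemW22Imm γ) :
    MemLp (turning γ) 2 (volume.restrict (Ioo 0 1)) := by
  have hw := h.1.velocity_regular.2.1
  have hb : ∀ i, MemLp (fun x => velocity γ x i / ‖velocity γ x‖ ^ 2) ⊤
      (volume.restrict (Ioo 0 1)) := by
    intro i
    have hc : ContinuousOn (fun x => velocity γ x i / ‖velocity γ x‖ ^ 2) (Icc 0 1) :=
      (h.continuousOn_velocity_apply i).div (h.continuousOn_norm_velocity.pow 2)
        fun x hx => by have := h.norm_velocity_pos hx; positivity
    obtain ⟨C, hC⟩ := isCompact_Icc.exists_bound_of_continuousOn hc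
    refine memLp_top_of_bound ((hc.mono Ioo_subset_Icc_self).aestronglyMeasurable
      measurableSet_Ioo) C ?_
    rw [ae_restrict_iff' measurableSet_Ioo]
    exact Eventually.of_forall fun x hx => hC x (Ioo_subset_Icc_self hx)
  have h1 := ((hw 1).mul (hb 0) (r := 2)).sub ((hw 0).mul (hb 1) (r := 2))
  refine h1.ae_eq (Eventually.of_forall fun x => ?_)
  simp only [Pi.sub_apply, Pi.mul_apply, turning]
  ring

lemma MemW22Imm.integrableOn_turning_sq_div (h : MemW22Imm γ) :
    IntegrableOn (fun x => turning γ x ^ 2 / ‖velocity γ x‖) (Icc 0 1) := by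
  have h1 : IntegrableOn (fun x => turning γ x ^ 2) (Icc 0 1) := by
    rw [integrableOn_Icc_iff_integrableOn_Ioo]
    exact h.memLp_turning.integrable_sq
  have h2 : ContinuousOn (fun x => ‖velocity γ x‖⁻¹) (Icc 0 1) :=
    h.continuousOn_norm_velocity.inv₀ fun x hx => (h.norm_velocity_pos hx).ne'
  exact h1.mul_continuousOn h2 isCompact_Icc

lemma MemW22Imm.bending_eq (h : MemW22Imm γ) :
    bending γ = ∫ x in (0 : ℝ)..1, turning γ x ^ 2 / ‖velocity γ x‖ := by
  refine intervalIntegral.integral_congr_ae ?_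
  filter_upwards [h.ae_bending_integrand, ae_mem_Ioo_of_mem_uIoc (zero_le_one' ℝ)] with x h1 h2 h3
  exact h1 (h2 h3)

end

/-! ### Jacobi's elliptic functions -/

/-- The Jacobi elliptic function `sn`, with modulus `q`. -/
noncomputable def jacobiSn (u q : ℝ) : ℝ := Real.sin (jacobiAm u q)

/-- The Jacobi elliptic function `dn`, with modulus `q`. -/
noncomputable def jacobiDn (u q : ℝ) : ℝ := √(1 - q ^ 2 * jacobiSn u q ^ 2)

section

variable {q : ℝ}

lemma one_sub_mul_sin_sq_pos (hq : q ∈ Ico (0 : ℝ) 1) (θ : ℝ) :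
    0 < 1 - q ^ 2 * Real.sin θ ^ 2 := by
  have h1 : Real.sin θ ^ 2 ≤ 1 := Real.sin_sq_le_one θ
  have h2 : q ^ 2 < 1 := by nlinarith [hq.1, hq.2]
  nlinarith [sq_nonneg (Real.sin θ), sq_nonneg q]

lemma sqrt_one_sub_mul_sin_sq_pos (hq : q ∈ Ico (0 : ℝ) 1) (θ : ℝ) :
    0 < √(1 - q ^ 2 * Real.sin θ ^ 2) := Real.sqrt_pos.2 (one_sub_mul_sin_sq_pos hq θ)

lemma continuous_ellE_integrand (q : ℝ) :
    Continuous fun θ : ℝ => √(1 - q ^ 2 * Real.sin θ ^ 2) := by fun_prop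

lemma continuous_ellF_integrand (hq : q ∈ Ico (0 : ℝ) 1) :
    Continuous fun θ : ℝ => 1 / √(1 - q ^ 2 * Real.sin θ ^ 2) :=
  continuous_const.div (continuous_ellE_integrand q)
    fun θ => (sqrt_one_sub_mul_sin_sq_pos hq θ).ne'

lemma hasDerivAt_ellF (hq : q ∈ Ico (0 : ℝ) 1) (x : ℝ) :
    HasDerivAt (fun ξ => ellF ξ q) (1 / √(1 - q ^ 2 * Real.sin x ^ 2)) x :=
  (continuous_ellF_integrand hq).integral_hasStrictDerivAt 0 x |>.hasDerivAt

lemma hasDerivAt_ellE (q x : ℝ) :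
    HasDerivAt (fun ξ => ellE ξ q) (√(1 - q ^ 2 * Real.sin x ^ 2)) x :=
  (continuous_ellE_integrand q).integral_hasStrictDerivAt 0 x |>.hasDerivAt

lemma ellF_strictMono (hq : q ∈ Ico (0 : ℝ) 1) : StrictMono fun ξ => ellF ξ q :=
  strictMono_of_hasDerivAt_pos (hasDerivAt_ellF hq)
    fun x => one_div_pos.2 (sqrt_one_sub_mul_sin_sq_pos hq x)

lemma ellF_zero (q : ℝ) : ellF 0 q = 0 := by simp [ellF]

lemma ellE_zero (q : ℝ) : ellE 0 q = 0 := by simp [ellE]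

lemma ellF_neg (q x : ℝ) : ellF (-x) q = -ellF x q := by
  have := intervalIntegral.integral_comp_neg (a := 0) (b := x)
    (fun θ : ℝ => 1 / √(1 - q ^ 2 * Real.sin θ ^ 2))
  simp only [Real.sin_neg, neg_sq, neg_zero] at this
  rw [ellF, ellF, this, intervalIntegral.integral_symm]

lemma ellE_neg (q x : ℝ) : ellE (-x) q = -ellE x q := by
  have := intervalIntegral.integral_comp_neg (a := 0) (b := x)
    (fun θ : ℝ => √(1 - q ^ 2 * Real.sin θ ^ 2))
  simp only [Real.sin_neg, neg_sq, neg_zero] at this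
  rw [ellE, ellE, this, intervalIntegral.integral_symm]

lemma self_le_ellF (hq : q ∈ Ico (0 : ℝ) 1) {x : ℝ} (hx : 0 ≤ x) : x ≤ ellF x q := by
  have hmono : Monotone fun ξ => ellF ξ q - ξ := by
    refine monotone_of_hasDerivAt_nonneg
      (fun x => (hasDerivAt_ellF hq x).sub (hasDerivAt_id x)) fun x => ?_
    have h1 := sqrt_one_sub_mul_sin_sq_pos hq x
    have h2 : √(1 - q ^ 2 * Real.sin x ^ 2) ≤ 1 :=
      Real.sqrt_le_one.2 (by nlinarith [mul_nonneg (sq_nonneg q) (sq_nonneg (Real.sin x))])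
    simpa using (one_le_one_div h1 h2)
  have := hmono hx
  simp only [ellF_zero] at this
  linarith

lemma ellF_surjective (hq : q ∈ Ico (0 : ℝ) 1) : Function.Surjective fun ξ => ellF ξ q := by
  have hc : Continuous fun ξ => ellF ξ q :=
    continuous_iff_continuousAt.2 fun x => (hasDerivAt_ellF hq x).continuousAt
  have htop : Tendsto (fun ξ => ellF ξ q) atTop atTop :=
    tendsto_atTop_mono' _ ((eventually_ge_atTop 0).mono fun x hx => self_le_ellF hq hx) tendsto_id
  have hbot : Tendsto (fun ξ => ellF ξ q) atBot atBot := by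
    refine tendsto_atBot_mono' _ ((eventually_le_atBot 0).mono fun x hx => ?_) tendsto_id
    have := self_le_ellF hq (neg_nonneg.2 hx)
    rw [ellF_neg] at this
    simpa using neg_le_neg this
  exact hc.surjective htop hbot

lemma ellF_jacobiAm (hq : q ∈ Ico (0 : ℝ) 1) (u : ℝ) : ellF (jacobiAm u q) q = u :=
  Function.rightInverse_invFun (ellF_surjective hq) u

lemma jacobiAm_ellF (hq : q ∈ Ico (0 : ℝ) 1) (x : ℝ) : jacobiAm (ellF x q) q = x :=
  Function.leftInverse_invFun (ellF_strictMono hq).injective x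

lemma jacobiAm_strictMono (hq : q ∈ Ico (0 : ℝ) 1) : StrictMono fun u => jacobiAm u q := by
  intro u v huv
  rw [← ellF_jacobiAm hq u, ← ellF_jacobiAm hq v] at huv
  exact (ellF_strictMono hq).lt_iff_lt.1 huv

lemma continuous_jacobiAm (hq : q ∈ Ico (0 : ℝ) 1) : Continuous fun u => jacobiAm u q :=
  (jacobiAm_strictMono hq).monotone.continuous_of_surjective
    fun x => ⟨ellF x q, jacobiAm_ellF hq x⟩

lemma jacobiDn_pos (hq : q ∈ Ico (0 : ℝ) 1) (u : ℝ) : 0 < jacobiDn u q :=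
  sqrt_one_sub_mul_sin_sq_pos hq _

lemma jacobiDn_sq (hq : q ∈ Ico (0 : ℝ) 1) (u : ℝ) :
    jacobiDn u q ^ 2 = 1 - q ^ 2 * jacobiSn u q ^ 2 :=
  Real.sq_sqrt (one_sub_mul_sin_sq_pos hq _).le

lemma jacobiSn_sq_add (u q : ℝ) : jacobiSn u q ^ 2 + jacobiCn u q ^ 2 = 1 :=
  Real.sin_sq_add_cos_sq _

lemma hasDerivAt_jacobiAm (hq : q ∈ Ico (0 : ℝ) 1) (u : ℝ) :
    HasDerivAt (fun u => jacobiAm u q) (jacobiDn u q) u := by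
  have h := HasDerivAt.of_local_left_inverse (continuous_jacobiAm hq).continuousAt
    (hasDerivAt_ellF hq (jacobiAm u q))
    (one_div_pos.2 (sqrt_one_sub_mul_sin_sq_pos hq _)).ne'
    (Eventually.of_forall (ellF_jacobiAm hq))
  simpa [jacobiDn, jacobiSn] using h

lemma hasDerivAt_jacobiSn (hq : q ∈ Ico (0 : ℝ) 1) (u : ℝ) :
    HasDerivAt (fun u => jacobiSn u q) (jacobiCn u q * jacobiDn u q) u :=
  (hasDerivAt_jacobiAm hq u).sin

lemma hasDerivAt_jacobiCn (hq : q ∈ Ico (0 : ℝ) 1) (u : ℝ) :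
    HasDerivAt (fun u => jacobiCn u q) (-(jacobiSn u q * jacobiDn u q)) u :=
  (hasDerivAt_jacobiAm hq u).cos.congr_deriv (by simp [jacobiSn])

lemma hasDerivAt_jacobiDn (hq : q ∈ Ico (0 : ℝ) 1) (u : ℝ) :
    HasDerivAt (fun u => jacobiDn u q) (-(q ^ 2 * jacobiSn u q * jacobiCn u q)) u := by
  have h := ((((hasDerivAt_jacobiSn hq u).fun_pow 2).const_mul (q ^ 2)).const_sub 1).sqrt
    (one_sub_mul_sin_sq_pos hq _).ne'
  refine h.congr_deriv ?_
  have hd : √(1 - q ^ 2 * jacobiSn u q ^ 2) = jacobiDn u q := rfl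
  have hpos := jacobiDn_pos hq u
  rw [hd]
  field_simp
  ring

lemma hasDerivAt_ellE_jacobiAm (hq : q ∈ Ico (0 : ℝ) 1) (u : ℝ) :
    HasDerivAt (fun u => ellE (jacobiAm u q) q) (jacobiDn u q ^ 2) u := by
  have h := (hasDerivAt_ellE q (jacobiAm u q)).comp u (hasDerivAt_jacobiAm hq u)
  refine h.congr_deriv ?_
  rw [pow_two (jacobiDn u q)]; rfl

lemma contDiff_jacobiAm (hq : q ∈ Ico (0 : ℝ) 1) : ContDiff ℝ ∞ fun u => jacobiAm u q := by
  have hder : deriv (fun u => jacobiAm u q) = fun u => jacobiDn u q :=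
    funext fun u => (hasDerivAt_jacobiAm hq u).deriv
  rw [contDiff_infty]
  intro n
  -- `am` solves the autonomous equation `am' = √(1 - q² sin² am)`
  induction n with
  | zero => exact contDiff_zero.2 (continuous_jacobiAm hq)
  | succ n ih =>
    rw [Nat.cast_succ, contDiff_succ_iff_deriv]
    refine ⟨fun u => (hasDerivAt_jacobiAm hq u).differentiableAt, by simp, ?_⟩
    rw [hder]
    exact (contDiff_const.sub (contDiff_const.mul (ih.sin.pow 2))).sqrt
      fun _ => (one_sub_mul_sin_sq_pos hq _).ne'

lemma contDiff_jacobiCn (hq : q ∈ Ico (0 : ℝ) 1) : ContDiff ℝ ∞ fun u => jacobiCn u q :=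
  (contDiff_jacobiAm hq).cos

lemma contDiff_jacobiSn (hq : q ∈ Ico (0 : ℝ) 1) : ContDiff ℝ ∞ fun u => jacobiSn u q :=
  (contDiff_jacobiAm hq).sin

lemma contDiff_jacobiDn (hq : q ∈ Ico (0 : ℝ) 1) : ContDiff ℝ ∞ fun u => jacobiDn u q :=
  (contDiff_const.sub (contDiff_const.mul ((contDiff_jacobiSn hq).pow 2))).sqrt
    fun _ => (one_sub_mul_sin_sq_pos hq _).ne'

lemma contDiff_ellE_jacobiAm (hq : q ∈ Ico (0 : ℝ) 1) :
    ContDiff ℝ ∞ fun u => ellE (jacobiAm u q) q := by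
  rw [contDiff_infty_iff_deriv]
  refine ⟨fun u => (hasDerivAt_ellE_jacobiAm hq u).differentiableAt, ?_⟩
  rw [funext fun u => (hasDerivAt_ellE_jacobiAm hq u).deriv]
  exact (contDiff_jacobiDn hq).pow 2

lemma jacobiAm_zero (hq : q ∈ Ico (0 : ℝ) 1) : jacobiAm 0 q = 0 := by
  simpa [ellF_zero] using jacobiAm_ellF hq 0

lemma jacobiAm_compK (hq : q ∈ Ico (0 : ℝ) 1) : jacobiAm (compK q) q = Real.pi / 2 :=
  jacobiAm_ellF hq _

lemma jacobiAm_neg (hq : q ∈ Ico (0 : ℝ) 1) (u : ℝ) : jacobiAm (-u) q = -jacobiAm u q := by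
  apply (ellF_strictMono hq).injective
  simp only [ellF_neg, ellF_jacobiAm hq]

lemma jacobiCn_neg (hq : q ∈ Ico (0 : ℝ) 1) (u : ℝ) : jacobiCn (-u) q = jacobiCn u q := by
  simp [jacobiCn, jacobiAm_neg hq]

lemma jacobiSn_neg (hq : q ∈ Ico (0 : ℝ) 1) (u : ℝ) : jacobiSn (-u) q = -jacobiSn u q := by
  simp [jacobiSn, jacobiAm_neg hq]

lemma jacobiSn_zero (hq : q ∈ Ico (0 : ℝ) 1) : jacobiSn 0 q = 0 := by
  simp [jacobiSn, jacobiAm_zero hq]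

lemma jacobiCn_compK (hq : q ∈ Ico (0 : ℝ) 1) : jacobiCn (compK q) q = 0 := by
  simp [jacobiCn, jacobiAm_compK hq]

lemma compK_pos (hq : q ∈ Ico (0 : ℝ) 1) : 0 < compK q :=
  lt_of_lt_of_le (by positivity) (self_le_ellF hq (by positivity : 0 ≤ Real.pi / 2))

lemma jacobiAm_mem_Ioc (hq : q ∈ Ico (0 : ℝ) 1) {u : ℝ} (hu : u ∈ Ioc 0 (compK q)) :
    jacobiAm u q ∈ Ioc 0 (Real.pi / 2) := by
  rw [← jacobiAm_compK hq]
  nth_rw 1 [← jacobiAm_zero hq]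
  exact ⟨jacobiAm_strictMono hq hu.1, (jacobiAm_strictMono hq).monotone hu.2⟩

lemma jacobiSn_pos (hq : q ∈ Ico (0 : ℝ) 1) {u : ℝ} (hu : u ∈ Ioc 0 (compK q)) :
    0 < jacobiSn u q := by
  have h := jacobiAm_mem_Ioc hq hu
  exact Real.sin_pos_of_pos_of_lt_pi h.1 (by linarith [h.2, Real.pi_pos])

lemma jacobiCn_pos (hq : q ∈ Ico (0 : ℝ) 1) {u : ℝ} (hu : u ∈ Ioo (-compK q) (compK q)) :
    0 < jacobiCn u q := by
  refine Real.cos_pos_of_mem_Ioo ⟨?_, ?_⟩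
  · rw [← jacobiAm_compK hq, ← jacobiAm_neg hq]
    exact jacobiAm_strictMono hq hu.1
  · rw [← jacobiAm_compK hq]
    exact jacobiAm_strictMono hq hu.2

lemma jacobiCn_nonneg (hq : q ∈ Ico (0 : ℝ) 1) {u : ℝ} (hu : u ∈ Icc (-compK q) (compK q)) :
    0 ≤ jacobiCn u q := by
  refine Real.cos_nonneg_of_mem_Icc ⟨?_, ?_⟩
  · rw [← jacobiAm_compK hq, ← jacobiAm_neg hq]
    exact (jacobiAm_strictMono hq).monotone hu.1
  · rw [← jacobiAm_compK hq]
    exact (jacobiAm_strictMono hq).monotone hu.2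

end

/-! ### Complete elliptic integrals and the moduli `q̂`, `q_*`, `q₂` -/

lemma exists_isLeast_preimage {f : ℝ → ℝ} {a b c : ℝ} (hab : a ≤ b)
    (hf : ContinuousOn f (Icc a b)) (hc : c ∈ uIcc (f a) (f b)) :
    ∃ m, IsLeast {x | x ∈ Icc a b ∧ f x = c} m := by
  have hne : {x | x ∈ Icc a b ∧ f x = c}.Nonempty := by
    rw [← uIcc_of_le hab] at hf
    obtain ⟨x, hx, hxc⟩ := intermediate_value_uIcc hf hc
    exact ⟨x, by rwa [uIcc_of_le hab] at hx, hxc⟩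
  have hcpt : IsCompact {x | x ∈ Icc a b ∧ f x = c} :=
    isCompact_Icc.of_isClosed_subset (hf.preimage_isClosed_of_isClosed isClosed_Icc
      (isClosed_singleton (x := c))) fun x hx => hx.1
  exact hcpt.exists_isLeast hne

lemma continuous_compE : Continuous compE := by
  unfold compE ellE
  exact intervalIntegral.continuous_parametric_intervalIntegral_of_continuous' (by fun_prop) _ _

lemma continuousOn_compK {r : ℝ} (hr : r ∈ Ico (0 : ℝ) 1) : ContinuousOn compK (Icc 0 r) := by
  have hr2 : 0 < 1 - r ^ 2 := by nlinarith [hr.1, hr.2]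
  have h : Continuous fun q : ℝ =>
      ∫ θ in (0 : ℝ)..Real.pi / 2, 1 / √(max (1 - q ^ 2 * Real.sin θ ^ 2) (1 - r ^ 2)) := by
    refine intervalIntegral.continuous_parametric_intervalIntegral_of_continuous' ?_ _ _
    refine Continuous.div continuous_const (by fun_prop) fun p => ?_
    exact (Real.sqrt_pos.2 (lt_max_of_lt_right hr2)).ne'
  refine h.continuousOn.congr fun q hq => ?_
  unfold compK ellF
  refine intervalIntegral.integral_congr fun θ _ => ?_
  have h1 : q ^ 2 * Real.sin θ ^ 2 ≤ r ^ 2 * 1 :=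
    mul_le_mul (pow_le_pow_left₀ hq.1 hq.2 2) (Real.sin_sq_le_one θ) (sq_nonneg _) (sq_nonneg _)
  rw [max_eq_left (by linarith)]

lemma compK_mono {q r : ℝ} (hq : 0 ≤ q) (hqr : q ≤ r) (hr : r < 1) : compK q ≤ compK r := by
  have hr' : r ∈ Ico (0 : ℝ) 1 := ⟨hq.trans hqr, hr⟩
  refine intervalIntegral.integral_mono_on (by positivity)
    ((continuous_ellF_integrand ⟨hq, hqr.trans_lt hr⟩).intervalIntegrable _ _)
    ((continuous_ellF_integrand hr').intervalIntegrable _ _) fun θ _ => ?_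
  refine one_div_le_one_div_of_le (sqrt_one_sub_mul_sin_sq_pos hr' θ) (Real.sqrt_le_sqrt ?_)
  have := mul_le_mul_of_nonneg_right (pow_le_pow_left₀ hq hqr 2) (sq_nonneg (Real.sin θ))
  linarith

lemma compE_anti {q r : ℝ} (hq : 0 ≤ q) (hqr : q ≤ r) : compE r ≤ compE q := by
  refine intervalIntegral.integral_mono_on (by positivity)
    ((continuous_ellE_integrand r).intervalIntegrable _ _)
    ((continuous_ellE_integrand q).intervalIntegrable _ _) fun θ _ => Real.sqrt_le_sqrt ?_
  have := mul_le_mul_of_nonneg_right (pow_le_pow_left₀ hq hqr 2) (sq_nonneg (Real.sin θ))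
  linarith

lemma compE_pos {q : ℝ} (hq : q ∈ Ico (0 : ℝ) 1) : 0 < compE q :=
  intervalIntegral.intervalIntegral_pos_of_pos ((continuous_ellE_integrand q).intervalIntegrable _ _)
    (sqrt_one_sub_mul_sin_sq_pos hq) (by positivity)

lemma compE_le (q : ℝ) : compE q ≤ Real.pi / 2 := by
  have : compE q ≤ ∫ _θ in (0 : ℝ)..Real.pi / 2, (1 : ℝ) := by
    refine intervalIntegral.integral_mono_on (by positivity)
      ((continuous_ellE_integrand q).intervalIntegrable _ _) (by simp) fun θ _ => ?_
    exact Real.sqrt_le_one.2 (by nlinarith [mul_nonneg (sq_nonneg q) (sq_nonneg (Real.sin θ))])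
  simpa using this

lemma inv_sqrt_two_mem : 1 / √2 ∈ Ioo (0 : ℝ) 1 := by
  have h1 : (1 : ℝ) < √2 := Real.lt_sqrt_of_sq_lt (by norm_num)
  exact ⟨by positivity, by rw [div_lt_one (by positivity)]; exact h1⟩

lemma inv_sqrt_two_sq : (1 / √2) ^ 2 = (1 / 2 : ℝ) := by
  rw [div_pow, Real.sq_sqrt (by norm_num)]; norm_num

lemma two_compE_sub_compK_pos {q : ℝ} (hq : 0 ≤ q) (hq2 : q ≤ 1 / √2) :
    0 < 2 * compE q - compK q := by
  have hs := inv_sqrt_two_mem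
  have hs' : 1 / √2 ∈ Ico (0 : ℝ) 1 := ⟨hs.1.le, hs.2⟩
  have h1 := compK_mono hq hq2 hs.2
  have h2 := compE_anti hq hq2
  -- at `q = 1/√2` the integrand of `2E - K` is `cos² θ / √(1 - q² sin² θ)`
  have h3 : 0 < 2 * compE (1 / √2) - compK (1 / √2) := by
    have hi := (continuous_ellE_integrand (1 / √2)).intervalIntegrable (μ := volume) 0 (Real.pi / 2)
    have hi' := (continuous_ellF_integrand hs').intervalIntegrable (μ := volume) 0 (Real.pi / 2)
    unfold compE compK ellE ellF
    rw [← intervalIntegral.integral_const_mul, ← intervalIntegral.integral_sub (hi.const_mul 2) hi']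
    refine intervalIntegral.intervalIntegral_pos_of_pos_on ((hi.const_mul 2).sub hi')
      (fun θ hθ => ?_) (by positivity)
    have hp := sqrt_one_sub_mul_sin_sq_pos hs' θ
    have hsq := Real.sq_sqrt (one_sub_mul_sin_sq_pos hs' θ).le
    have hc : 0 < Real.cos θ := Real.cos_pos_of_mem_Ioo ⟨by linarith [hθ.1, Real.pi_pos], hθ.2⟩
    have htrig := Real.sin_sq_add_cos_sq θ
    generalize √(1 - (1 / √2) ^ 2 * Real.sin θ ^ 2) = D at hp hsq
    rw [inv_sqrt_two_sq] at hsq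
    have heq : 2 * D - 1 / D = Real.cos θ ^ 2 / D := by
      field_simp
      linarith
    rw [heq]
    positivity
  linarith

/-- Since `K(q) ≥ log ((π/2 + ε) / ε)` for `q² = 1 - ε²`, `K` is unbounded near `q = 1`, where `2E`
stays at most `π`. -/
lemma exists_two_compE_sub_compK_neg :
    ∃ q ∈ Ioo (1 / √2) 1, 2 * compE q - compK q ≤ 0 := by
  set ε : ℝ := Real.exp (-Real.pi) with hε
  have hε0 : 0 < ε := Real.exp_pos _
  have hε1 : ε < 1 / 2 := by
    have h1 : Real.exp (-Real.pi) < Real.exp (-1) :=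
      Real.exp_lt_exp.2 (by linarith [Real.pi_gt_three])
    linarith [Real.exp_neg_one_lt_half]
  have hε2 : ε ^ 2 < 1 / 2 := by nlinarith
  set q : ℝ := √(1 - ε ^ 2) with hqdef
  have hqsq : q ^ 2 = 1 - ε ^ 2 := Real.sq_sqrt (by linarith)
  have hq0 : 0 ≤ q := Real.sqrt_nonneg _
  have hq1 : q < 1 := by
    have : 0 < ε ^ 2 := by positivity
    nlinarith
  have hq2 : 1 / √2 < q := by
    refine lt_of_pow_lt_pow_left₀ 2 hq0 ?_
    rw [inv_sqrt_two_sq, hqsq]; linarith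
  refine ⟨q, ⟨hq2, hq1⟩, ?_⟩
  have hq : q ∈ Ico (0 : ℝ) 1 := ⟨hq0, hq1⟩
  have hK : Real.log ((Real.pi / 2 + ε) / ε) ≤ compK q := by
    have hd : ∀ x ∈ uIcc (0 : ℝ) (Real.pi / 2),
        HasDerivAt (fun θ => -Real.log (Real.pi / 2 - θ + ε)) (1 / (Real.pi / 2 - x + ε)) x := by
      intro x hx
      rw [uIcc_of_le (by positivity)] at hx
      have hpos : 0 < Real.pi / 2 - x + ε := by linarith [hx.2]
      have h := ((((hasDerivAt_id x).const_sub (Real.pi / 2)).add_const ε).log hpos.ne').neg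
      refine h.congr_deriv ?_
      simp only [id]
      ring
    have hcont : ContinuousOn (fun x : ℝ => 1 / (Real.pi / 2 - x + ε)) (uIcc 0 (Real.pi / 2)) := by
      refine continuousOn_const.div (by fun_prop) fun x hx => ?_
      rw [uIcc_of_le (by positivity)] at hx
      have hpos : 0 < Real.pi / 2 - x + ε := by linarith [hx.2]
      exact hpos.ne'
    have hint := intervalIntegral.integral_eq_sub_of_hasDerivAt hd hcont.intervalIntegrable
    have hlog : Real.log ((Real.pi / 2 + ε) / ε) =
        ∫ x in (0 : ℝ)..Real.pi / 2, 1 / (Real.pi / 2 - x + ε) := by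
      rw [hint, Real.log_div (by positivity) hε0.ne']
      simp only [sub_self, sub_zero, zero_add]
      ring
    rw [hlog]
    refine intervalIntegral.integral_mono_on (by positivity) hcont.intervalIntegrable
      ((continuous_ellF_integrand hq).intervalIntegrable _ _) fun θ hθ => ?_
    refine one_div_le_one_div_of_le (sqrt_one_sub_mul_sin_sq_pos hq θ) ?_
    rw [Real.sqrt_le_left (by linarith [hθ.2])]
    have hcos : Real.cos θ ≤ Real.pi / 2 - θ := by
      rw [← Real.sin_pi_div_two_sub]
      exact Real.sin_le (by linarith [hθ.2])
    have hcos0 : 0 ≤ Real.cos θ :=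
      Real.cos_nonneg_of_mem_Icc ⟨by linarith [hθ.1, Real.pi_pos], hθ.2⟩
    have htrig := Real.sin_sq_add_cos_sq θ
    have hs1 := Real.sin_sq_le_one θ
    rw [hqsq]
    nlinarith [mul_nonneg (sub_nonneg.2 hθ.2) hε0.le, sq_nonneg ε]
  have hlog : Real.pi ≤ Real.log ((Real.pi / 2 + ε) / ε) := by
    have h1 : (1 : ℝ) / ε ≤ (Real.pi / 2 + ε) / ε := by
      gcongr
      linarith [Real.pi_gt_three]
    have h2 := Real.log_le_log (by positivity) h1
    rwa [hε, one_div, ← Real.exp_neg, neg_neg, Real.log_exp] at h2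
  linarith [compE_le q]

lemma continuousOn_two_compE_sub_compK {r : ℝ} (hr : r ∈ Ico (0 : ℝ) 1) :
    ContinuousOn (fun q => 2 * compE q - compK q) (Icc 0 r) :=
  (continuous_compE.continuousOn.const_mul 2).sub (continuousOn_compK hr)

lemma isLeast_qStar :
    IsLeast {q | q ∈ Ioo (0 : ℝ) 1 ∧ 2 * compE q - compK q = 0} qStar := by
  obtain ⟨r, hr, hrneg⟩ := exists_two_compE_sub_compK_neg
  have hs := inv_sqrt_two_mem
  have hpos := two_compE_sub_compK_pos hs.1.le le_rfl
  have hc : ContinuousOn (fun q => 2 * compE q - compK q) (Icc (1 / √2) r) :=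
    (continuousOn_two_compE_sub_compK ⟨hs.1.le.trans hr.1.le, hr.2⟩).mono
      (Icc_subset_Icc_left hs.1.le)
  obtain ⟨m, ⟨hm, hm0⟩, hleast⟩ := exists_isLeast_preimage (c := 0) hr.1.le hc
    (mem_uIcc_of_ge hrneg hpos.le)
  have : IsLeast {q | q ∈ Ioo (0 : ℝ) 1 ∧ 2 * compE q - compK q = 0} m := by
    refine ⟨⟨⟨hs.1.trans_le hm.1, hm.2.trans_lt hr.2⟩, hm0⟩, fun z hz => ?_⟩
    rcases le_total z r with hzr | hzr
    · refine hleast ⟨⟨?_, hzr⟩, hz.2⟩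
      by_contra hcon
      exact (two_compE_sub_compK_pos hz.1.1.le (not_le.1 hcon).le).ne' hz.2
    · exact hm.2.trans hzr
  rw [qStar, this.csInf_eq]
  exact this

lemma qStar_mem : qStar ∈ Ioo (1 / √2) 1 := by
  have h := isLeast_qStar.1
  refine ⟨?_, h.1.2⟩
  by_contra hcon
  exact (two_compE_sub_compK_pos h.1.1.le (not_lt.1 hcon)).ne' h.2

lemma two_compE_sub_compK_qStar : 2 * compE qStar - compK qStar = 0 := isLeast_qStar.1.2

lemma two_compE_sub_compK_pos_of_lt_qStar {q : ℝ} (hq : 0 ≤ q) (hlt : q < qStar) :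
    0 < 2 * compE q - compK q := by
  rcases le_or_gt q (1 / √2) with h | h
  · exact two_compE_sub_compK_pos hq h
  · have hs := inv_sqrt_two_mem
    by_contra hcon
    have hpos := two_compE_sub_compK_pos hs.1.le le_rfl
    have hq1 : q < 1 := hlt.trans qStar_mem.2
    have hc : ContinuousOn (fun q => 2 * compE q - compK q) (Icc (1 / √2) q) :=
      (continuousOn_two_compE_sub_compK ⟨hq, hq1⟩).mono (Icc_subset_Icc_left hs.1.le)
    obtain ⟨m, ⟨hm, hm0⟩, -⟩ := exists_isLeast_preimage (c := 0) h.le hc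
      (mem_uIcc_of_ge (not_lt.1 hcon) hpos.le)
    have := isLeast_qStar.2 ⟨⟨hs.1.trans_le hm.1, hm.2.trans_lt hq1⟩, hm0⟩
    linarith [hm.2]

lemma isLeast_qHat : IsLeast {q | q ∈ Ico (1 / √2) 1 ∧ fAux q = 0} qHat ∧
    qHat ∈ Ioo (1 / √2) qStar := by
  have hs := inv_sqrt_two_mem
  have hst := qStar_mem
  have hsq := inv_sqrt_two_sq
  have h1 : 0 < fAux (1 / √2) := by
    have hpos := two_compE_sub_compK_pos hs.1.le le_rfl
    have h4 : (1 / √2 : ℝ) ^ 4 = 1 / 4 := by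
      rw [show (4 : ℕ) = 2 * 2 from rfl, pow_mul, hsq]; norm_num
    rw [fAux, h4, hsq]
    linarith
  -- at `q_*` one has `K = 2E`, and `f` reduces to `(1 - 2q²)E`
  have h2 : fAux qStar < 0 := by
    have hK : compK qStar = 2 * compE qStar := by linarith [two_compE_sub_compK_qStar]
    have hE := compE_pos (q := qStar) ⟨hs.1.le.trans hst.1.le, hst.2⟩
    have hlt : 1 / 2 < qStar ^ 2 := by
      rw [← hsq]; exact pow_lt_pow_left₀ hst.1 hs.1.le two_ne_zero
    rw [fAux, hK]
    nlinarith
  have hKc := (continuousOn_compK (r := qStar) ⟨hs.1.le.trans hst.1.le, hst.2⟩).mono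
    (Icc_subset_Icc_left hs.1.le)
  have hc : ContinuousOn fAux (Icc (1 / √2) qStar) := by
    unfold fAux
    have hE := continuous_compE.continuousOn (s := Icc (1 / √2) qStar)
    fun_prop
  obtain ⟨m, ⟨hm, hm0⟩, hleast⟩ := exists_isLeast_preimage (c := 0) hst.1.le hc
    (mem_uIcc_of_ge h2.le h1.le)
  have hm1 : 1 / √2 < m := lt_of_le_of_ne hm.1 fun h => by rw [← h] at hm0; linarith
  have hm2 : m < qStar := lt_of_le_of_ne hm.2 fun h => by rw [h] at hm0; linarith
  have : IsLeast {q | q ∈ Ico (1 / √2) 1 ∧ fAux q = 0} m := by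
    refine ⟨⟨⟨hm.1, hm2.trans hst.2⟩, hm0⟩, fun z hz => ?_⟩
    rcases le_total z qStar with h | h
    · exact hleast ⟨⟨hz.1.1, h⟩, hz.2⟩
    · exact hm.2.trans h
  rw [qHat, this.csInf_eq]
  exact ⟨this, hm1, hm2⟩

lemma half_lt_qHat_sq : 1 / 2 < qHat ^ 2 := by
  rw [← inv_sqrt_two_sq]
  exact pow_lt_pow_left₀ isLeast_qHat.2.1 inv_sqrt_two_mem.1.le two_ne_zero

lemma qHat_pos : 0 < qHat := inv_sqrt_two_mem.1.trans isLeast_qHat.2.1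

lemma lambdaHat_pos : 0 < lambdaHat := by
  have h1 := half_lt_qHat_sq
  have h2 := two_compE_sub_compK_pos_of_lt_qStar qHat_pos.le isLeast_qHat.2.2
  have h3 : 0 < 2 * qHat ^ 2 - 1 := by linarith
  rw [lambdaHat, gAux]
  positivity

lemma qTwo_spec {c : ℝ} (hc : c ∈ Ioc 0 lambdaHat) :
    qTwo c ∈ Ico qHat qStar ∧ gAux (qTwo c) = c := by
  have hs := inv_sqrt_two_mem
  have hst := qStar_mem
  have h2 : gAux qStar = 0 := by simp [gAux, two_compE_sub_compK_qStar]
  have hKc := (continuousOn_compK (r := qStar) ⟨hs.1.le.trans hst.1.le, hst.2⟩).mono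
    (Icc_subset_Icc_left qHat_pos.le)
  have hcont : ContinuousOn gAux (Icc qHat qStar) := by
    unfold gAux
    have hE := continuous_compE.continuousOn (s := Icc qHat qStar)
    fun_prop
  obtain ⟨m, ⟨hm, hmc⟩, hleast⟩ := exists_isLeast_preimage (c := c) isLeast_qHat.2.2.le hcont
    (mem_uIcc_of_ge (h2.trans_le hc.1.le) hc.2)
  have hm2 : m < qStar := lt_of_le_of_ne hm.2 fun h => by
    rw [h, h2] at hmc; exact hc.1.ne hmc
  have : IsLeast {q | q ∈ Ico qHat qStar ∧ gAux q = c} m :=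
    ⟨⟨⟨hm.1, hm2⟩, hmc⟩, fun z hz => hleast ⟨⟨hz.1.1, hz.1.2.le⟩, hz.2⟩⟩
  rw [qTwo, this.csInf_eq]
  exact this.1

/-! ### Geometry of the longer arc -/

/-- The scaling parameter `α = 2(2E(q) - K(q))` of the longer arc of modulus `q`. -/
noncomputable def arcScale (q : ℝ) : ℝ := 2 * (2 * compE q - compK q)

/-- The length `2K(q)/α` of the longer arc of modulus `q`. -/
noncomputable def arcLength (q : ℝ) : ℝ := 2 * compK q / arcScale q

/-- The longer arc, as a function of its modulus `q` and of the arclength `s`. -/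
noncomputable def arc (q s : ℝ) : Plane :=
  (1 / arcScale q) • !₂[2 * ellE (jacobiAm (arcScale q * s - compK q) q) q + 2 * compE q -
      arcScale q * s, 2 * q * jacobiCn (arcScale q * s - compK q) q]

/-- The unit tangent of the longer arc, as a function of the variable `u = αs - K(q)`. -/
noncomputable def arcTangent (q u : ℝ) : Plane :=
  !₂[2 * jacobiDn u q ^ 2 - 1, -(2 * q * jacobiSn u q * jacobiDn u q)]

/-- The signed curvature of the longer arc at arclength `s`. -/
noncomputable def arcCurvature (q s : ℝ) : ℝ :=
  -(2 * arcScale q * q * jacobiCn (arcScale q * s - compK q) q)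

lemma larcScale_one (lam : ℝ) : larcScale lam 1 = arcScale (qTwo lam) := by
  simp [larcScale, arcScale]

lemma larcLength_one (lam : ℝ) : larcLength lam 1 = arcLength (qTwo lam) := by
  rw [larcLength, larcScale_one]; simp [arcLength]

lemma larc_one (lam : ℝ) : larc lam 1 = arc (qTwo lam) := by
  funext s
  simp only [larc, larcScale_one, arc]
  simp

section

variable {q : ℝ}

lemma arc_apply_zero (q s : ℝ) : arc q s 0 = (2 * ellE (jacobiAm (arcScale q * s - compK q) q) q +
    2 * compE q - arcScale q * s) / arcScale q := by
  simp [arc, div_eq_inv_mul]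

lemma arc_apply_one (q s : ℝ) :
    arc q s 1 = 2 * q * jacobiCn (arcScale q * s - compK q) q / arcScale q := by
  simp [arc, div_eq_inv_mul]

lemma arcTangent_apply_zero (q u : ℝ) : arcTangent q u 0 = 2 * jacobiDn u q ^ 2 - 1 := rfl

lemma arcTangent_apply_one (q u : ℝ) :
    arcTangent q u 1 = -(2 * q * jacobiSn u q * jacobiDn u q) := rfl

lemma norm_arcTangent (hq : q ∈ Ico (0 : ℝ) 1) (u : ℝ) : ‖arcTangent q u‖ = 1 := by
  have h := plane_norm_sq (arcTangent q u)
  rw [arcTangent_apply_zero, arcTangent_apply_one] at h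
  have h2 := jacobiDn_sq hq u
  have h3 : ‖arcTangent q u‖ ^ 2 = 1 ^ 2 := by
    rw [h]
    linear_combination (4 * jacobiDn u q ^ 2) * h2
  exact (pow_left_inj₀ (norm_nonneg _) zero_le_one two_ne_zero).1 h3

lemma hasDerivAt_plane {c : ℝ → Plane} {v : Plane} {s : ℝ} :
    HasDerivAt c v s ↔ ∀ i, HasDerivAt (fun y => c y i) (v i) s := by
  simp only [← hasDerivWithinAt_univ]
  exact hasDerivWithinAt_plane

lemma hasDerivAt_arc (hq : q ∈ Ico (0 : ℝ) 1) (hα : 0 < arcScale q) (s : ℝ) :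
    HasDerivAt (arc q) (arcTangent q (arcScale q * s - compK q)) s := by
  have hlin : HasDerivAt (fun s => arcScale q * s - compK q) (arcScale q) s := by
    simpa using ((hasDerivAt_id s).const_mul (arcScale q)).sub_const (compK q)
  rw [hasDerivAt_plane]
  intro i
  fin_cases i
  · have h1 := (((hasDerivAt_ellE_jacobiAm hq _).comp s hlin).const_mul 2).add_const (2 * compE q)
    have h2 := (h1.sub ((hasDerivAt_id s).const_mul (arcScale q))).div_const (arcScale q)
    simp only [Fin.zero_eta, arc_apply_zero, arcTangent_apply_zero]
    refine h2.congr_deriv ?_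
    field_simp
  · have h1 := (((hasDerivAt_jacobiCn hq _).comp s hlin).const_mul (2 * q)).div_const (arcScale q)
    simp only [Fin.mk_one, arc_apply_one, arcTangent_apply_one]
    refine h1.congr_deriv ?_
    field_simp

/-- Frenet's equation for the longer arc. -/
lemma hasDerivAt_arcTangent (hq : q ∈ Ico (0 : ℝ) 1) (s : ℝ) :
    HasDerivAt (fun s => arcTangent q (arcScale q * s - compK q))
      (arcCurvature q s • rotQuarter (arcTangent q (arcScale q * s - compK q))) s := by
  have hlin : HasDerivAt (fun s => arcScale q * s - compK q) (arcScale q) s := by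
    simpa using ((hasDerivAt_id s).const_mul (arcScale q)).sub_const (compK q)
  have hsn := (hasDerivAt_jacobiSn hq _).comp s hlin
  have hdn := (hasDerivAt_jacobiDn hq _).comp s hlin
  have hsq := jacobiDn_sq hq (arcScale q * s - compK q)
  rw [hasDerivAt_plane]
  intro i
  fin_cases i
  · refine (((hdn.fun_pow 2).const_mul 2).sub_const 1).congr_deriv ?_
    simp [rotQuarter, arcCurvature, arcTangent_apply_one]
    ring
  · refine ((hsn.const_mul (2 * q)).fun_mul hdn).neg.congr_deriv ?_ |>.congr_of_eventuallyEq
      (Eventually.of_forall fun y => ?_)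
    · simp [rotQuarter, arcCurvature, arcTangent_apply_zero]
      linear_combination
        (2 * arcScale q * q * jacobiCn (arcScale q * s - compK q) q) * hsq
    · simp [arcTangent_apply_one]

lemma contDiff_arc (hq : q ∈ Ico (0 : ℝ) 1) : ContDiff ℝ ∞ (arc q) := by
  have hlin : ContDiff ℝ ∞ (fun s => arcScale q * s - compK q) := by fun_prop
  have h1 := (contDiff_ellE_jacobiAm hq).comp hlin
  have h2 := (contDiff_jacobiCn hq).comp hlin
  rw [contDiff_euclidean]
  intro i
  fin_cases i
  · simp only [Fin.zero_eta, arc_apply_zero]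
    exact (((contDiff_const.mul h1).add contDiff_const).sub
      (contDiff_const.mul contDiff_id)).div_const _
  · simp only [Fin.mk_one, arc_apply_one]
    exact (contDiff_const.mul h2).div_const _

lemma contDiff_arcCurvature (hq : q ∈ Ico (0 : ℝ) 1) : ContDiff ℝ ∞ (arcCurvature q) := by
  have hlin : ContDiff ℝ ∞ (fun s => arcScale q * s - compK q) := by fun_prop
  exact (contDiff_const.mul ((contDiff_jacobiCn hq).comp hlin)).neg

lemma arcLength_pos (hq : q ∈ Ico (0 : ℝ) 1) (hα : 0 < arcScale q) : 0 < arcLength q :=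
  div_pos (mul_pos two_pos (compK_pos hq)) hα

lemma arcScale_mul_arcLength (hα : 0 < arcScale q) : arcScale q * arcLength q = 2 * compK q := by
  rw [arcLength]; field_simp

lemma arc_zero (hq : q ∈ Ico (0 : ℝ) 1) : arc q 0 = !₂[0, 0] := by
  have h0 : arc q 0 0 = 0 := by
    rw [arc_apply_zero]
    simp only [mul_zero, zero_sub, jacobiAm_neg hq, jacobiAm_compK hq, ellE_neg]
    rw [show ellE (Real.pi / 2) q = compE q from rfl]
    ring
  have h1 : arc q 0 1 = 0 := by
    rw [arc_apply_one]
    simp [jacobiCn_neg hq, jacobiCn_compK hq]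
  ext i
  fin_cases i
  · simpa using h0
  · simpa using h1

/-- The longer arc is symmetric with respect to the line `x = 1/2`. -/
lemma arc_arcLength_sub (hq : q ∈ Ico (0 : ℝ) 1) (hα : 0 < arcScale q) (s : ℝ) :
    arc q (arcLength q - s) = !₂[1 - arc q s 0, arc q s 1] := by
  have hu : arcScale q * (arcLength q - s) - compK q = -(arcScale q * s - compK q) := by
    rw [mul_sub, arcScale_mul_arcLength hα]; ring
  have h0 : arc q (arcLength q - s) 0 = 1 - arc q s 0 := by
    have hα2 : arcScale q = 2 * (2 * compE q - compK q) := rfl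
    rw [arc_apply_zero, arc_apply_zero, hu, jacobiAm_neg hq, ellE_neg, mul_sub,
      arcScale_mul_arcLength hα]
    field_simp
    rw [hα2]
    ring
  have h1 : arc q (arcLength q - s) 1 = arc q s 1 := by
    rw [arc_apply_one, arc_apply_one, hu, jacobiCn_neg hq]
  ext i
  fin_cases i
  · simpa using h0
  · simpa using h1

lemma arc_arcLength (hq : q ∈ Ico (0 : ℝ) 1) (hα : 0 < arcScale q) :
    arc q (arcLength q) = !₂[1, 0] := by
  have h := arc_arcLength_sub hq hα 0
  rw [sub_zero] at h
  rw [h, arc_zero hq]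
  simp

lemma inner_rotQuarter_self (v : Plane) : inner ℝ (rotQuarter v) (rotQuarter v) = ‖v‖ ^ 2 := by
  rw [real_inner_self_eq_norm_sq, plane_norm_sq, plane_norm_sq]
  simp [rotQuarter]
  ring

lemma signedCurvature_arc (hq : q ∈ Ico (0 : ℝ) 1) (hα : 0 < arcScale q) {s : ℝ}
    (hs : s ∈ Icc 0 (arcLength q)) :
    signedCurvature (arcLength q) (arc q) s = arcCurvature q s := by
  have hu := uniqueDiffOn_Icc (arcLength_pos hq hα)
  have hd : deriv (arc q) = fun s => arcTangent q (arcScale q * s - compK q) :=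
    funext fun s => (hasDerivAt_arc hq hα s).deriv
  rw [signedCurvature, iteratedDerivWithin_eq_iteratedDeriv hu
    (contDiff_infty.1 (contDiff_arc hq) 2).contDiffAt hs,
    (hasDerivAt_arc hq hα s).hasDerivWithinAt.derivWithin (hu s hs),
    iteratedDeriv_succ, iteratedDeriv_one, hd, (hasDerivAt_arcTangent hq s).deriv,
    real_inner_smul_left, inner_rotQuarter_self, norm_arcTangent hq]
  ring

lemma hasDerivAt_arcCurvature (hq : q ∈ Ico (0 : ℝ) 1) (s : ℝ) :
    HasDerivAt (arcCurvature q) (2 * arcScale q ^ 2 * q *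
      (jacobiSn (arcScale q * s - compK q) q * jacobiDn (arcScale q * s - compK q) q)) s := by
  have hlin : HasDerivAt (fun s => arcScale q * s - compK q) (arcScale q) s := by
    simpa using ((hasDerivAt_id s).const_mul (arcScale q)).sub_const (compK q)
  refine (((hasDerivAt_jacobiCn hq _).comp s hlin).const_mul (2 * arcScale q * q)).neg.congr_deriv ?_
  ring

lemma iteratedDeriv_two_arcCurvature (hq : q ∈ Ico (0 : ℝ) 1) (s : ℝ) :
    iteratedDeriv 2 (arcCurvature q) s = 2 * arcScale q ^ 3 * q *
      (jacobiCn (arcScale q * s - compK q) q * (2 * jacobiDn (arcScale q * s - compK q) q ^ 2 - 1))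
      := by
  have hd : deriv (arcCurvature q) = fun s => 2 * arcScale q ^ 2 * q *
      (jacobiSn (arcScale q * s - compK q) q * jacobiDn (arcScale q * s - compK q) q) :=
    funext fun s => (hasDerivAt_arcCurvature hq s).deriv
  have hlin : HasDerivAt (fun s => arcScale q * s - compK q) (arcScale q) s := by
    simpa using ((hasDerivAt_id s).const_mul (arcScale q)).sub_const (compK q)
  have hsn := (hasDerivAt_jacobiSn hq _).comp s hlin
  have hdn := (hasDerivAt_jacobiDn hq _).comp s hlin
  have h := (hsn.fun_mul hdn).const_mul (2 * arcScale q ^ 2 * q)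
  have hsq := jacobiDn_sq hq (arcScale q * s - compK q)
  rw [iteratedDeriv_succ, iteratedDeriv_one, hd]
  refine h.deriv.trans ?_
  simp only [Function.comp]
  linear_combination
    (-2 * arcScale q ^ 3 * q * jacobiCn (arcScale q * s - compK q) q) * hsq

lemma isPenalizedPinnedElastica_arc (hq : q ∈ Ico (0 : ℝ) 1) (hα : 0 < arcScale q) {lam : ℝ}
    (hlam : lam = 2 * arcScale q ^ 2 * (2 * q ^ 2 - 1)) :
    IsPenalizedPinnedElastica lam (arcLength q) (arc q) where
  length_pos := arcLength_pos hq hα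
  smooth := (contDiff_arc hq).contDiffOn
  start_eq := arc_zero hq
  end_eq := arc_arcLength hq hα
  unit_speed s hs := by
    rw [(hasDerivAt_arc hq hα s).hasDerivWithinAt.derivWithin
      (uniqueDiffOn_Icc (arcLength_pos hq hα) s hs), norm_arcTangent hq]
  curvature_start := by
    rw [signedCurvature_arc hq hα (left_mem_Icc.2 (arcLength_pos hq hα).le)]
    simp [arcCurvature, jacobiCn_neg hq, jacobiCn_compK hq]
  curvature_end := by
    rw [signedCurvature_arc hq hα (right_mem_Icc.2 (arcLength_pos hq hα).le), arcCurvature,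
      arcScale_mul_arcLength hα, show 2 * compK q - compK q = compK q by ring, jacobiCn_compK hq]
    ring
  euler_lagrange s hs := by
    have hs' := Ioo_subset_Icc_self hs
    have hcongr : EqOn (signedCurvature (arcLength q) (arc q)) (arcCurvature q)
        (Icc 0 (arcLength q)) := fun t ht => signedCurvature_arc hq hα ht
    rw [iteratedDerivWithin_congr hcongr hs', signedCurvature_arc hq hα hs',
      iteratedDerivWithin_eq_iteratedDeriv (uniqueDiffOn_Icc (arcLength_pos hq hα))
      (contDiff_infty.1 (contDiff_arcCurvature hq) 2).contDiffAt hs',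
      iteratedDeriv_two_arcCurvature hq, hlam, arcCurvature]
    have hsq := jacobiDn_sq hq (arcScale q * s - compK q)
    have hsc := jacobiSn_sq_add (arcScale q * s - compK q) q
    linear_combination (8 * arcScale q ^ 3 * q * jacobiCn (arcScale q * s - compK q) q) * hsq
      - (8 * arcScale q ^ 3 * q ^ 3 * jacobiCn (arcScale q * s - compK q) q) * hsc

end

/-! ### The longer arc as a competitor -/

lemma hasWeakDeriv_deriv {f : ℝ → Plane} (hf : ContDiff ℝ 1 f) : HasWeakDeriv f (deriv f) := by
  intro φ hφ _ hφs
  have hφ0 : φ 0 = 0 := image_eq_zero_of_notMem_tsupport fun hm => (hφs hm).1.false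
  have hφ1 : φ 1 = 0 := image_eq_zero_of_notMem_tsupport fun hm => (hφs hm).2.false
  have hd : Continuous (deriv φ) := hφ.continuous_deriv (by simp)
  have hd' : Continuous (deriv f) := hf.continuous_deriv le_rfl
  have hc1 : Continuous fun x => φ x • deriv f x := hφ.continuous.smul hd'
  have hc2 : Continuous fun x => deriv φ x • f x := hd.smul hf.continuous
  have h := intervalIntegral.integral_eq_sub_of_hasDerivAt (a := 0) (b := 1)
    (f := fun x => φ x • f x) (f' := fun x => φ x • deriv f x + deriv φ x • f x)
    (fun x _ => ((hφ.differentiable (by simp)).differentiableAt.hasDerivAt).fun_smul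
      ((hf.differentiable one_ne_zero).differentiableAt.hasDerivAt))
    ((hc1.add hc2).intervalIntegrable _ _)
  rw [hφ0, hφ1, intervalIntegral.integral_add (hc1.intervalIntegrable _ _)
    (hc2.intervalIntegrable _ _), intervalIntegral.integral_of_le zero_le_one,
    intervalIntegral.integral_of_le zero_le_one, integral_Ioc_eq_integral_Ioo,
    integral_Ioc_eq_integral_Ioo] at h
  simp only [zero_smul, sub_self] at h
  exact eq_neg_of_add_eq_zero_right h

lemma memLp_two_of_continuous {f : ℝ → Plane} (hf : Continuous f) :
    MemLp f 2 (volume.restrict (Ioo 0 1)) := by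
  obtain ⟨C, hC⟩ := isCompact_Icc.exists_bound_of_continuousOn (hf.continuousOn (s := Icc 0 1))
  refine MemLp.of_bound hf.aestronglyMeasurable C ?_
  rw [ae_restrict_iff' measurableSet_Ioo]
  exact Eventually.of_forall fun x hx => hC x (Ioo_subset_Icc_self hx)

lemma memW22_of_contDiff {γ : ℝ → Plane} (h : ContDiff ℝ 2 γ) : MemW22 γ := by
  have h2 : ContDiff ℝ 1 (deriv γ) := by
    rw [show (2 : WithTop ℕ∞) = 1 + 1 by norm_num] at h
    exact (contDiff_succ_iff_deriv.1 h).2.2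
  refine ⟨h.continuous.continuousOn, deriv γ, deriv (deriv γ),
    memLp_two_of_continuous h2.continuous,
    memLp_two_of_continuous (h2.continuous_deriv le_rfl),
    hasWeakDeriv_deriv (h.of_le (by norm_num)), hasWeakDeriv_deriv h2⟩

/-- The constant speed parametrization of the longer arc on the unit interval. -/
noncomputable def arcUnit (q x : ℝ) : Plane := arc q (arcLength q * x)

section

variable {q : ℝ}

lemma hasDerivAt_arcUnit (hq : q ∈ Ico (0 : ℝ) 1) (hα : 0 < arcScale q) (x : ℝ) :
    HasDerivAt (arcUnit q)
      (arcLength q • arcTangent q (arcScale q * (arcLength q * x) - compK q)) x := by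
  have hlin : HasDerivAt (fun x => arcLength q * x) (arcLength q) x := by
    simpa using (hasDerivAt_id x).const_mul (arcLength q)
  exact (hasDerivAt_arc hq hα (arcLength q * x)).scomp x hlin

lemma velocity_arcUnit (hq : q ∈ Ico (0 : ℝ) 1) (hα : 0 < arcScale q) {x : ℝ}
    (hx : x ∈ Icc (0 : ℝ) 1) : velocity (arcUnit q) x =
      arcLength q • arcTangent q (arcScale q * (arcLength q * x) - compK q) :=
  (hasDerivAt_arcUnit hq hα x).hasDerivWithinAt.derivWithin (uniqueDiffOn_Icc zero_lt_one x hx)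

lemma norm_velocity_arcUnit (hq : q ∈ Ico (0 : ℝ) 1) (hα : 0 < arcScale q) {x : ℝ}
    (hx : x ∈ Icc (0 : ℝ) 1) : ‖velocity (arcUnit q) x‖ = arcLength q := by
  rw [velocity_arcUnit hq hα hx, norm_smul, norm_arcTangent hq, mul_one, Real.norm_eq_abs,
    abs_of_pos (arcLength_pos hq hα)]

lemma memW22Imm_arcUnit (hq : q ∈ Ico (0 : ℝ) 1) (hα : 0 < arcScale q) :
    MemW22Imm (arcUnit q) := by
  refine ⟨memW22_of_contDiff ?_, fun x hx h0 => ?_⟩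
  · exact (contDiff_infty.1 (contDiff_arc hq) 2).comp (contDiff_const.mul contDiff_id)
  · have := norm_velocity_arcUnit hq hα hx
    rw [h0, norm_zero] at this
    exact (arcLength_pos hq hα).ne this

lemma length_arcUnit (hq : q ∈ Ico (0 : ℝ) 1) (hα : 0 < arcScale q) :
    length (arcUnit q) = arcLength q := by
  rw [length, arclength]
  rw [intervalIntegral.integral_congr (g := fun _ => arcLength q) fun x hx => ?_]
  · simp
  · rw [uIcc_of_le zero_le_one] at hx
    exact norm_velocity_arcUnit hq hα hx

lemma norm_curvatureVec_arcUnit_sq (hq : q ∈ Ico (0 : ℝ) 1) (hα : 0 < arcScale q) {x : ℝ}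
    (hx : x ∈ Icc (0 : ℝ) 1) :
    ‖curvatureVec (arcUnit q) x‖ ^ 2 = arcCurvature q (arcLength q * x) ^ 2 := by
  have hL := arcLength_pos hq hα
  have hT : EqOn (arcDeriv (arcUnit q) (arcUnit q))
      (fun x => arcTangent q (arcScale q * (arcLength q * x) - compK q)) (Icc 0 1) := by
    intro y hy
    have h1 := velocity_arcUnit hq hα hy
    rw [velocity] at h1
    rw [arcDeriv, norm_velocity_arcUnit hq hα hy, h1, smul_smul, inv_mul_cancel₀ hL.ne', one_smul]
  have hlin : HasDerivAt (fun x => arcLength q * x) (arcLength q) x := by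
    simpa using (hasDerivAt_id x).const_mul (arcLength q)
  have hd := (hasDerivAt_arcTangent hq (arcLength q * x)).scomp x hlin
  rw [curvatureVec, arcDeriv, norm_velocity_arcUnit hq hα hx, derivWithin_congr hT (hT hx)]
  have h2 := hd.hasDerivWithinAt.derivWithin (uniqueDiffOn_Icc zero_lt_one x hx)
  simp only [Function.comp_def] at h2
  rw [h2, smul_smul, inv_mul_cancel₀ hL.ne', one_smul, norm_smul, mul_pow,
    ← real_inner_self_eq_norm_sq (rotQuarter _), inner_rotQuarter_self, norm_arcTangent hq]
  simp

lemma bending_arcUnit (hq : q ∈ Ico (0 : ℝ) 1) (hα : 0 < arcScale q) :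
    bending (arcUnit q) = 8 * arcScale q * (compE q - (1 - q ^ 2) * compK q) := by
  have hL := arcLength_pos hq hα
  rw [bending, intervalIntegral.integral_congr
    (g := fun x => arcCurvature q (arcLength q * x) ^ 2 * arcLength q) fun x hx => ?_]
  · have hd : ∀ x ∈ uIcc (0 : ℝ) 1, HasDerivAt (fun x => 4 * arcScale q *
        ((q ^ 2 - 1) * (arcScale q * (arcLength q * x) - compK q) +
          ellE (jacobiAm (arcScale q * (arcLength q * x) - compK q) q) q))
        (arcCurvature q (arcLength q * x) ^ 2 * arcLength q) x := by
      intro x _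
      have hlin : HasDerivAt (fun x => arcScale q * (arcLength q * x) - compK q)
          (arcScale q * arcLength q) x := by
        simpa using (((hasDerivAt_id x).const_mul (arcLength q)).const_mul
          (arcScale q)).sub_const (compK q)
      have h1 := (hasDerivAt_ellE_jacobiAm hq _).comp x hlin
      refine (((hlin.const_mul (q ^ 2 - 1)).fun_add h1).const_mul (4 * arcScale q)).congr_deriv ?_
      have hsq := jacobiDn_sq hq (arcScale q * (arcLength q * x) - compK q)
      have hsc := jacobiSn_sq_add (arcScale q * (arcLength q * x) - compK q) q
      rw [arcCurvature]
      linear_combination (4 * arcScale q ^ 2 * arcLength q) * hsq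
        - (4 * arcScale q ^ 2 * arcLength q * q ^ 2) * hsc
    have hcont : Continuous fun x => arcCurvature q (arcLength q * x) ^ 2 * arcLength q :=
      (((contDiff_arcCurvature hq).continuous.comp (continuous_const.mul continuous_id)).pow
        2).mul continuous_const
    rw [intervalIntegral.integral_eq_sub_of_hasDerivAt hd (hcont.intervalIntegrable _ _)]
    rw [mul_one, arcScale_mul_arcLength hα, mul_zero, mul_zero,
      show 2 * compK q - compK q = compK q by ring, zero_sub, jacobiAm_neg hq, jacobiAm_compK hq,
      ellE_neg, show ellE (Real.pi / 2) q = compE q from rfl]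
    ring
  · rw [uIcc_of_le zero_le_one] at hx
    simp only
    rw [norm_velocity_arcUnit hq hα hx, norm_curvatureVec_arcUnit_sq hq hα hx]

lemma energy_arcUnit (hq : q ∈ Ico (0 : ℝ) 1) (hα : 0 < arcScale q) {lam : ℝ}
    (hlam : lam = 2 * arcScale q ^ 2 * (2 * q ^ 2 - 1)) :
    energy lam (arcUnit q) =
      2 * arcScale q ^ 2 + 8 * arcScale q * compK q * (2 * q ^ 2 - 1) := by
  have h := arcScale_mul_arcLength hα
  have hα2 : arcScale q = 2 * (2 * compE q - compK q) := rfl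
  rw [energy, bending_arcUnit hq hα, length_arcUnit hq hα, hlam]
  have h2 : 2 * arcScale q ^ 2 * (2 * q ^ 2 - 1) * arcLength q =
      2 * arcScale q * (2 * q ^ 2 - 1) * (2 * compK q) := by rw [← h]; ring
  rw [h2]
  linear_combination (-2 * arcScale q) * hα2

lemma mem_Icc_of_mem_arc (hα : 0 < arcScale q) {s : ℝ} (hs : s ∈ Icc 0 (arcLength q)) :
    arcScale q * s - compK q ∈ Icc (-compK q) (compK q) := by
  have h1 := mul_nonneg hα.le hs.1
  have h2 := mul_le_mul_of_nonneg_left hs.2 hα.le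
  rw [arcScale_mul_arcLength hα] at h2
  constructor <;> linarith

lemma arc_one_nonneg (hq : q ∈ Ico (0 : ℝ) 1) (hα : 0 < arcScale q) {s : ℝ}
    (hs : s ∈ Icc 0 (arcLength q)) : 0 ≤ arc q s 1 := by
  rw [arc_apply_one]
  have := jacobiCn_nonneg hq (mem_Icc_of_mem_arc hα hs)
  have := hq.1
  positivity

/-- While its first coordinate lies in `(0,1)`, the longer arc runs at a height proportional to
`1/α`: it enters this strip only after its tangent has turned past the vertical. -/
lemma le_arc_one_sq (hq : q ∈ Ico (0 : ℝ) 1) (hα : 0 < arcScale q) {s : ℝ}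
    (hs : s ∈ Icc 0 (arcLength q)) (hX : arc q s 0 ∈ Ioo (0 : ℝ) 1) :
    2 * (2 * q ^ 2 - 1) ≤ (arcScale q * arc q s 1) ^ 2 := by
  have hu := mem_Icc_of_mem_arc hα hs
  set u := arcScale q * s - compK q with hudef
  let G : ℝ → ℝ := fun v => 2 * ellE (jacobiAm v q) q - v
  have hGK : G (compK q) = arcScale q / 2 := by
    simp only [G, jacobiAm_compK hq]
    rw [show ellE (Real.pi / 2) q = compE q from rfl, arcScale]; ring
  have hGneg : ∀ v, G (-v) = -G v := fun v => by
    simp only [G, jacobiAm_neg hq, ellE_neg]; ring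
  have hGu : G u = arcScale q * arc q s 0 - arcScale q / 2 := by
    rw [arc_apply_zero, mul_div_cancel₀ _ hα.ne', ← hudef, arcScale]
    simp only [G]
    have : arcScale q * s = u + compK q := by rw [hudef]; ring
    rw [arcScale] at this
    rw [this]; ring
  have hGabs : G |u| < G (compK q) := by
    rw [hGK]
    rcases abs_choice u with h | h <;> rw [h]
    · rw [hGu]; nlinarith [hX.2]
    · rw [hGneg, hGu]; nlinarith [hX.1]
  have hsnabs : jacobiSn |u| q ^ 2 = jacobiSn u q ^ 2 := by
    rcases abs_choice u with h | h <;> rw [h]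
    rw [jacobiSn_neg hq, neg_sq]
  have hle : |u| ≤ compK q := abs_le.2 hu
  have key : q ^ 2 * jacobiSn |u| q ^ 2 ≤ 1 / 2 := by
    by_contra hcon
    have hanti : AntitoneOn G (Icc |u| (compK q)) := by
      refine antitoneOn_of_hasDerivWithinAt_nonpos (f' := fun v => 2 * jacobiDn v q ^ 2 - 1)
        (convex_Icc _ _) (fun v _ => ?_) (fun v _ => ?_) (fun v hv => ?_)
      · exact (((hasDerivAt_ellE_jacobiAm hq v).const_mul 2).sub
          (hasDerivAt_id v)).continuousAt.continuousWithinAt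
      · exact (((hasDerivAt_ellE_jacobiAm hq v).const_mul 2).sub
          (hasDerivAt_id v)).hasDerivWithinAt
      · rw [interior_Icc] at hv
        have h0 : 0 ≤ jacobiSn |u| q := by
          rcases (abs_nonneg u).eq_or_lt with h | h
          · rw [← h, jacobiSn_zero hq]
          · exact (jacobiSn_pos hq ⟨h, hle⟩).le
        have hmono : jacobiSn |u| q ≤ jacobiSn v q := by
          have hv2 := jacobiAm_mem_Ioc hq ⟨(abs_nonneg u).trans_lt hv.1, hv.2.le⟩
          refine Real.sin_le_sin_of_le_of_le_pi_div_two ?_ hv2.2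
            ((jacobiAm_strictMono hq).monotone hv.1.le)
          have := (jacobiAm_strictMono hq).monotone (abs_nonneg u)
          simp only [jacobiAm_zero hq] at this
          linarith [Real.pi_pos]
        have h1 := mul_le_mul_of_nonneg_left (pow_le_pow_left₀ h0 hmono 2) (sq_nonneg q)
        have h2 := jacobiDn_sq hq v
        linarith
    have := hanti (left_mem_Icc.2 hle) (right_mem_Icc.2 hle) hle
    linarith
  have hsc := jacobiSn_sq_add u q
  rw [hsnabs] at key
  rw [arc_apply_one, mul_div_cancel₀ _ hα.ne', ← hudef]
  nlinarith

/-- If the scaling parameter is small, then the longer arc stays strictly above the obstacle. -/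
lemma lt_arc_one {ψ : ℝ → ℝ} (hψ : IsObstacle ψ) (hq : q ∈ Ico (0 : ℝ) 1) (hα : 0 < arcScale q)
    {M : ℝ} (hM : ∀ x ∈ Icc (0 : ℝ) 1, ψ x ≤ M)
    (hsmall : (arcScale q * M) ^ 2 < 2 * (2 * q ^ 2 - 1)) {s : ℝ}
    (hs : s ∈ Icc 0 (arcLength q)) : ψ (arc q s 0) < arc q s 1 := by
  have hy := arc_one_nonneg hq hα hs
  rcases le_or_gt (arc q s 0) 0 with h0 | h0
  · exact (hψ.neg_left _ h0).trans_le hy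
  rcases le_or_gt 1 (arc q s 0) with h1 | h1
  · exact (hψ.neg_right _ h1).trans_le hy
  have h2 := hsmall.trans_le (le_arc_one_sq hq hα hs ⟨h0, h1⟩)
  have h3 := lt_of_pow_lt_pow_left₀ 2 (by positivity) h2
  exact (hM _ ⟨h0.le, h1.le⟩).trans_lt (lt_of_mul_lt_mul_left h3 hα.le)

lemma arcUnit_mem_admissibleSym {ψ : ℝ → ℝ} (hq : q ∈ Ico (0 : ℝ) 1) (hα : 0 < arcScale q)
    (habove : ∀ s ∈ Icc 0 (arcLength q), ψ (arc q s 0) < arc q s 1) :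
    arcUnit q ∈ admissibleSym ψ := by
  have hL := arcLength_pos hq hα
  refine ⟨⟨memW22Imm_arcUnit hq hα, ?_, ?_, fun x hx => ?_⟩, fun x _ => ?_⟩
  · rw [arcUnit, mul_zero, arc_zero hq]
  · rw [arcUnit, mul_one, arc_arcLength hq hα]
  · exact (habove _ ⟨mul_nonneg hL.le hx.1, mul_le_of_le_one_right hL.le hx.2⟩).le
  · rw [arcUnit, mul_sub, mul_one, arc_arcLength_sub hq hα]
    rfl

end

/-! ### The calibration inequality -/

/-- Half of a symmetric curve, described by the components `c`, `τ` of its unit tangent, the speed of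
rotation `l` of the tangent and the speed `v`, all with respect to a parameter in `[a,b]`. It starts
in the direction `(1,0)`; its bending energy is `∫ l²/v`. -/
structure IsHalfFrame (a b : ℝ) (c τ l v : ℝ → ℝ) : Prop where
  lt : a < b
  ac_c : AbsolutelyContinuousOnInterval c a b
  ac_τ : AbsolutelyContinuousOnInterval τ a b
  frenet : ∀ᵐ x, x ∈ Ioo a b → HasDerivAt c (-(τ x * l x)) x ∧ HasDerivAt τ (c x * l x) x
  norm_eq : ∀ x ∈ Icc a b, c x ^ 2 + τ x ^ 2 = 1
  start_eq : c a = 1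
  continuousOn_v : ContinuousOn v (Icc a b)
  v_pos : ∀ x ∈ Icc a b, 0 < v x
  integrableOn_l : IntegrableOn l (Icc a b)
  integrableOn_energy : IntegrableOn (fun x => l x ^ 2 / v x) (Icc a b)

section

variable {a b : ℝ} {c τ l v : ℝ → ℝ}

lemma IsHalfFrame.intervalIntegrable_v (h : IsHalfFrame a b c τ l v) {x y : ℝ}
    (hx : x ∈ Icc a b) (hy : y ∈ Icc a b) : IntervalIntegrable v volume x y :=
  (h.continuousOn_v.mono (uIcc_subset_Icc hx hy)).intervalIntegrable

lemma IsHalfFrame.intervalIntegrable_l (h : IsHalfFrame a b c τ l v) {x y : ℝ}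
    (hx : x ∈ Icc a b) (hy : y ∈ Icc a b) : IntervalIntegrable l volume x y :=
  (h.integrableOn_l.mono_set (uIcc_subset_Icc hx hy)).intervalIntegrable

lemma IsHalfFrame.intervalIntegrable_energy (h : IsHalfFrame a b c τ l v) {x y : ℝ}
    (hx : x ∈ Icc a b) (hy : y ∈ Icc a b) :
    IntervalIntegrable (fun x => l x ^ 2 / v x) volume x y :=
  (h.integrableOn_energy.mono_set (uIcc_subset_Icc hx hy)).intervalIntegrable

lemma IsHalfFrame.integral_v_pos (h : IsHalfFrame a b c τ l v) {x : ℝ} (hx : x ∈ Ioc a b) :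
    0 < ∫ t in a..x, v t := by
  refine intervalIntegral.intervalIntegral_pos_of_pos_on
    (h.intervalIntegrable_v (left_mem_Icc.2 h.lt.le) (Ioc_subset_Icc_self hx)) (fun t ht => ?_) hx.1
  exact h.v_pos t ⟨ht.1.le, ht.2.le.trans hx.2⟩

/-- The Cauchy-Schwarz inequality, bounding the total rotation by bending energy and length. -/
lemma IsHalfFrame.sq_integral_abs_le (h : IsHalfFrame a b c τ l v) {x : ℝ} (hx : x ∈ Ioc a b) :
    (∫ t in a..x, |l t|) ^ 2 ≤ (∫ t in a..x, l t ^ 2 / v t) * ∫ t in a..x, v t := by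
  have ha := left_mem_Icc.2 h.lt.le
  have hx' := Ioc_subset_Icc_self hx
  set r := ∫ t in a..x, |l t| with hr
  set e := ∫ t in a..x, l t ^ 2 / v t with he
  set V := ∫ t in a..x, v t with hV
  have hVpos : 0 < V := h.integral_v_pos hx
  have hquad : 2 * (r / V) * r ≤ e + (r / V) ^ 2 * V := by
    rw [hr, he, hV, ← intervalIntegral.integral_const_mul, ← intervalIntegral.integral_const_mul,
      ← intervalIntegral.integral_add (h.intervalIntegrable_energy ha hx')
      ((h.intervalIntegrable_v ha hx').const_mul _)]
    refine intervalIntegral.integral_mono_on hx.1.le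
      ((h.intervalIntegrable_l ha hx').abs.const_mul _)
      ((h.intervalIntegrable_energy ha hx').add ((h.intervalIntegrable_v ha hx').const_mul _))
      fun t ht => ?_
    rw [← hr, ← hV]
    have hv := h.v_pos t ⟨ht.1, ht.2.trans hx.2⟩
    have hid : l t ^ 2 / v t + (r / V) ^ 2 * v t - 2 * (r / V) * |l t| =
        (|l t| - r / V * v t) ^ 2 / v t := by
      rw [← sq_abs (l t)]
      field_simp
      ring
    have : 0 ≤ (|l t| - r / V * v t) ^ 2 / v t := by positivity
    linarith
  have h2 : 2 * (r / V) * r = 2 * r ^ 2 / V := by ring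
  have h3 : (r / V) ^ 2 * V = r ^ 2 / V := by field_simp
  have h4 : 2 * r ^ 2 / V = r ^ 2 / V + r ^ 2 / V := by ring
  rw [h2, h3, h4] at hquad
  rw [← div_le_iff₀ hVpos]
  linarith

lemma IsHalfFrame.abs_c_le (h : IsHalfFrame a b c τ l v) {x : ℝ} (hx : x ∈ Icc a b) :
    |c x| ≤ 1 := abs_le_one_iff_mul_self_le_one.2 (by nlinarith [h.norm_eq x hx, sq_nonneg (τ x)])

lemma IsHalfFrame.abs_τ_le (h : IsHalfFrame a b c τ l v) {x : ℝ} (hx : x ∈ Icc a b) :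
    |τ x| ≤ 1 := abs_le_one_iff_mul_self_le_one.2 (by nlinarith [h.norm_eq x hx, sq_nonneg (c x)])

lemma IsHalfFrame.start_τ (h : IsHalfFrame a b c τ l v) : τ a = 0 := by
  have := h.norm_eq a (left_mem_Icc.2 h.lt.le)
  rw [h.start_eq] at this
  nlinarith

/-- The tangent can leave its initial direction only at the cost of rotation. -/
lemma IsHalfFrame.one_sub_c_le (h : IsHalfFrame a b c τ l v) {x : ℝ} (hx : x ∈ Ioc a b) :
    1 - c x ≤ 2 * ((∫ t in a..x, l t ^ 2 / v t) * ∫ t in a..x, v t) := by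
  have ha := left_mem_Icc.2 h.lt.le
  have hx' := Ioc_subset_Icc_self hx
  have hsub : uIcc a x ⊆ uIcc a b := by
    rw [uIcc_of_le hx.1.le, uIcc_of_le h.lt.le]; exact Icc_subset_Icc_right hx.2
  have hCS := h.sq_integral_abs_le hx
  set r := ∫ t in a..x, |l t| with hr
  have hbound : ∀ {f f' : ℝ → ℝ}, AbsolutelyContinuousOnInterval f a b →
      (∀ᵐ t, t ∈ Ioo a b → HasDerivAt f (f' t) t) → (∀ t ∈ Icc a b, |f' t| ≤ |l t|) →
      |f x - f a| ≤ r := by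
    intro f f' hf hf' hle
    have hae : ∀ᵐ t, t ∈ uIoc a x → HasDerivAt f (f' t) t := by
      filter_upwards [hf', ae_mem_Ioo_of_mem_uIoc hx.1.le] with t h1 h2 h3
      exact h1 ⟨(h2 h3).1, (h2 h3).2.trans_le hx.2⟩
    rw [← ((hf.mono hsub).integral_eq_sub_of_ae_hasDerivAt hae).2, ← Real.norm_eq_abs]
    refine intervalIntegral.norm_integral_le_of_norm_le hx.1.le
      (Eventually.of_forall fun t ht => ?_) (h.intervalIntegrable_l ha hx').abs
    exact hle t ⟨ht.1.le, ht.2.trans hx.2⟩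
  have h1 : |c x - c a| ≤ r := by
    refine hbound h.ac_c (h.frenet.mono fun t ht hm => (ht hm).1) fun t ht => ?_
    rw [abs_neg, abs_mul]
    exact mul_le_of_le_one_left (abs_nonneg _) (h.abs_τ_le ht)
  have h2 : |τ x - τ a| ≤ r := by
    refine hbound h.ac_τ (h.frenet.mono fun t ht hm => (ht hm).2) fun t ht => ?_
    rw [abs_mul]
    exact mul_le_of_le_one_left (abs_nonneg _) (h.abs_c_le ht)
  rw [h.start_eq] at h1
  rw [h.start_τ, sub_zero] at h2
  have h3 := h.norm_eq x hx'
  have h4 : τ x ^ 2 ≤ r ^ 2 := by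
    rw [← sq_abs (τ x)]; exact pow_le_pow_left₀ (abs_nonneg _) h2 2
  have h5 := abs_le.1 h1
  have h6 := abs_le.1 (h.abs_c_le hx')
  have h7 : 1 - c x ≤ 2 * r ^ 2 := by
    rcases le_or_gt 1 r with hr1 | hr1
    · nlinarith
    · nlinarith [sq_nonneg r]
  linarith

/-- The slope `cn/(sn dn)` of the calibrating field of extremals. -/
noncomputable def calib (q u : ℝ) : ℝ := jacobiCn u q / (jacobiSn u q * jacobiDn u q)

lemma contDiffOn_calib {q : ℝ} (hq : q ∈ Ico (0 : ℝ) 1) :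
    ContDiffOn ℝ 1 (calib q) {u | jacobiSn u q ≠ 0} := by
  have h1 := (contDiff_infty.1 (contDiff_jacobiCn hq) 1).contDiffOn (s := {u | jacobiSn u q ≠ 0})
  have h2 := (contDiff_infty.1 (contDiff_jacobiSn hq) 1).contDiffOn (s := {u | jacobiSn u q ≠ 0})
  have h3 := (contDiff_infty.1 (contDiff_jacobiDn hq) 1).contDiffOn (s := {u | jacobiSn u q ≠ 0})
  exact h1.div (h2.mul h3) fun u hu => mul_ne_zero hu (jacobiDn_pos hq u).ne'

/-- The Riccati equation of the calibrating field. -/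
lemma hasDerivAt_calib {q : ℝ} (hq : q ∈ Ico (0 : ℝ) 1) {u : ℝ} (hu : jacobiSn u q ≠ 0) :
    HasDerivAt (calib q) (-1 - calib q u ^ 2 * (1 - 2 * q ^ 2 * jacobiSn u q ^ 2)) u := by
  have hd := (jacobiDn_pos hq u).ne'
  have h := (hasDerivAt_jacobiCn hq u).fun_div
    ((hasDerivAt_jacobiSn hq u).fun_mul (hasDerivAt_jacobiDn hq u)) (mul_ne_zero hu hd)
  refine h.congr_deriv ?_
  have hsq := jacobiDn_sq hq u
  rw [calib]
  field_simp
  linear_combination (-jacobiCn u q ^ 2) * hsq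

end

section

variable {a b : ℝ} {c τ l v : ℝ → ℝ}

/-- The arclength along the half curve, scaled by `w`; the argument of the elliptic functions. -/
noncomputable def phase (a w : ℝ) (v : ℝ → ℝ) (x : ℝ) : ℝ := w * ∫ t in a..x, v t

/-- The difference of `1 - cos` of the tangent angles of the half curve and of the elastica. -/
noncomputable def gap (q a w : ℝ) (c v : ℝ → ℝ) (x : ℝ) : ℝ :=
  1 - c x - 2 * q ^ 2 * jacobiSn (phase a w v x) q ^ 2

lemma IsHalfFrame.phase_mem (h : IsHalfFrame a b c τ l v) {q w : ℝ} (hw : 0 < w)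
    (hK : phase a w v b = compK q) {x : ℝ} (hx : x ∈ Ioo a b) :
    phase a w v x ∈ Ioo 0 (compK q) := by
  have hx' := Ioo_subset_Icc_self hx
  have hb := right_mem_Icc.2 h.lt.le
  have h1 := h.integral_v_pos ⟨hx.1, hx.2.le⟩
  have h2 : 0 < ∫ t in x..b, v t :=
    intervalIntegral.intervalIntegral_pos_of_pos_on (h.intervalIntegrable_v hx' hb)
      (fun t ht => h.v_pos t ⟨hx.1.le.trans ht.1.le, ht.2.le⟩) hx.2
  have h3 := intervalIntegral.integral_add_adjacent_intervals
    (h.intervalIntegrable_v (left_mem_Icc.2 h.lt.le) hx') (h.intervalIntegrable_v hx' hb)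
  rw [← hK]
  refine ⟨mul_pos hw h1, mul_lt_mul_of_pos_left ?_ hw⟩
  linarith

lemma phase_self (a w : ℝ) (v : ℝ → ℝ) : phase a w v a = 0 := by simp [phase]

lemma IsHalfFrame.ac_phase (h : IsHalfFrame a b c τ l v) (w : ℝ) :
    AbsolutelyContinuousOnInterval (phase a w v) a b :=
  ((h.intervalIntegrable_v (left_mem_Icc.2 h.lt.le)
    (right_mem_Icc.2 h.lt.le)).absolutelyContinuousOnInterval_intervalIntegral
      left_mem_uIcc).const_mul w

lemma IsHalfFrame.continuousOn_phase (h : IsHalfFrame a b c τ l v) (w : ℝ) :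
    ContinuousOn (phase a w v) (Icc a b) := by
  have := (h.ac_phase w).continuousOn
  rwa [uIcc_of_le h.lt.le] at this

lemma IsHalfFrame.hasDerivAt_phase (h : IsHalfFrame a b c τ l v) (w : ℝ) {x : ℝ}
    (hx : x ∈ Ioo a b) : HasDerivAt (phase a w v) (w * v x) x := by
  have hnhds : Icc a b ∈ 𝓝 x := Icc_mem_nhds hx.1 hx.2
  refine HasDerivAt.const_mul w (intervalIntegral.integral_hasDerivAt_right
    (h.intervalIntegrable_v (left_mem_Icc.2 h.lt.le) (Ioo_subset_Icc_self hx)) ?_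
    (h.continuousOn_v.continuousAt hnhds))
  exact (h.continuousOn_v.mono Ioo_subset_Icc_self).stronglyMeasurableAtFilter isOpen_Ioo x hx

lemma IsHalfFrame.jacobiSn_phase_pos (h : IsHalfFrame a b c τ l v) {q w : ℝ}
    (hq : q ∈ Ico (0 : ℝ) 1) (hw : 0 < w) (hK : phase a w v b = compK q) {x : ℝ}
    (hx : x ∈ Ioc a b) : 0 < jacobiSn (phase a w v x) q := by
  rcases hx.2.eq_or_lt with rfl | hlt
  · rw [hK]; exact jacobiSn_pos hq ⟨compK_pos hq, le_rfl⟩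
  · exact jacobiSn_pos hq (Ioo_subset_Ioc_self (h.phase_mem hw hK ⟨hx.1, hlt⟩))

lemma IsHalfFrame.continuousOn_calib_phase (h : IsHalfFrame a b c τ l v) {q w : ℝ}
    (hq : q ∈ Ico (0 : ℝ) 1) (hw : 0 < w) (hK : phase a w v b = compK q) {x₀ : ℝ} (hx₀ : a < x₀) :
    ContinuousOn (fun x => calib q (phase a w v x)) (Icc x₀ b) :=
  (contDiffOn_calib hq).continuousOn.comp
    ((h.continuousOn_phase w).mono (Icc_subset_Icc_left hx₀.le))
    fun _ hx => (h.jacobiSn_phase_pos hq hw hK ⟨hx₀.trans_le hx.1, hx.2⟩).ne'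

lemma IsHalfFrame.continuousOn_gap (h : IsHalfFrame a b c τ l v) {q : ℝ} (hq : q ∈ Ico (0 : ℝ) 1)
    (w : ℝ) : ContinuousOn (gap q a w c v) (Icc a b) := by
  have h1 := h.ac_c.continuousOn
  rw [uIcc_of_le h.lt.le] at h1
  have h2 := (contDiff_jacobiSn hq).continuous.comp_continuousOn (h.continuousOn_phase w)
  exact (continuousOn_const.sub h1).sub (continuousOn_const.mul (h2.pow 2))

/-- The calibrated lower bound for the bending energy away from the starting point, with the
boundary term that the singularity of the field at the starting point leaves. -/
lemma IsHalfFrame.calibration_right (h : IsHalfFrame a b c τ l v) {q w : ℝ}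
    (hq : q ∈ Ico (0 : ℝ) 1) (hw : 0 < w) (hK : phase a w v b = compK q) {x₀ : ℝ}
    (hx₀ : x₀ ∈ Ioo a b) :
    (∫ x in x₀..b, (4 * w ^ 2 * q ^ 2 * jacobiCn (phase a w v x) q ^ 2 * v x +
        2 * w ^ 2 * gap q a w c v x * v x)) -
      2 * (w * calib q (phase a w v x₀) * gap q a w c v x₀) +
      (∫ x in x₀..b, w ^ 2 * calib q (phase a w v x) ^ 2 * gap q a w c v x ^ 2 * v x) ≤
    ∫ x in x₀..b, l x ^ 2 / v x := by
  set u := phase a w v with hu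
  set m := gap q a w c v with hm
  have hsub : Icc x₀ b ⊆ Icc a b := Icc_subset_Icc_left hx₀.1.le
  have husub : uIcc x₀ b ⊆ uIcc a b := by
    rw [uIcc_of_le hx₀.2.le, uIcc_of_le h.lt.le]; exact hsub
  have hb := right_mem_Icc.2 h.lt.le
  have hx₀' := Ioo_subset_Icc_self hx₀
  have hsn : ∀ x ∈ Icc x₀ b, 0 < jacobiSn (u x) q := fun x hx =>
    h.jacobiSn_phase_pos hq hw hK ⟨hx₀.1.trans_le hx.1, hx.2⟩
  have huc : ContinuousOn u (Icc x₀ b) := (h.continuousOn_phase w).mono hsub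
  have hmc : ContinuousOn m (Icc x₀ b) := (h.continuousOn_gap hq w).mono hsub
  have hvc : ContinuousOn v (Icc x₀ b) := h.continuousOn_v.mono hsub
  have hcalc : ContinuousOn (fun x => calib q (u x)) (Icc x₀ b) :=
    h.continuousOn_calib_phase hq hw hK hx₀.1
  have hcnc : ContinuousOn (fun x => jacobiCn (u x) q) (Icc x₀ b) :=
    (contDiff_jacobiCn hq).continuous.comp_continuousOn huc
  -- the calibrating potential
  have hΦac : AbsolutelyContinuousOnInterval (fun x => w * calib q (u x) * m x) x₀ b := by
    have hu_ac := (h.ac_phase w).mono husub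
    have h1 : AbsolutelyContinuousOnInterval (fun x => calib q (u x)) x₀ b :=
      hu_ac.comp_contDiffOn (contDiffOn_calib hq) fun x hx => by
        rw [uIcc_of_le hx₀.2.le] at hx; exact (hsn x hx).ne'
    have h2 : AbsolutelyContinuousOnInterval
        (fun x => 1 - 2 * q ^ 2 * jacobiSn (u x) q ^ 2) x₀ b := by
      refine hu_ac.comp_contDiffOn (s := univ)
        (φ := fun y => 1 - 2 * q ^ 2 * jacobiSn y q ^ 2) ?_ (mapsTo_univ _ _)
      exact (contDiff_const.sub (contDiff_const.mul
        ((contDiff_infty.1 (contDiff_jacobiSn hq) 1).pow 2))).contDiffOn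
    have h3 : AbsolutelyContinuousOnInterval m x₀ b := by
      refine (h2.fun_sub (h.ac_c.mono husub)).congr_uIcc fun x _ => ?_
      rw [hm, gap]; ring
    exact (h1.const_mul w).fun_mul h3
  have hder : ∀ᵐ x, x ∈ uIoc x₀ b → HasDerivAt (fun x => w * calib q (u x) * m x)
      (w * calib q (u x) * (τ x * l x) +
        (-(2 * w ^ 2 * q ^ 2 * jacobiCn (u x) q ^ 2 * v x * 2)
        + w ^ 2 * m x * v x * (-1 - calib q (u x) ^ 2 * (1 - 2 * q ^ 2 * jacobiSn (u x) q ^ 2))))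
      x := by
    filter_upwards [h.frenet, ae_mem_Ioo_of_mem_uIoc hx₀.2.le] with x hfr hmem hx
    have hxI := hmem hx
    have hxab : x ∈ Ioo a b := ⟨hx₀.1.trans hxI.1, hxI.2⟩
    have hs := hsn x (Ioo_subset_Icc_self hxI)
    have hd := jacobiDn_pos hq (u x)
    have hu' : HasDerivAt u (w * v x) x := h.hasDerivAt_phase w hxab
    have h1 := ((hasDerivAt_calib hq hs.ne').comp x hu').const_mul w
    have h2 := ((hasDerivAt_jacobiSn hq (u x)).comp x hu').fun_pow 2 |>.const_mul (2 * q ^ 2)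
    have h3 := ((hfr hxab).1.const_sub 1).fun_sub h2
    refine (h1.fun_mul h3).congr_deriv ?_
    have hcal : calib q (u x) * (jacobiSn (u x) q * jacobiDn (u x) q) = jacobiCn (u x) q := by
      rw [calib]; field_simp
    simp only [Function.comp, hm, gap, ← hu]
    linear_combination
      (-(4 * w ^ 2 * q ^ 2 * v x * jacobiCn (u x) q)) * hcal
  obtain ⟨hΦi, hΦ⟩ := hΦac.integral_eq_sub_of_ae_hasDerivAt hder
  have hend : calib q (u b) = 0 := by
    rw [hK, calib, jacobiCn_compK hq, zero_div]
  rw [hend] at hΦ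
  have hi1 : IntervalIntegrable (fun x => 4 * w ^ 2 * q ^ 2 * jacobiCn (u x) q ^ 2 * v x +
      2 * w ^ 2 * m x * v x) volume x₀ b := by
    refine ContinuousOn.intervalIntegrable ?_
    rw [uIcc_of_le hx₀.2.le]
    fun_prop
  have hi2 : IntervalIntegrable (fun x => w ^ 2 * calib q (u x) ^ 2 * m x ^ 2 * v x)
      volume x₀ b := by
    refine ContinuousOn.intervalIntegrable ?_
    rw [uIcc_of_le hx₀.2.le]
    fun_prop
  have hrw : -(2 * (w * calib q (u x₀) * m x₀)) = 2 * (w * 0 * m b - w * calib q (u x₀) * m x₀) := by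
    ring
  rw [sub_eq_add_neg, hrw, ← hΦ, ← intervalIntegral.integral_const_mul,
    ← intervalIntegral.integral_add hi1 (hΦi.const_mul 2),
    ← intervalIntegral.integral_add (hi1.add (hΦi.const_mul 2)) hi2]
  refine intervalIntegral.integral_mono_on hx₀.2.le ((hi1.add (hΦi.const_mul 2)).add hi2)
    (h.intervalIntegrable_energy hx₀' hb) fun x hx => ?_
  have hv := h.v_pos x (hsub hx)
  have hnorm := h.norm_eq x (hsub hx)
  have hs := hsn x hx
  have hd := jacobiDn_pos hq (u x)
  have hcal : calib q (u x) * (jacobiSn (u x) q * jacobiDn (u x) q) = jacobiCn (u x) q := by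
    rw [calib]; field_simp
  have hdn := jacobiDn_sq hq (u x)
  -- the excess of the bending integrand is a perfect square
  have hsq : 0 ≤ (l x - w * calib q (u x) * v x * τ x) ^ 2 / v x := by positivity
  have hexp : (l x - w * calib q (u x) * v x * τ x) ^ 2 / v x =
      l x ^ 2 / v x - 2 * w * calib q (u x) * (τ x * l x) +
        w ^ 2 * calib q (u x) ^ 2 * v x * τ x ^ 2 := by
    field_simp
    ring
  have hcal2 : calib q (u x) ^ 2 * (jacobiSn (u x) q ^ 2 * (1 - q ^ 2 * jacobiSn (u x) q ^ 2)) =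
      jacobiCn (u x) q ^ 2 := by rw [← hcal, ← hdn]; ring
  have hτ : τ x ^ 2 = (m x + 2 * q ^ 2 * jacobiSn (u x) q ^ 2) *
      (2 - (m x + 2 * q ^ 2 * jacobiSn (u x) q ^ 2)) := by
    simp only [hm, gap, ← hu]
    linear_combination hnorm
  rw [hexp, hτ] at hsq
  refine le_of_sub_nonneg (hsq.trans_eq ?_)
  linear_combination (4 * q ^ 2 * w ^ 2 * v x) * hcal2

/-- The boundary term of the calibration vanishes at the starting point. -/
lemma IsHalfFrame.tendsto_calib_mul_gap (h : IsHalfFrame a b c τ l v) {q w : ℝ}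
    (hq : q ∈ Ico (0 : ℝ) 1) (hw : 0 < w) (hK : phase a w v b = compK q) :
    Tendsto (fun x => w * calib q (phase a w v x) * gap q a w c v x) (𝓝[>] a) (𝓝 0) := by
  set u := phase a w v with hu
  have ha := left_mem_Icc.2 h.lt.le
  have hmem : ∀ᶠ x in 𝓝[>] a, x ∈ Ioo a b := Ioo_mem_nhdsGT h.lt
  have hle : 𝓝[>] a ≤ 𝓝[Icc a b] a := by
    rw [← nhdsWithin_Ioo_eq_nhdsGT h.lt]
    exact nhdsWithin_mono _ Ioo_subset_Icc_self
  have hu0 : Tendsto u (𝓝[>] a) (𝓝 0) := by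
    have := ((h.continuousOn_phase w) a ha).mono_left hle
    rwa [phase_self] at this
  have hu0' : Tendsto u (𝓝[>] a) (𝓝[≠] 0) := by
    refine tendsto_nhdsWithin_iff.2 ⟨hu0, hmem.mono fun x hx => ?_⟩
    exact (h.phase_mem hw hK hx).1.ne'
  have hquot : Tendsto (fun x => jacobiSn (u x) q / u x) (𝓝[>] a) (𝓝 1) := by
    have h1 := (hasDerivAt_jacobiSn hq 0).tendsto_slope_zero
    have h2 : jacobiCn 0 q * jacobiDn 0 q = 1 := by
      simp [jacobiCn, jacobiDn, jacobiAm_zero hq, jacobiSn_zero hq]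
    rw [h2] at h1
    refine (h1.comp hu0').congr fun x => ?_
    simp [jacobiSn_zero hq, div_eq_inv_mul]
  have hcn : Tendsto (fun x => jacobiCn (u x) q) (𝓝[>] a) (𝓝 1) := by
    have := ((contDiff_jacobiCn hq).continuous.tendsto 0).comp hu0
    simpa [Function.comp_def, jacobiCn, jacobiAm_zero hq] using this
  have hsn : Tendsto (fun x => jacobiSn (u x) q) (𝓝[>] a) (𝓝 0) := by
    have := ((contDiff_jacobiSn hq).continuous.tendsto 0).comp hu0
    rwa [jacobiSn_zero hq] at this
  have hdn : Tendsto (fun x => jacobiDn (u x) q) (𝓝[>] a) (𝓝 1) := by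
    have := ((contDiff_jacobiDn hq).continuous.tendsto 0).comp hu0
    simpa [Function.comp_def, jacobiDn, jacobiSn_zero hq] using this
  have he : Tendsto (fun x => ∫ t in a..x, l t ^ 2 / v t) (𝓝[>] a) (𝓝 0) := by
    have hint : IntegrableOn (fun x => l x ^ 2 / v x) (uIcc a b) := by
      rw [uIcc_of_le h.lt.le]; exact h.integrableOn_energy
    have h1 := (intervalIntegral.continuousOn_primitive_interval hint) a left_mem_uIcc
    rw [ContinuousWithinAt, uIcc_of_le h.lt.le, intervalIntegral.integral_same] at h1
    exact h1.mono_left hle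
  have hn : Tendsto (fun x => (1 - c x) / u x) (𝓝[>] a) (𝓝 0) := by
    have hub : Tendsto (fun x => 2 / w * ∫ t in a..x, l t ^ 2 / v t) (𝓝[>] a) (𝓝 0) := by
      simpa using he.const_mul (2 / w)
    refine tendsto_of_tendsto_of_tendsto_of_le_of_le' tendsto_const_nhds hub
      (hmem.mono fun x hx => ?_) (hmem.mono fun x hx => ?_)
    · have h1 := (abs_le.1 (h.abs_c_le (Ioo_subset_Icc_self hx))).2
      exact div_nonneg (by linarith) (h.phase_mem hw hK hx).1.le
    · have h1 := h.one_sub_c_le (Ioo_subset_Ioc_self hx)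
      have hupos := (h.phase_mem hw hK hx).1
      rw [div_le_iff₀ hupos]
      refine h1.trans_eq ?_
      rw [phase]
      field_simp
  have hlim : Tendsto (fun x => w * (((1 - c x) / u x) / (jacobiSn (u x) q / u x) *
      (jacobiCn (u x) q / jacobiDn (u x) q) -
      2 * q ^ 2 * jacobiSn (u x) q * (jacobiCn (u x) q / jacobiDn (u x) q))) (𝓝[>] a) (𝓝 0) := by
    have h1 := hcn.div hdn one_ne_zero
    have h2 := ((hn.div hquot one_ne_zero).mul h1).sub ((hsn.const_mul (2 * q ^ 2)).mul h1)
    simpa using h2.const_mul w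
  refine hlim.congr' (hmem.mono fun x hx => ?_)
  have hupos := (h.phase_mem hw hK hx)
  have hs := jacobiSn_pos hq (Ioo_subset_Ioc_self hupos)
  have hd := jacobiDn_pos hq (u x)
  have hupos' : 0 < u x := hupos.1
  simp only [calib, gap, ← hu]
  field_simp

/-- The calibration inequality: among half curves of given length, the elastica of modulus `q`
minimizes the bending energy penalized by the Lagrange multiplier `2w²` of the horizontal span. The
integral of the squared gap measures the deviation from the elastica. -/
lemma IsHalfFrame.calibration (h : IsHalfFrame a b c τ l v) {q w : ℝ}
    (hq : q ∈ Ico (0 : ℝ) 1) (hw : 0 < w) (hK : phase a w v b = compK q) {x₁ : ℝ}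
    (hx₁ : x₁ ∈ Ioo a b) :
    4 * w * ((q ^ 2 - 2) * compK q + 2 * compE q) + 2 * w ^ 2 * (∫ x in a..b, (1 - c x) * v x) +
      (∫ x in x₁..b, w ^ 2 * calib q (phase a w v x) ^ 2 * gap q a w c v x ^ 2 * v x) ≤
    ∫ x in a..b, l x ^ 2 / v x := by
  set u := phase a w v with hu
  set m := gap q a w c v with hm
  set δ := ∫ x in x₁..b, w ^ 2 * calib q (u x) ^ 2 * m x ^ 2 * v x with hδ
  have ha := left_mem_Icc.2 h.lt.le
  have hb := right_mem_Icc.2 h.lt.le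
  have hmem : ∀ᶠ x in 𝓝[>] a, x ∈ Ioo a x₁ := Ioo_mem_nhdsGT hx₁.1
  have hle : 𝓝[>] a ≤ 𝓝[Icc a b] a := by
    rw [← nhdsWithin_Ioo_eq_nhdsGT h.lt]
    exact nhdsWithin_mono _ Ioo_subset_Icc_self
  have huc : ContinuousOn u (Icc a b) := h.continuousOn_phase w
  have hmc : ContinuousOn m (Icc a b) := h.continuousOn_gap hq w
  have hvc : ContinuousOn v (Icc a b) := h.continuousOn_v
  have hcc : ContinuousOn c (Icc a b) := by
    have := h.ac_c.continuousOn
    rwa [uIcc_of_le h.lt.le] at this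
  have hcnc : ContinuousOn (fun x => jacobiCn (u x) q) (Icc a b) :=
    (contDiff_jacobiCn hq).continuous.comp_continuousOn huc
  have hfc : ContinuousOn (fun x => 4 * w ^ 2 * q ^ 2 * jacobiCn (u x) q ^ 2 * v x +
      2 * w ^ 2 * m x * v x) (Icc a b) := by fun_prop
  have hleft : ∀ {f : ℝ → ℝ}, IntegrableOn f (Icc a b) →
      Tendsto (fun x => ∫ t in x..b, f t) (𝓝[>] a) (𝓝 (∫ t in a..b, f t)) := by
    intro f hf
    rw [← uIcc_of_le h.lt.le] at hf
    have h1 := intervalIntegral.continuousOn_primitive_interval_left hf a left_mem_uIcc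
    rw [ContinuousWithinAt, uIcc_of_le h.lt.le] at h1
    exact h1.mono_left hle
  have hlim := (((hleft hfc.integrableOn_Icc).sub
    ((h.tendsto_calib_mul_gap hq hw hK).const_mul 2)).add_const δ)
  have hineq := le_of_tendsto_of_tendsto hlim (hleft h.integrableOn_energy)
    (hmem.mono fun x₀ hx₀ => ?_)
  · -- evaluation of the integrals along the elastica
    have hder : ∀ x ∈ Ioo a b, HasDerivAt
        (fun x => 4 * w * ((q ^ 2 - 2) * u x + 2 * ellE (jacobiAm (u x) q) q))
        (4 * w ^ 2 * (q ^ 2 - 2 + 2 * jacobiDn (u x) q ^ 2) * v x) x := by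
      intro x hx
      have hu' : HasDerivAt u (w * v x) x := h.hasDerivAt_phase w hx
      have h1 := (hasDerivAt_ellE_jacobiAm hq (u x)).comp x hu'
      refine (((hu'.const_mul (q ^ 2 - 2)).fun_add (h1.const_mul 2)).const_mul
        (4 * w)).congr_deriv ?_
      ring
    have hdnc : ContinuousOn (fun x => jacobiDn (u x) q) (Icc a b) :=
      (contDiff_jacobiDn hq).continuous.comp_continuousOn huc
    have hEc : ContinuousOn (fun x => ellE (jacobiAm (u x) q) q) (Icc a b) :=
      (contDiff_ellE_jacobiAm hq).continuous.comp_continuousOn huc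
    have hi1 : IntervalIntegrable
        (fun x => 4 * w ^ 2 * (q ^ 2 - 2 + 2 * jacobiDn (u x) q ^ 2) * v x) volume a b := by
      refine ContinuousOn.intervalIntegrable ?_
      rw [uIcc_of_le h.lt.le]
      fun_prop
    have hi2 : IntervalIntegrable (fun x => (1 - c x) * v x) volume a b := by
      refine ContinuousOn.intervalIntegrable ?_
      rw [uIcc_of_le h.lt.le]
      fun_prop
    have hev := intervalIntegral.integral_eq_sub_of_hasDerivAt_of_le h.lt.le
      (f := fun x => 4 * w * ((q ^ 2 - 2) * u x + 2 * ellE (jacobiAm (u x) q) q))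
      (by fun_prop) hder hi1
    have hua : u a = 0 := phase_self a w v
    rw [hK, hua, jacobiAm_compK hq, jacobiAm_zero hq, ellE_zero,
      show ellE (Real.pi / 2) q = compE q from rfl] at hev
    have hsplit : (∫ x in a..b, (4 * w ^ 2 * q ^ 2 * jacobiCn (u x) q ^ 2 * v x +
        2 * w ^ 2 * m x * v x)) =
        (∫ x in a..b, 4 * w ^ 2 * (q ^ 2 - 2 + 2 * jacobiDn (u x) q ^ 2) * v x) +
          2 * w ^ 2 * ∫ x in a..b, (1 - c x) * v x := by
      rw [← intervalIntegral.integral_const_mul,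
        ← intervalIntegral.integral_add hi1 (hi2.const_mul _)]
      refine intervalIntegral.integral_congr fun x _ => ?_
      have hsc := jacobiSn_sq_add (u x) q
      have hdn := jacobiDn_sq hq (u x)
      simp only [hm, gap, ← hu]
      linear_combination (4 * w ^ 2 * q ^ 2 * v x) * hsc - (8 * w ^ 2 * v x) * hdn
    rw [hsplit, hev] at hineq
    linarith
  · -- the deviation on `[x₁,b]` is at most that on `[x₀,b]`
    have hx₀b : x₀ ∈ Ioo a b := ⟨hx₀.1, hx₀.2.trans hx₁.2⟩
    have hmain := h.calibration_right hq hw hK hx₀b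
    have hcalc : ContinuousOn (fun x => calib q (u x)) (Icc x₀ b) :=
      h.continuousOn_calib_phase hq hw hK hx₀.1
    have hgc : ContinuousOn (fun x => w ^ 2 * calib q (u x) ^ 2 * m x ^ 2 * v x) (Icc x₀ b) := by
      have h1 := hmc.mono (Icc_subset_Icc_left hx₀.1.le)
      have h2 := hvc.mono (Icc_subset_Icc_left hx₀.1.le)
      fun_prop
    have hadj := intervalIntegral.integral_add_adjacent_intervals
      ((hgc.mono (uIcc_subset_Icc (left_mem_Icc.2 hx₀b.2.le)
        ⟨hx₀.2.le, hx₁.2.le⟩)).intervalIntegrable (μ := volume))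
      ((hgc.mono (uIcc_subset_Icc ⟨hx₀.2.le, hx₁.2.le⟩
        (right_mem_Icc.2 hx₀b.2.le))).intervalIntegrable (μ := volume))
    have hpos : 0 ≤ ∫ x in x₀..x₁, w ^ 2 * calib q (u x) ^ 2 * m x ^ 2 * v x := by
      refine intervalIntegral.integral_nonneg hx₀.2.le fun x hx => ?_
      have := (h.v_pos x ⟨hx₀.1.le.trans hx.1, hx.2.trans hx₁.2.le⟩).le
      positivity
    rw [← hu, ← hm] at hmain
    simp only
    linarith

/-- The equality case of the calibration inequality. -/
lemma IsHalfFrame.eq_of_calibration_eq (h : IsHalfFrame a b c τ l v) {q w : ℝ}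
    (hq : q ∈ Ico (0 : ℝ) 1) (hw : 0 < w) (hK : phase a w v b = compK q)
    (heq : ∫ x in a..b, l x ^ 2 / v x ≤ 4 * w * ((q ^ 2 - 2) * compK q + 2 * compE q) +
      2 * w ^ 2 * (∫ x in a..b, (1 - c x) * v x)) :
    ∀ x ∈ Icc a b, c x = 2 * jacobiDn (phase a w v x) q ^ 2 - 1 := by
  have hgap : EqOn (gap q a w c v) 0 (Icc a b) := by
    have hIoo : EqOn (gap q a w c v) 0 (Ioo a b) := by
      intro x hx
      by_contra hne
      obtain ⟨x₁, hx₁⟩ := exists_between hx.1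
      have hx₁b : x₁ ∈ Ioo a b := ⟨hx₁.1, hx₁.2.trans hx.2⟩
      have hcal := h.calibration hq hw hK hx₁b
      have hsub : Icc x₁ b ⊆ Icc a b := Icc_subset_Icc_left hx₁.1.le
      have hpos : 0 < ∫ x in x₁..b,
          w ^ 2 * calib q (phase a w v x) ^ 2 * gap q a w c v x ^ 2 * v x := by
        have hcalc := h.continuousOn_calib_phase hq hw hK hx₁.1
        have h1 := (h.continuousOn_gap hq w).mono hsub
        have h2 := h.continuousOn_v.mono hsub
        refine intervalIntegral.integral_pos hx₁b.2 (by fun_prop) (fun y hy => ?_)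
          ⟨x, ⟨hx₁.2.le, hx.2.le⟩, ?_⟩
        · have := (h.v_pos y (hsub (Ioc_subset_Icc_self hy))).le
          positivity
        · have hv := h.v_pos x (Ioo_subset_Icc_self hx)
          have hu := h.phase_mem hw hK hx
          have hs := jacobiSn_pos hq (Ioo_subset_Ioc_self hu)
          have hd := jacobiDn_pos hq (phase a w v x)
          have hc := jacobiCn_pos hq ⟨by linarith [hu.1, compK_pos hq], hu.2⟩
          have hcal : 0 < calib q (phase a w v x) := div_pos hc (mul_pos hs hd)
          have hne' : gap q a w c v x ≠ 0 := hne
          positivity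
      linarith
    refine hIoo.of_subset_closure (h.continuousOn_gap hq w) continuousOn_const
      Ioo_subset_Icc_self ?_
    rw [closure_Ioo h.lt.ne]
  intro x hx
  have h1 : gap q a w c v x = 0 := hgap hx
  rw [gap] at h1
  have h2 := jacobiDn_sq hq (phase a w v x)
  linarith

end

/-! ### Symmetric admissible curves -/

section

variable {γ : ℝ → Plane}

lemma MemW22Imm.hasDerivWithinAt (h : MemW22Imm γ) {x : ℝ} (hx : x ∈ Icc (0 : ℝ) 1) :
    HasDerivWithinAt γ (velocity γ x) (Icc 0 1) x := h.1.velocity_regular.2.2 x hx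

lemma MemW22Imm.intervalIntegrable_norm_velocity (h : MemW22Imm γ) {x y : ℝ}
    (hx : x ∈ Icc (0 : ℝ) 1) (hy : y ∈ Icc (0 : ℝ) 1) :
    IntervalIntegrable (fun t => ‖velocity γ t‖) volume x y :=
  (h.continuousOn_norm_velocity.mono (uIcc_subset_Icc hx hy)).intervalIntegrable

lemma MemW22Imm.hasDerivWithinAt_arclength (h : MemW22Imm γ) {x : ℝ} (hx : x ∈ Icc (0 : ℝ) 1) :
    HasDerivWithinAt (arclength γ) ‖velocity γ x‖ (Icc 0 1) x := by
  have : Fact (x ∈ Icc (0 : ℝ) 1) := ⟨hx⟩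
  refine intervalIntegral.integral_hasDerivWithinAt_right
    (h.intervalIntegrable_norm_velocity (left_mem_Icc.2 zero_le_one) hx) ?_
    (h.continuousOn_norm_velocity x hx)
  exact h.continuousOn_norm_velocity.stronglyMeasurableAtFilter_nhdsWithin measurableSet_Icc x

lemma MemW22Imm.length_pos (h : MemW22Imm γ) : 0 < length γ :=
  intervalIntegral.intervalIntegral_pos_of_pos_on
    (h.intervalIntegrable_norm_velocity (left_mem_Icc.2 zero_le_one) (right_mem_Icc.2 zero_le_one))
    (fun _ ht => h.norm_velocity_pos (Ioo_subset_Icc_self ht)) one_pos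

lemma MemW22Imm.norm_sub_le (h : MemW22Imm γ) {x y : ℝ} (hx : x ∈ Icc (0 : ℝ) 1)
    (hy : y ∈ Icc (0 : ℝ) 1) (hxy : x ≤ y) :
    ‖γ y - γ x‖ ≤ ∫ t in x..y, ‖velocity γ t‖ := by
  have hsub : Icc x y ⊆ Icc 0 1 := Icc_subset_Icc hx.1 hy.2
  have hc : ContinuousOn (velocity γ) (Icc 0 1) := by
    have h2 : ContinuousOn (fun x => (!₂[velocity γ x 0, velocity γ x 1] : Plane)) (Icc 0 1) := by
      refine (PiLp.continuous_toLp 2 _).comp_continuousOn (continuousOn_pi.2 fun i => ?_)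
      fin_cases i
      · exact h.continuousOn_velocity_apply 0
      · exact h.continuousOn_velocity_apply 1
    refine h2.congr fun x _ => ?_
    ext i; fin_cases i <;> rfl
  have hint := intervalIntegral.integral_eq_sub_of_hasDerivAt_of_le hxy
    (f := γ) (f' := velocity γ) (fun t ht => ((h.hasDerivWithinAt (hsub ht)).continuousWithinAt).mono
      hsub) (fun t ht => ?_) ?_
  · rw [← hint]
    exact intervalIntegral.norm_integral_le_integral_norm hxy
  · exact (h.hasDerivWithinAt (hsub (Ioo_subset_Icc_self ht))).hasDerivAt
      (Icc_mem_nhds (hx.1.trans_lt ht.1) (ht.2.trans_le hy.2))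
  · exact (hc.mono (uIcc_subset_Icc hx hy)).intervalIntegrable

/-- A symmetric curve from `(0,0)` to `(1,0)` of class `W^{2,2}`, i.e. an element of `A_sym` without
the obstacle constraint; that it starts at `(0,0)` follows from the symmetry. -/
structure IsSymCurve (γ : ℝ → Plane) : Prop where
  imm : MemW22Imm γ
  end_eq : γ 1 = !₂[1, 0]
  symm : ∀ x ∈ Icc (0 : ℝ) 1, γ (1 - x) = !₂[1 - γ x 0, γ x 1]

lemma isSymCurve_of_mem_admissibleSym {ψ : ℝ → ℝ} (h : γ ∈ admissibleSym ψ) : IsSymCurve γ :=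
  ⟨h.1.1, h.1.2.2.1, h.2⟩

lemma one_sub_mem_Icc {x : ℝ} (hx : x ∈ Icc (0 : ℝ) 1) : 1 - x ∈ Icc (0 : ℝ) 1 :=
  ⟨sub_nonneg.2 hx.2, sub_le_self _ hx.1⟩

lemma IsSymCurve.velocity_one_sub (h : IsSymCurve γ) {x : ℝ} (hx : x ∈ Icc (0 : ℝ) 1) :
    velocity γ (1 - x) 0 = velocity γ x 0 ∧ velocity γ (1 - x) 1 = -velocity γ x 1 := by
  have hu := uniqueDiffOn_Icc (zero_lt_one' ℝ) x hx
  have hlin : HasDerivWithinAt (fun y : ℝ => 1 - y) (-1) (Icc 0 1) x := by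
    simpa using (hasDerivWithinAt_id x (Icc (0 : ℝ) 1)).const_sub 1
  have h1 := (h.imm.hasDerivWithinAt (one_sub_mem_Icc hx)).scomp x hlin
    fun y hy => one_sub_mem_Icc hy
  have h2 := hasDerivWithinAt_plane.1 h1
  have h3 := hasDerivWithinAt_plane.1 (h.imm.hasDerivWithinAt hx)
  constructor
  · have h4 : HasDerivWithinAt (fun y => (γ ∘ fun y => 1 - y) y 0) (-velocity γ x 0)
        (Icc 0 1) x := by
      refine ((h3 0).const_sub 1).congr (fun y hy => ?_) ?_
      · simp [h.symm y hy]
      · simp [h.symm x hx]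
    have := hu.eq_deriv _ (h2 0) h4
    simpa using this
  · have h4 : HasDerivWithinAt (fun y => (γ ∘ fun y => 1 - y) y 1) (velocity γ x 1)
        (Icc 0 1) x := by
      refine (h3 1).congr (fun y hy => ?_) ?_
      · simp [h.symm y hy]
      · simp [h.symm x hx]
    have := hu.eq_deriv _ (h2 1) h4
    simp only [PiLp.smul_apply, smul_eq_mul] at this
    linarith

lemma IsSymCurve.norm_velocity_one_sub (h : IsSymCurve γ) {x : ℝ} (hx : x ∈ Icc (0 : ℝ) 1) :
    ‖velocity γ (1 - x)‖ = ‖velocity γ x‖ := by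
  rw [plane_norm, plane_norm, (h.velocity_one_sub hx).1, (h.velocity_one_sub hx).2, neg_sq]

lemma IsSymCurve.turning_one_sub (h : IsSymCurve γ) {x : ℝ} (hx : x ∈ Ioo (0 : ℝ) 1) :
    turning γ (1 - x) = turning γ x := by
  have hx' := Ioo_subset_Icc_self hx
  have hnhds : ∀ᶠ y in 𝓝 x, y ∈ Icc (0 : ℝ) 1 := Icc_mem_nhds hx.1 hx.2
  have d0 : deriv (fun y => velocity γ y 0) (1 - x) = -deriv (fun y => velocity γ y 0) x := by
    have h1 : (fun y => velocity γ (1 - y) 0) =ᶠ[𝓝 x] fun y => velocity γ y 0 :=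
      hnhds.mono fun y hy => (h.velocity_one_sub hy).1
    rw [← h1.deriv_eq, deriv_comp_const_sub (fun y => velocity γ y 0), neg_neg]
  have d1 : deriv (fun y => velocity γ y 1) (1 - x) = deriv (fun y => velocity γ y 1) x := by
    have h1 : (fun y => velocity γ (1 - y) 1) =ᶠ[𝓝 x] fun y => -velocity γ y 1 :=
      hnhds.mono fun y hy => (h.velocity_one_sub hy).2
    have h2 := h1.deriv_eq
    rw [deriv_comp_const_sub (fun y => velocity γ y 1), deriv.fun_neg] at h2
    linarith
  rw [turning, turning, h.norm_velocity_one_sub hx', d0, d1, (h.velocity_one_sub hx').1,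
    (h.velocity_one_sub hx').2]
  ring

lemma half_mem : (1 / 2 : ℝ) ∈ Icc (0 : ℝ) 1 := by constructor <;> norm_num

lemma IsSymCurve.integral_velocity_right (h : IsSymCurve γ) {x : ℝ} (hx : x ∈ Icc (0 : ℝ) 1) :
    ∫ t in (1 - x)..1, ‖velocity γ t‖ = arclength γ x := by
  have h1 := intervalIntegral.integral_comp_sub_left (a := 0) (b := x)
    (fun t => ‖velocity γ t‖) 1
  rw [sub_zero] at h1
  rw [← h1, arclength]
  refine intervalIntegral.integral_congr fun t ht => ?_
  rw [uIcc_of_le hx.1] at ht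
  exact h.norm_velocity_one_sub ⟨ht.1, ht.2.trans hx.2⟩

lemma IsSymCurve.arclength_one_sub (h : IsSymCurve γ) {x : ℝ} (hx : x ∈ Icc (0 : ℝ) 1) :
    arclength γ (1 - x) = length γ - arclength γ x := by
  have h1 := intervalIntegral.integral_add_adjacent_intervals
    (h.imm.intervalIntegrable_norm_velocity (left_mem_Icc.2 zero_le_one) (one_sub_mem_Icc hx))
    (h.imm.intervalIntegrable_norm_velocity (one_sub_mem_Icc hx) (right_mem_Icc.2 zero_le_one))
  rw [h.integral_velocity_right hx] at h1
  rw [length, arclength, arclength, ← h1, arclength]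
  ring

lemma IsSymCurve.arclength_half (h : IsSymCurve γ) : arclength γ (1 / 2) = length γ / 2 := by
  have := h.arclength_one_sub half_mem
  rw [show (1 : ℝ) - 1 / 2 = 1 / 2 by norm_num] at this
  linarith

lemma IsSymCurve.integral_norm_velocity_half (h : IsSymCurve γ) :
    ∫ t in (1 / 2 : ℝ)..1, ‖velocity γ t‖ = length γ / 2 := by
  have := h.integral_velocity_right half_mem
  rw [show (1 : ℝ) - 1 / 2 = 1 / 2 by norm_num] at this
  rw [this, h.arclength_half]

lemma IsSymCurve.bending_eq (h : IsSymCurve γ) :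
    bending γ = 2 * ∫ x in (1 / 2 : ℝ)..1, turning γ x ^ 2 / ‖velocity γ x‖ := by
  have hint : ∀ {x y : ℝ}, x ∈ Icc (0 : ℝ) 1 → y ∈ Icc (0 : ℝ) 1 →
      IntervalIntegrable (fun x => turning γ x ^ 2 / ‖velocity γ x‖) volume x y := fun hx hy =>
    (h.imm.integrableOn_turning_sq_div.mono_set (uIcc_subset_Icc hx hy)).intervalIntegrable
  have h1 := intervalIntegral.integral_comp_sub_left (a := 1 / 2) (b := 1)
    (fun x => turning γ x ^ 2 / ‖velocity γ x‖) 1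
  rw [sub_self, show (1 : ℝ) - 1 / 2 = 1 / 2 by norm_num] at h1
  rw [h.imm.bending_eq, ← intervalIntegral.integral_add_adjacent_intervals
    (hint (left_mem_Icc.2 zero_le_one) half_mem) (hint half_mem (right_mem_Icc.2 zero_le_one)),
    ← h1, two_mul]
  congr 1
  refine intervalIntegral.integral_congr_ae ?_
  filter_upwards [ae_mem_Ioo_of_mem_uIoc (show (1 / 2 : ℝ) ≤ 1 by norm_num)] with x hx hm
  have hx' : x ∈ Ioo (0 : ℝ) 1 := ⟨lt_trans (by norm_num) (hx hm).1, (hx hm).2⟩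
  rw [h.turning_one_sub hx', h.norm_velocity_one_sub (Ioo_subset_Icc_self hx')]

lemma IsSymCurve.tangent_half (h : IsSymCurve γ) :
    arcDeriv γ γ (1 / 2) 0 ^ 2 = 1 ∧ arcDeriv γ γ (1 / 2) 1 = 0 := by
  have h1 := (h.velocity_one_sub half_mem).2
  rw [show (1 : ℝ) - 1 / 2 = 1 / 2 by norm_num] at h1
  have h2 : velocity γ (1 / 2) 1 = 0 := by linarith
  have h3 : arcDeriv γ γ (1 / 2) 1 = 0 := by rw [arcDeriv_self_apply, h2, mul_zero]
  have h4 := h.imm.tangent_sq_add half_mem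
  rw [h3] at h4
  exact ⟨by linarith, h3⟩

lemma half_one_subset : Icc (1 / 2 : ℝ) 1 ⊆ Icc 0 1 := Icc_subset_Icc_left (by norm_num)

/-- The right half of a symmetric curve starts horizontally. If it starts to the left, its tangent
is replaced by the opposite one. -/
lemma IsSymCurve.isHalfFrame (h : IsSymCurve γ) :
    IsHalfFrame (1 / 2) 1 (fun x => arcDeriv γ γ (1 / 2) 0 * arcDeriv γ γ x 0)
      (fun x => arcDeriv γ γ (1 / 2) 0 * arcDeriv γ γ x 1) (turning γ)
      (fun x => ‖velocity γ x‖) where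
  lt := by norm_num
  ac_c := ((h.imm.tangent_absolutelyContinuous 0).mono (by
    rw [uIcc_of_le (by norm_num), uIcc_of_le (by norm_num)]; exact half_one_subset)).const_mul _
  ac_τ := ((h.imm.tangent_absolutelyContinuous 1).mono (by
    rw [uIcc_of_le (by norm_num), uIcc_of_le (by norm_num)]; exact half_one_subset)).const_mul _
  frenet := by
    filter_upwards [h.imm.ae_hasDerivAt_tangent] with x hx hm
    obtain ⟨h0, h1⟩ := hx ⟨lt_trans (by norm_num) hm.1, hm.2⟩
    exact ⟨(h0.const_mul _).congr_deriv (by ring), (h1.const_mul _).congr_deriv (by ring)⟩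
  norm_eq x hx := by
    have h1 := h.imm.tangent_sq_add (half_one_subset hx)
    have h2 := h.tangent_half.1
    rw [mul_pow, mul_pow, h2]
    linarith
  start_eq := by rw [← pow_two]; exact h.tangent_half.1
  continuousOn_v := h.imm.continuousOn_norm_velocity.mono half_one_subset
  v_pos x hx := h.imm.norm_velocity_pos (half_one_subset hx)
  integrableOn_l := by
    have h1 : IntegrableOn (turning γ) (Ioo 0 1) := h.imm.memLp_turning.integrable (by norm_num)
    rw [← integrableOn_Icc_iff_integrableOn_Ioo] at h1
    exact h1.mono_set half_one_subset
  integrableOn_energy := h.imm.integrableOn_turning_sq_div.mono_set half_one_subset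

lemma IsSymCurve.integral_one_sub_c (h : IsSymCurve γ) :
    ∫ x in (1 / 2 : ℝ)..1, (1 - arcDeriv γ γ (1 / 2) 0 * arcDeriv γ γ x 0) * ‖velocity γ x‖ =
      (length γ - arcDeriv γ γ (1 / 2) 0) / 2 := by
  have h1mem := right_mem_Icc.2 (zero_le_one' ℝ)
  have hi : IntervalIntegrable (fun x => velocity γ x 0) volume (1 / 2) 1 :=
    ((h.imm.continuousOn_velocity_apply 0).mono
      (uIcc_subset_Icc half_mem h1mem)).intervalIntegrable
  have hγ : ∫ x in (1 / 2 : ℝ)..1, velocity γ x 0 = 1 / 2 := by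
    have hd := fun x (hx : x ∈ Icc (0 : ℝ) 1) =>
      (hasDerivWithinAt_plane.1 (h.imm.hasDerivWithinAt hx)) 0
    rw [intervalIntegral.integral_eq_sub_of_hasDerivAt_of_le (f := fun x => γ x 0) (by norm_num)
      (fun x hx => ((hd x (half_one_subset hx)).continuousWithinAt).mono half_one_subset)
      (fun x hx => (hd x (half_one_subset (Ioo_subset_Icc_self hx))).hasDerivAt
        (Icc_mem_nhds (lt_trans (by norm_num) hx.1) hx.2)) hi]
    have h2 := congrArg (fun p : Plane => p 0) (h.symm (1 / 2) half_mem)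
    rw [show (1 : ℝ) - 1 / 2 = 1 / 2 by norm_num] at h2
    simp only [Matrix.cons_val_zero] at h2
    rw [h.end_eq]
    simp only [Matrix.cons_val_zero]
    linarith
  have hcongr : ∫ x in (1 / 2 : ℝ)..1,
      (1 - arcDeriv γ γ (1 / 2) 0 * arcDeriv γ γ x 0) * ‖velocity γ x‖ =
      ∫ x in (1 / 2 : ℝ)..1, (‖velocity γ x‖ - arcDeriv γ γ (1 / 2) 0 * velocity γ x 0) := by
    refine intervalIntegral.integral_congr fun x hx => ?_
    rw [uIcc_of_le (by norm_num)] at hx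
    simp only
    rw [h.imm.velocity_eq (half_one_subset hx)]
    ring
  rw [hcongr, intervalIntegral.integral_sub
    (h.imm.intervalIntegrable_norm_velocity half_mem h1mem) (hi.const_mul _),
    intervalIntegral.integral_const_mul, hγ, h.integral_norm_velocity_half]
  ring

end

/-! ### Comparison with the longer arc -/

section

variable {γ : ℝ → Plane} {q lam : ℝ}

lemma IsSymCurve.phase_eq (h : IsSymCurve γ) (w : ℝ) {x : ℝ} (hx : x ∈ Icc (1 / 2 : ℝ) 1) :
    phase (1 / 2) w (fun x => ‖velocity γ x‖) x = w * (arclength γ x - length γ / 2) := by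
  have h1 := intervalIntegral.integral_add_adjacent_intervals
    (h.imm.intervalIntegrable_norm_velocity (left_mem_Icc.2 zero_le_one) half_mem)
    (h.imm.intervalIntegrable_norm_velocity half_mem (half_one_subset hx))
  rw [phase, ← h.arclength_half, arclength, arclength, ← h1]
  ring

lemma IsSymCurve.phase_one (h : IsSymCurve γ) (q : ℝ) :
    phase (1 / 2) (2 * compK q / length γ) (fun x => ‖velocity γ x‖) 1 = compK q := by
  have hL := h.imm.length_pos
  rw [phase, h.integral_norm_velocity_half]
  field_simp

/-- The lower bound for the energy of a symmetric curve of length `L = 2K(q)/w` that comes from the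
calibration by the elastica of modulus `q`, rescaled to the same length. Here `σ = ±1` is the
horizontal direction of the curve at its midpoint. -/
lemma IsSymCurve.energy_ge (h : IsSymCurve γ) (hq : q ∈ Ico (0 : ℝ) 1) (hα : 0 < arcScale q)
    (hlam : lam = 2 * arcScale q ^ 2 * (2 * q ^ 2 - 1)) :
    energy lam (arcUnit q) +
      (2 * (2 * compK q / length γ - arcScale q) ^ 2 * ((2 * q ^ 2 - 1) * length γ - 1) +
      2 * (2 * compK q / length γ) ^ 2 * (1 - arcDeriv γ γ (1 / 2) 0)) ≤ energy lam γ ∧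
    (energy lam γ ≤ energy lam (arcUnit q) +
      (2 * (2 * compK q / length γ - arcScale q) ^ 2 * ((2 * q ^ 2 - 1) * length γ - 1) +
      2 * (2 * compK q / length γ) ^ 2 * (1 - arcDeriv γ γ (1 / 2) 0)) →
      ∀ x ∈ Icc (1 / 2 : ℝ) 1, arcDeriv γ γ (1 / 2) 0 * arcDeriv γ γ x 0 =
        arcTangent q (2 * compK q / length γ * (arclength γ x - length γ / 2)) 0) := by
  have hL := h.imm.length_pos
  have hKpos := compK_pos hq
  set K := compK q with hKdef
  set L := length γ with hLdef
  set σ := arcDeriv γ γ (1 / 2) 0 with hσ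
  set w := 2 * K / L with hw
  have hwpos : 0 < w := by positivity
  have hwL : w * L = 2 * K := by rw [hw]; field_simp
  have hα2 : arcScale q = 2 * (2 * compE q - K) := rfl
  have hframe := h.isHalfFrame
  have hphase : phase (1 / 2) w (fun x => ‖velocity γ x‖) 1 = compK q := h.phase_one q
  have hspan := h.integral_one_sub_c
  have hbend := h.bending_eq
  rw [← hσ, ← hLdef] at hspan
  -- the calibrated lower bound, rewritten in terms of the energy of the longer arc
  have hid : energy lam (arcUnit q) +
      (2 * (w - arcScale q) ^ 2 * ((2 * q ^ 2 - 1) * L - 1) + 2 * w ^ 2 * (1 - σ)) =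
      2 * (4 * w * ((q ^ 2 - 2) * K + 2 * compE q) + 2 * w ^ 2 * ((L - σ) / 2)) + lam * L := by
    rw [energy_arcUnit hq hα hlam, hlam, ← hKdef]
    have hE : compE q = arcScale q / 4 + K / 2 := by rw [hα2]; ring
    rw [hE]
    have hK : K = w * L / 2 := by linarith
    rw [hK]
    ring
  have hE : energy lam γ = bending γ + lam * L := rfl
  rw [hid, hE, hbend]
  constructor
  · have hx₁ : (3 / 4 : ℝ) ∈ Ioo (1 / 2 : ℝ) 1 := by constructor <;> norm_num
    have hcal := hframe.calibration hq hwpos hphase hx₁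
    rw [hspan] at hcal
    have hpos : 0 ≤ ∫ x in (3 / 4 : ℝ)..1, w ^ 2 *
        calib q (phase (1 / 2) w (fun x => ‖velocity γ x‖) x) ^ 2 *
        gap q (1 / 2) w (fun x => σ * arcDeriv γ γ x 0) (fun x => ‖velocity γ x‖) x ^ 2 *
        ‖velocity γ x‖ :=
      intervalIntegral.integral_nonneg (by norm_num) fun x _ => by positivity
    linarith
  · intro hle x hx
    have heq := hframe.eq_of_calibration_eq hq hwpos hphase (by rw [hspan]; linarith) x hx
    rw [h.phase_eq w hx] at heq
    rw [arcTangent_apply_zero]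
    exact heq

/-- Curves that are neither very short nor very long have energy bounded from below, since their
tangent has to turn by a definite amount. -/
lemma IsSymCurve.two_mul_div_le_bending (h : IsSymCurve γ) :
    2 * (length γ - 1) / length γ ^ 2 ≤ bending γ := by
  have hL := h.imm.length_pos
  have hframe := h.isHalfFrame
  have hspan := h.integral_one_sub_c
  have hhalf := h.integral_norm_velocity_half
  have hbend := h.bending_eq
  have h1mem := right_mem_Icc.2 (zero_le_one' ℝ)
  set B := ∫ x in (1 / 2 : ℝ)..1, turning γ x ^ 2 / ‖velocity γ x‖ with hB
  set L := length γ with hLdef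
  set σ := arcDeriv γ γ (1 / 2) 0 with hσ
  have hσ1 : σ ≤ 1 := by nlinarith [h.tangent_half.1]
  have hle : ∀ x ∈ Ioo (1 / 2 : ℝ) 1, (1 - σ * arcDeriv γ γ x 0) * ‖velocity γ x‖ ≤
      2 * (B * (L / 2)) * ‖velocity γ x‖ := by
    intro x hx
    have hxI := Ioo_subset_Icc_self hx
    have hx' := half_one_subset hxI
    refine mul_le_mul_of_nonneg_right ?_ (norm_nonneg _)
    refine (hframe.one_sub_c_le (Ioo_subset_Ioc_self hx)).trans ?_
    have hpos1 : ∀ t ∈ Icc (1 / 2 : ℝ) 1, 0 ≤ turning γ t ^ 2 / ‖velocity γ t‖ :=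
      fun t _ => by positivity
    have e1 : ∫ t in (1 / 2 : ℝ)..x, turning γ t ^ 2 / ‖velocity γ t‖ ≤ B :=
      intervalIntegral.integral_mono_interval le_rfl hx.1.le hx.2.le
        ((ae_restrict_iff' measurableSet_Ioc).2 (Eventually.of_forall fun t ht =>
          hpos1 t (Ioc_subset_Icc_self ht)))
        (hframe.intervalIntegrable_energy (left_mem_Icc.2 (by norm_num))
          (right_mem_Icc.2 (by norm_num)))
    have e2 : ∫ t in (1 / 2 : ℝ)..x, ‖velocity γ t‖ ≤ L / 2 := by
      rw [← hhalf]
      exact intervalIntegral.integral_mono_interval le_rfl hx.1.le hx.2.le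
        (Eventually.of_forall fun t => norm_nonneg _)
        (h.imm.intervalIntegrable_norm_velocity half_mem h1mem)
    have e3 : 0 ≤ ∫ t in (1 / 2 : ℝ)..x, ‖velocity γ t‖ :=
      intervalIntegral.integral_nonneg hx.1.le fun t _ => norm_nonneg _
    have e4 : 0 ≤ B := intervalIntegral.integral_nonneg (by norm_num) hpos1
    have := mul_le_mul e1 e2 e3 e4
    linarith
  have hint : ∫ x in (1 / 2 : ℝ)..1, (1 - σ * arcDeriv γ γ x 0) * ‖velocity γ x‖ ≤
      ∫ x in (1 / 2 : ℝ)..1, 2 * (B * (L / 2)) * ‖velocity γ x‖ := by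
    refine intervalIntegral.integral_mono_on_of_le_Ioo (by norm_num) ?_
      ((h.imm.intervalIntegrable_norm_velocity half_mem h1mem).const_mul _) hle
    refine ContinuousOn.intervalIntegrable ?_
    have hc := hframe.ac_c.continuousOn
    rw [uIcc_of_le (by norm_num)] at hc ⊢
    exact (continuousOn_const.sub hc).mul hframe.continuousOn_v
  rw [hspan, intervalIntegral.integral_const_mul, hhalf] at hint
  rw [hbend, div_le_iff₀ (by positivity)]
  nlinarith

/-- A symmetric curve whose right half has the tangent of the longer arc is the longer arc. -/
lemma IsSymCurve.isArclengthParam (h : IsSymCurve γ) (hq : q ∈ Ico (0 : ℝ) 1)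
    (hα : 0 < arcScale q) (hL : length γ = arcLength q)
    (hT : ∀ x ∈ Icc (1 / 2 : ℝ) 1, ∀ i,
      arcDeriv γ γ x i = arcTangent q (arcScale q * arclength γ x - compK q) i) :
    IsArclengthParam γ (arc q) := by
  have hright : ∀ x ∈ Icc (1 / 2 : ℝ) 1, γ x = arc q (arclength γ x) := by
    have hder : ∀ x ∈ Icc (1 / 2 : ℝ) 1,
        HasDerivWithinAt (fun x => γ x - arc q (arclength γ x)) 0 (Icc (1 / 2) 1) x := by
      intro x hx
      have hx' := half_one_subset hx
      have h1 := (hasDerivAt_arc hq hα (arclength γ x)).scomp_hasDerivWithinAt x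
        (h.imm.hasDerivWithinAt_arclength hx')
      have h2 := ((h.imm.hasDerivWithinAt hx').sub h1).mono half_one_subset
      refine h2.congr_deriv ?_
      rw [sub_eq_zero]
      ext i
      rw [h.imm.velocity_eq hx' i, hT x hx i, PiLp.smul_apply, smul_eq_mul, mul_comm]
    have hconst : ∀ x ∈ Icc (1 / 2 : ℝ) 1, γ x - arc q (arclength γ x) =
        γ (1 / 2) - arc q (arclength γ (1 / 2)) := by
      refine constant_of_derivWithin_zero (fun x hx => (hder x hx).differentiableWithinAt)
        fun x hx => ?_
      exact (hder x (Ico_subset_Icc_self hx)).derivWithin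
        (uniqueDiffOn_Icc (by norm_num) x (Ico_subset_Icc_self hx))
    have hone : γ 1 - arc q (arclength γ 1) = 0 := by
      rw [show arclength γ 1 = length γ from rfl, hL, arc_arcLength hq hα, h.end_eq, sub_self]
    intro x hx
    rw [← sub_eq_zero, hconst x hx, ← hconst 1 (right_mem_Icc.2 (by norm_num)), hone]
  intro x hx
  rcases le_total (1 / 2) x with hle | hle
  · exact hright x ⟨hle, hx.2⟩
  · have hx1 := one_sub_mem_Icc hx
    have h1 := hright (1 - x) ⟨by linarith, hx1.2⟩
    have h2 := h.symm (1 - x) hx1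
    rw [sub_sub_cancel] at h2
    rw [h2, h1, h.arclength_one_sub hx, hL, arc_arcLength_sub hq hα]
    ext i; fin_cases i <;> simp

/-- An admissible curve passes above each point of `(0,1)`. -/
lemma exists_apply_zero_eq {ψ : ℝ → ℝ} (h : γ ∈ admissible ψ) {x₀ : ℝ} (hx₀ : x₀ ∈ Icc (0 : ℝ) 1) :
    ∃ x ∈ Icc (0 : ℝ) 1, γ x 0 = x₀ ∧ ψ x₀ ≤ γ x 1 := by
  have hc : ContinuousOn (fun x => γ x 0) (Icc 0 1) :=
    (EuclideanSpace.proj (𝕜 := ℝ) (0 : Fin 2)).continuous.comp_continuousOn h.1.1.1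
  have h0 : γ 0 0 = 0 := by rw [h.2.1]; rfl
  have h1 : γ 1 0 = 1 := by rw [h.2.2.1]; rfl
  have hiv := intermediate_value_Icc zero_le_one hc
  rw [h0, h1] at hiv
  obtain ⟨x, hx, hxeq⟩ := hiv hx₀
  have hxeq' : γ x 0 = x₀ := hxeq
  exact ⟨x, hx, hxeq', by rw [← hxeq']; exact h.2.2.2 x hx⟩

/-- The obstacle forces a definite excess of length. -/
lemma exists_length_ge {ψ : ℝ → ℝ} (hψ : IsObstacle ψ) :
    ∃ δ : ℝ, 0 < δ ∧ ∀ γ ∈ admissible ψ, 1 + δ ≤ length γ := by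
  obtain ⟨x₀, hx₀, hpos⟩ := hψ.pos_somewhere
  refine ⟨√(x₀ ^ 2 + ψ x₀ ^ 2) + √((1 - x₀) ^ 2 + ψ x₀ ^ 2) - 1, ?_, fun γ hγ => ?_⟩
  · have h1 : x₀ < √(x₀ ^ 2 + ψ x₀ ^ 2) := Real.lt_sqrt_of_sq_lt (by nlinarith)
    have h2 : 1 - x₀ < √((1 - x₀) ^ 2 + ψ x₀ ^ 2) := Real.lt_sqrt_of_sq_lt (by nlinarith)
    linarith
  · obtain ⟨x, hx, hxeq, hle⟩ := exists_apply_zero_eq hγ hx₀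
    have e1 := hγ.1.norm_sub_le (left_mem_Icc.2 zero_le_one) hx hx.1
    have e2 := hγ.1.norm_sub_le hx (right_mem_Icc.2 zero_le_one) hx.2
    have hsq : ψ x₀ ^ 2 ≤ γ x 1 ^ 2 := pow_le_pow_left₀ hpos.le hle 2
    have f1 : √(x₀ ^ 2 + ψ x₀ ^ 2) ≤ ‖γ x - γ 0‖ := by
      rw [plane_norm]
      refine Real.sqrt_le_sqrt ?_
      simp [hγ.2.1, hxeq, hsq]
    have f2 : √((1 - x₀) ^ 2 + ψ x₀ ^ 2) ≤ ‖γ 1 - γ x‖ := by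
      rw [plane_norm]
      refine Real.sqrt_le_sqrt ?_
      simp [hγ.2.2.1, hxeq, hsq]
    have hadj := intervalIntegral.integral_add_adjacent_intervals
      (hγ.1.intervalIntegrable_norm_velocity (left_mem_Icc.2 zero_le_one) hx)
      (hγ.1.intervalIntegrable_norm_velocity hx (right_mem_Icc.2 zero_le_one))
    rw [length, arclength, ← hadj]
    linarith

/-- The longer arc and its mirror image have the same first component of the tangent; the obstacle
rules out the mirror image. -/
lemma tangent_eq_of_apply_zero_eq {ψ : ℝ → ℝ} (hψ : IsObstacle ψ) (hγ : γ ∈ admissibleSym ψ)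
    (hq : q ∈ Ioo (0 : ℝ) 1) (hα : 0 < arcScale q) (hL : length γ = arcLength q)
    (hT : ∀ x ∈ Icc (1 / 2 : ℝ) 1,
      arcDeriv γ γ x 0 = arcTangent q (arcScale q * arclength γ x - compK q) 0) :
    ∀ x ∈ Icc (1 / 2 : ℝ) 1, ∀ i,
      arcDeriv γ γ x i = arcTangent q (arcScale q * arclength γ x - compK q) i := by
  have hq' : q ∈ Ico (0 : ℝ) 1 := Ioo_subset_Ico_self hq
  have h := isSymCurve_of_mem_admissibleSym hγ
  have hαL := arcScale_mul_arcLength hα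
  have hframe := h.isHalfFrame
  -- the second component of the tangent of the arc is negative on the right half
  have hphase : ∀ x ∈ Icc (1 / 2 : ℝ) 1, arcScale q * arclength γ x - compK q =
      phase (1 / 2) (arcScale q) (fun x => ‖velocity γ x‖) x := fun x hx => by
    rw [h.phase_eq _ hx, hL]
    linear_combination (1 / 2) * hαL
  have hend : phase (1 / 2) (arcScale q) (fun x => ‖velocity γ x‖) 1 = compK q := by
    rw [← hphase 1 (right_mem_Icc.2 (by norm_num)), show arclength γ 1 = length γ from rfl, hL, hαL]
    ring
  have hneg : ∀ x ∈ Ioc (1 / 2 : ℝ) 1,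
      arcTangent q (arcScale q * arclength γ x - compK q) 1 < 0 := by
    intro x hx
    rw [hphase x (Ioc_subset_Icc_self hx), arcTangent_apply_one]
    have h1 := hframe.jacobiSn_phase_pos hq' hα hend hx
    have h2 := jacobiDn_pos hq' (phase (1 / 2) (arcScale q) (fun x => ‖velocity γ x‖) x)
    have h3 := hq.1
    have : 0 < 2 * q * jacobiSn (phase (1 / 2) (arcScale q) (fun x => ‖velocity γ x‖) x) q *
      jacobiDn (phase (1 / 2) (arcScale q) (fun x => ‖velocity γ x‖) x) q := by positivity
    linarith
  have hsq : ∀ x ∈ Icc (1 / 2 : ℝ) 1, arcDeriv γ γ x 1 ^ 2 =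
      arcTangent q (arcScale q * arclength γ x - compK q) 1 ^ 2 := by
    intro x hx
    have h1 := h.imm.tangent_sq_add (half_one_subset hx)
    have h2 := plane_norm_sq (arcTangent q (arcScale q * arclength γ x - compK q))
    rw [norm_arcTangent hq', ← hT x hx] at h2
    linarith
  have hTc : ContinuousOn (fun x => arcDeriv γ γ x 1) (Icc 0 1) := by
    simpa [uIcc_of_le zero_le_one] using (h.imm.tangent_absolutelyContinuous 1).continuousOn
  have hne : ∀ x ∈ Ioc (1 / 2 : ℝ) 1, arcDeriv γ γ x 1 ≠ 0 := by
    intro x hx h0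
    have := hsq x (Ioc_subset_Icc_self hx)
    rw [h0] at this
    nlinarith [hneg x hx]
  -- if the tangent pointed upwards at the endpoint, the whole curve would lie below the axis
  have hone : arcDeriv γ γ 1 1 < 0 := by
    by_contra hcon
    have hsign : ∀ x ∈ Ioc (1 / 2 : ℝ) 1, 0 < arcDeriv γ γ x 1 := by
      intro x hx
      by_contra hx0
      have hsub : Icc x 1 ⊆ Icc 0 1 := Icc_subset_Icc_left (half_mem.1.trans hx.1.le)
      obtain ⟨y, hy, hy0⟩ := intermediate_value_Icc hx.2 (hTc.mono hsub)
        (⟨not_lt.1 hx0, not_lt.1 hcon⟩ : (0 : ℝ) ∈ Icc _ _)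
      exact hne y ⟨hx.1.trans_le hy.1, hy.2⟩ hy0
    have hmono : MonotoneOn (fun x => γ x 1) (Icc (1 / 2 : ℝ) 1) := by
      have hd := fun x (hx : x ∈ Icc (0 : ℝ) 1) =>
        (hasDerivWithinAt_plane.1 (h.imm.hasDerivWithinAt hx)) 1
      refine monotoneOn_of_hasDerivWithinAt_nonneg (f' := fun x => velocity γ x 1) (convex_Icc _ _)
        (fun x hx => ((hd x (half_one_subset hx)).continuousWithinAt).mono half_one_subset)
        (fun x hx => ?_) (fun x hx => ?_)
      · exact (hd x (half_one_subset (interior_subset hx))).mono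
          (interior_subset.trans half_one_subset)
      · rw [interior_Icc] at hx
        rw [h.imm.velocity_eq (half_one_subset (Ioo_subset_Icc_self hx))]
        exact mul_nonneg (hsign x (Ioo_subset_Ioc_self hx)).le (norm_nonneg _)
    have hright : ∀ x ∈ Icc (1 / 2 : ℝ) 1, γ x 1 ≤ 0 := by
      intro x hx
      have h1 : γ x 1 ≤ γ 1 1 := hmono hx (right_mem_Icc.2 (by norm_num)) hx.2
      have h2 : γ 1 1 = 0 := by rw [h.end_eq]; rfl
      linarith
    obtain ⟨x₀, hx₀, hpos⟩ := hψ.pos_somewhere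
    obtain ⟨x, hx, -, hle⟩ := exists_apply_zero_eq hγ.1 hx₀
    have hx1 : γ x 1 ≤ 0 := by
      rcases le_total (1 / 2) x with hc | hc
      · exact hright x ⟨hc, hx.2⟩
      · have h1 := hright (1 - x) ⟨by linarith, (one_sub_mem_Icc hx).2⟩
        rw [h.symm x hx] at h1
        simpa using h1
    linarith
  have hlt : ∀ x ∈ Ioc (1 / 2 : ℝ) 1, arcDeriv γ γ x 1 < 0 := by
    intro x hx
    by_contra hx0
    have hsub : Icc x 1 ⊆ Icc 0 1 := Icc_subset_Icc_left (half_mem.1.trans hx.1.le)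
    obtain ⟨y, hy, hy0⟩ := intermediate_value_Icc' hx.2 (hTc.mono hsub)
      (⟨hone.le, not_lt.1 hx0⟩ : (0 : ℝ) ∈ Icc _ _)
    exact hne y ⟨hx.1.trans_le hy.1, hy.2⟩ hy0
  intro x hx i
  fin_cases i
  · exact hT x hx
  · change arcDeriv γ γ x 1 = arcTangent q (arcScale q * arclength γ x - compK q) 1
    rcases hx.1.eq_or_lt with heq | hlt'
    · have h1 := hsq x hx
      rw [← heq, h.tangent_half.2] at h1 ⊢
      nlinarith
    · have h1 := hlt x ⟨hlt', hx.2⟩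
      have h2 := hneg x ⟨hlt', hx.2⟩
      rcases sq_eq_sq_iff_eq_or_eq_neg.1 (hsq x hx) with h3 | h3
      · exact h3
      · linarith

/-- Global minimality and uniqueness of the longer arc: a symmetric admissible curve with at most
the energy of the longer arc is the longer arc, provided that the latter has less energy than all
curves of bounded length. -/
lemma eq_arc_of_energy_le {ψ : ℝ → ℝ} (hψ : IsObstacle ψ) {δ : ℝ} (hδ : 0 < δ)
    (hlen : 1 + δ ≤ length γ) (hγ : γ ∈ admissibleSym ψ) (hq : q ∈ Ioo (0 : ℝ) 1)
    (hα : 0 < arcScale q) {p : ℝ} (hp : 0 < p) (hpq : p ≤ 2 * q ^ 2 - 1)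
    (hlam : lam = 2 * arcScale q ^ 2 * (2 * q ^ 2 - 1))
    (hsmall : energy lam (arcUnit q) < 2 * δ * p ^ 2)
    (hle : energy lam γ ≤ energy lam (arcUnit q)) :
    energy lam γ = energy lam (arcUnit q) ∧ length γ = arcLength q ∧
      IsArclengthParam γ (arc q) := by
  have hq' : q ∈ Ico (0 : ℝ) 1 := Ioo_subset_Ico_self hq
  have h := isSymCurve_of_mem_admissibleSym hγ
  have hL := h.imm.length_pos
  have hK := compK_pos hq'
  have hp2 : 0 < 2 * q ^ 2 - 1 := hp.trans_le hpq
  have hlampos : 0 < lam := by rw [hlam]; positivity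
  -- short curves have too much bending energy
  have hlong : 0 < (2 * q ^ 2 - 1) * length γ - 1 := by
    by_contra hcon
    have h1 : p * length γ ≤ 1 := by nlinarith
    have h2 := h.two_mul_div_le_bending
    have h3 : 2 * δ * p ^ 2 ≤ 2 * (length γ - 1) / length γ ^ 2 := by
      rw [le_div_iff₀ (by positivity)]
      have h4 : (p * length γ) ^ 2 ≤ 1 := pow_le_one₀ (by positivity) h1
      nlinarith
    have h5 : bending γ ≤ energy lam γ := by
      have : energy lam γ = bending γ + lam * length γ := rfl
      have := mul_pos hlampos hL
      linarith
    linarith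
  obtain ⟨hge, heq⟩ := h.energy_ge hq' hα hlam
  set w := 2 * compK q / length γ with hw
  have hwpos : 0 < w := by positivity
  have hσ := h.tangent_half.1
  have hσ1 : arcDeriv γ γ (1 / 2) 0 ≤ 1 := by nlinarith
  have t1 : 0 ≤ 2 * (w - arcScale q) ^ 2 * ((2 * q ^ 2 - 1) * length γ - 1) := by positivity
  have t2 : 0 ≤ 2 * w ^ 2 * (1 - arcDeriv γ γ (1 / 2) 0) :=
    mul_nonneg (by positivity) (by linarith)
  have t3 : 2 * (w - arcScale q) ^ 2 * ((2 * q ^ 2 - 1) * length γ - 1) = 0 := by linarith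
  have t4 : 2 * w ^ 2 * (1 - arcDeriv γ γ (1 / 2) 0) = 0 := by linarith
  have hwα : w = arcScale q := by
    have h1 : 2 * (w - arcScale q) ^ 2 = 0 := (mul_eq_zero.1 t3).resolve_right hlong.ne'
    have h2 : (w - arcScale q) ^ 2 = 0 := by linarith
    exact sub_eq_zero.1 (pow_eq_zero_iff two_ne_zero |>.1 h2)
  have hσeq : arcDeriv γ γ (1 / 2) 0 = 1 := by
    have h1 := (mul_eq_zero.1 t4).resolve_left (by positivity)
    linarith
  have hLeq : length γ = arcLength q := by
    rw [arcLength, ← hwα, hw]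
    field_simp
  have hT := heq (by linarith)
  refine ⟨by linarith, hLeq, h.isArclengthParam hq' hα hLeq
    (tangent_eq_of_apply_zero_eq hψ hγ hq hα hLeq fun x hx => ?_)⟩
  have harg : arcScale q * (arclength γ x - length γ / 2) =
      arcScale q * arclength γ x - compK q := by
    rw [hLeq]
    linear_combination (-1 / 2 : ℝ) * arcScale_mul_arcLength hα
  have h1 := hT x hx
  rwa [hσeq, one_mul, hwα, harg] at h1

end

/-! ### Small penalization -/

/-- Smallness conditions on the scale `α` of the longer arc. The first puts the arc above the
obstacle; by the second, it has less energy than every symmetric curve with length between `1 + δ`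
and `1 / (2q̂² - 1)`. -/
lemma exists_small_scale {ψ : ℝ → ℝ} (hψ : IsObstacle ψ) {δ : ℝ} (hδ : 0 < δ) :
    ∃ ε : ℝ, 0 < ε ∧ ∃ M : ℝ, (∀ x ∈ Icc (0 : ℝ) 1, ψ x ≤ M) ∧
      ∀ α : ℝ, 0 < α → α < ε → (α * M) ^ 2 < 2 * (2 * qHat ^ 2 - 1) ∧
        2 * α ^ 2 + 8 * α * compK qStar < 2 * δ * (2 * qHat ^ 2 - 1) ^ 2 := by
  obtain ⟨M, hM⟩ := isCompact_Icc.bddAbove_image (hψ.uniformContinuous.continuous.continuousOn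
    (s := Icc (0 : ℝ) 1))
  have hp : 0 < 2 * qHat ^ 2 - 1 := by linarith [half_lt_qHat_sq]
  have h1 : Tendsto (fun α : ℝ => (α * M) ^ 2) (𝓝 0) (𝓝 0) := by
    have : Continuous fun α : ℝ => (α * M) ^ 2 := by fun_prop
    simpa using this.tendsto 0
  have h2 : Tendsto (fun α : ℝ => 2 * α ^ 2 + 8 * α * compK qStar) (𝓝 0) (𝓝 0) := by
    have : Continuous fun α : ℝ => 2 * α ^ 2 + 8 * α * compK qStar := by fun_prop
    simpa using this.tendsto 0
  have h3 := (h1.eventually_lt_const (u := 2 * (2 * qHat ^ 2 - 1)) (by positivity)).and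
    (h2.eventually_lt_const (u := 2 * δ * (2 * qHat ^ 2 - 1) ^ 2) (by positivity))
  obtain ⟨ε, hε, hball⟩ := Metric.eventually_nhds_iff.1 h3
  refine ⟨ε, hε, M, fun x hx => hM (mem_image_of_mem _ hx), fun α hα hαε => hball ?_⟩
  rw [Real.dist_eq, sub_zero, abs_of_pos hα]
  exact hαε

end ElasticObstacle

open ElasticObstacle

theorem theorem1p2 (ψ : ℝ → ℝ) (hψ : ElasticObstacle.IsObstacle ψ) :
    ∃ lamBar : ℝ, 0 < lamBar ∧ lamBar ≤ ElasticObstacle.lambdaHat ∧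
      ∀ lam ∈ Set.Ioo 0 lamBar,
        -- no minimizer touches the obstacle
        (∀ γ ∈ ElasticObstacle.symMinimizers ψ lam,
          ElasticObstacle.coincidenceSet ψ γ = ∅) ∧
        -- the longer arc is a critical point
        ElasticObstacle.IsPenalizedPinnedElastica lam (ElasticObstacle.larcLength lam 1)
          (ElasticObstacle.larc lam 1) ∧
        -- its constant speed parametrization on the unit interval is a minimizer
        (fun x => ElasticObstacle.larc lam 1 (ElasticObstacle.larcLength lam 1 * x)) ∈
          ElasticObstacle.symMinimizers ψ lam ∧
        -- up to reparametrization there is no other minimizer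
        (∀ γ ∈ ElasticObstacle.symMinimizers ψ lam,
          ElasticObstacle.length γ = ElasticObstacle.larcLength lam 1 ∧
            ElasticObstacle.IsArclengthParam γ (ElasticObstacle.larc lam 1)) := by
  obtain ⟨δ, hδ, hlen⟩ := exists_length_ge hψ
  obtain ⟨ε, hε, M, hM, hsmall⟩ := exists_small_scale hψ hδ
  have hp : 0 < 2 * qHat ^ 2 - 1 := by linarith [half_lt_qHat_sq]
  refine ⟨min lambdaHat (2 * ε ^ 2 * (2 * qHat ^ 2 - 1)),
    lt_min lambdaHat_pos (by positivity), min_le_left _ _, fun lam hlam => ?_⟩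
  obtain ⟨hqmem, hg⟩ := qTwo_spec ⟨hlam.1, (hlam.2.trans_le (min_le_left _ _)).le⟩
  rw [larc_one, larcLength_one]
  set q := qTwo lam with hqdef
  have hq0 : 0 < q := qHat_pos.trans_le hqmem.1
  have hq : q ∈ Ioo (0 : ℝ) 1 := ⟨hq0, hqmem.2.trans qStar_mem.2⟩
  have hq' : q ∈ Ico (0 : ℝ) 1 := Ioo_subset_Ico_self hq
  have hα : 0 < arcScale q := mul_pos two_pos (two_compE_sub_compK_pos_of_lt_qStar hq0.le hqmem.2)
  have hpq : 2 * qHat ^ 2 - 1 ≤ 2 * q ^ 2 - 1 := by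
    have := pow_le_pow_left₀ qHat_pos.le hqmem.1 2
    linarith
  have hlameq : lam = 2 * arcScale q ^ 2 * (2 * q ^ 2 - 1) := by
    rw [← hg, gAux, arcScale]; ring
  have hαε : arcScale q < ε := by
    refine lt_of_pow_lt_pow_left₀ 2 hε.le ?_
    have h1 : lam < 2 * ε ^ 2 * (2 * qHat ^ 2 - 1) := hlam.2.trans_le (min_le_right _ _)
    have h2 : 2 * arcScale q ^ 2 * (2 * qHat ^ 2 - 1) ≤ lam := by
      rw [hlameq]; gcongr
    have h3 := h2.trans_lt h1
    nlinarith
  obtain ⟨hs1, hs2⟩ := hsmall _ hα hαε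
  have habove : ∀ s ∈ Icc 0 (arcLength q), ψ (arc q s 0) < arc q s 1 := fun s hs =>
    lt_arc_one hψ hq' hα hM (hs1.trans_le (by linarith)) hs
  have hadm : arcUnit q ∈ admissibleSym ψ := arcUnit_mem_admissibleSym hq' hα habove
  have henergy : energy lam (arcUnit q) < 2 * δ * (2 * qHat ^ 2 - 1) ^ 2 := by
    refine lt_of_le_of_lt ?_ hs2
    rw [energy_arcUnit hq' hα hlameq]
    have hK := compK_mono hq0.le hqmem.2.le qStar_mem.2
    have hK0 := compK_pos hq'
    have h1 : compK q * (2 * q ^ 2 - 1) ≤ compK qStar := by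
      have h2 : 2 * q ^ 2 - 1 ≤ 1 := by nlinarith [hq.1, hq.2]
      nlinarith
    nlinarith
  have hmain : ∀ γ ∈ admissibleSym ψ, energy lam γ ≤ energy lam (arcUnit q) →
      energy lam γ = energy lam (arcUnit q) ∧ length γ = arcLength q ∧
        IsArclengthParam γ (arc q) := fun γ hγ hle =>
    eq_arc_of_energy_le hψ hδ (hlen γ hγ.1) hγ hq hα hp hpq hlameq henergy hle
  have huniq : ∀ γ ∈ symMinimizers ψ lam, length γ = arcLength q ∧ IsArclengthParam γ (arc q) :=
    fun γ hγ => (hmain γ hγ.1 (hγ.2 _ hadm)).2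
  refine ⟨fun γ hγ => ?_, isPenalizedPinnedElastica_arc hq' hα hlameq, ⟨hadm, fun γ hγ => ?_⟩,
    huniq⟩
  · obtain ⟨hL, hpar⟩ := huniq γ hγ
    refine eq_empty_iff_forall_notMem.2 fun x hx => ?_
    have himm := hγ.1.1.1
    have hs : arclength γ x ∈ Icc 0 (arcLength q) := by
      rw [← hL]
      refine ⟨intervalIntegral.integral_nonneg hx.1.1 fun t _ => norm_nonneg _, ?_⟩
      exact intervalIntegral.integral_mono_interval le_rfl hx.1.1 hx.1.2
        (Eventually.of_forall fun t => norm_nonneg _)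
        (himm.intervalIntegrable_norm_velocity (left_mem_Icc.2 zero_le_one)
          (right_mem_Icc.2 zero_le_one))
    have h1 := habove _ hs
    rw [← hpar x hx.1] at h1
    exact h1.ne' hx.2
  · rcases le_total (energy lam γ) (energy lam (arcUnit q)) with h | h
    · exact (hmain γ hγ h).1.ge
    · exact h
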